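/- Let $d\ge 1$, let $H_0$ be a bounded self-adjoint operator on $\ell^2(\mathbb Z^d)$ commuting with all translations of $\mathbb Z^d$, and let $\omega=(\omega_j)_{j\in\mathbb Z^d}$ be independent real random variables with common distribution $\mu$. Consider the Anderson model $H^\omega=H_0+\sum_{j\in\mathbb Z^d}\omega_jP_j$, where $P_j$ is the orthogonal projection onto $\ell^2(\{j\})$; for finite $\Lambda\subset\mathbb Z^d$ let $H^\omega_\Lambda$ be the compression of $H^\omega$ to $\ell^2(\Lambda)$. Assume: (1) $\mu$ is uniformly $\alpha$-Hölder continuous for some $0<\alpha\le 1$: there is $C<\infty$ with $\mu([x,x+r])\le C r^\alpha$ for all $x\in\mathbb R$, $r\ge 0$. (2) (Fractional-moment localization on $[a,b]$, $a<b$.) There are $s>0$, $\kappa>0$, $C<\infty$ such that for every sufficiently large cube $\Lambda\subset\mathbb Z^d$ and all $n,m\in\Lambda$, $$\sup_{\operatorname{Im}z>0,\ \operatorname{Re}z\in[a,b]}\mathbb E\left(|\langle\delta_n,(H^\omega_\Lambda-z)^{-1}\delta_m\rangle|^s\right)\le C e^{-\kappa|n-m|}.$$ Let $E\in[a,b]$,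 $\Lambda_L=\{-L,\dots,L\}^d$, $\beta_L=(2L+1)^{d/\alpha}$, and for $I\subset\mathbb R$ let $\xi^\omega_{L,E}(I)$ be the number of eigenvalues $\lambda$ of $H^\omega_{\Lambda_L}$, counted with multiplicity, with $\beta_L(\lambda-E)\in I$. Let $I$ be a bounded open interval and let $L_1<L_2<\cdots$ be a sequence of nonnegative integers such that the limit $$\gamma_{E,I}=\lim_{n\to\infty}\mathbb E\left(\xi^\omega_{L_n,E}(I)\right)$$ exists, is finite and is nonzero. Then the random variables $\xi^\omega_{L_n,E}(I)$ converge in distribution, as $n\to\infty$, to a Poisson random variable with parameter $\gamma_{E,I}$. -/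

import Mathlib

open MeasureTheory ProbabilityTheory Filter Topology
open scoped NNReal ENNReal

noncomputable section

namespace Anderson

/-- The Hilbert space `ℓ²(ℤ^d)`. -/
abbrev L2 (d : ℕ) : Type := lp (fun _ : Fin d → ℤ => ℂ) 2

/-- The canonical basis vector `δ_x` of `ℓ²(ℤ^d)`. -/
def basisVec {d : ℕ} (x : Fin d → ℤ) : L2 d := lp.single 2 x (1 : ℂ)

/-- Translation by `k ∈ ℤ^d` on `ℓ²(ℤ^d)`: `(U_k ψ)(n) = ψ(n - k)`. -/
def translate {d : ℕ} (k : Fin d → ℤ) (ψ : L2 d) : L2 d :=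
  ⟨fun n => ψ (n - k), by
    have h := (memℓp_gen_iff (p := 2) (by norm_num)).1 (lp.memℓp ψ)
    exact (memℓp_gen_iff (p := 2) (by norm_num)).2
      (h.comp_injective (sub_left_injective (b := k)))⟩

/-- The operator commutes with all translations of `ℤ^d`. -/
def CommutesWithTranslations {d : ℕ} (H₀ : L2 d →L[ℂ] L2 d) : Prop :=
  ∀ (k : Fin d → ℤ) (ψ : L2 d), H₀ (translate k ψ) = translate k (H₀ ψ)

/-- The Anderson operator `H^ω = H₀ + ∑_j ω_j P_j` on `ℓ²(ℤ^d)` for a potential `ω : ℤ^d → ℝ`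
(possibly unbounded), on its maximal domain `{ψ : (ω_n ψ_n)_n ∈ ℓ²}`. -/
def hamiltonian {d : ℕ} (H₀ : L2 d →L[ℂ] L2 d) (ω : (Fin d → ℤ) → ℝ) : L2 d →ₗ.[ℂ] L2 d where
  domain :=
    { carrier := {ψ | Memℓp (fun n => (ω n : ℂ) * ψ n) 2}
      add_mem' := fun {φ ψ} hφ hψ => by
        have h := Memℓp.add hφ hψ
        have e : (fun n => (ω n : ℂ) * (φ + ψ : L2 d) n)
            = (fun n => (ω n : ℂ) * φ n) + fun n => (ω n : ℂ) * ψ n := by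
          funext n; simp [mul_add]
        simpa only [Set.mem_ofPred_eq, e] using h
      zero_mem' := by
        have e : (fun n => (ω n : ℂ) * (0 : L2 d) n) = 0 := by funext n; simp
        simpa only [Set.mem_ofPred_eq, e] using zero_memℓp
      smul_mem' := fun c ψ hψ => by
        have h := Memℓp.const_smul hψ c
        have e : (fun n => (ω n : ℂ) * (c • ψ : L2 d) n)
            = c • fun n => (ω n : ℂ) * ψ n := by
          funext n; simp [mul_left_comm]
        simpa only [Set.mem_ofPred_eq, e] using h }
  toFun :=
    { toFun := fun ψ => H₀ ψ.1 + ⟨fun n => (ω n : ℂ) * ψ.1 n, ψ.2⟩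
      map_add' := fun φ ψ => by
        ext n
        change (H₀ (φ.1 + ψ.1)) n + (ω n : ℂ) * (φ.1 n + ψ.1 n)
          = ((H₀ φ.1) n + (ω n : ℂ) * φ.1 n) + ((H₀ ψ.1) n + (ω n : ℂ) * ψ.1 n)
        rw [map_add, lp.coeFn_add, Pi.add_apply]
        ring
      map_smul' := fun c ψ => by
        ext n
        change (H₀ (c • ψ.1)) n + (ω n : ℂ) * (c * ψ.1 n)
          = c * ((H₀ ψ.1) n + (ω n : ℂ) * ψ.1 n)
        rw [map_smul, lp.coeFn_smul, Pi.smul_apply, smul_eq_mul]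
        ring }

theorem basisVec_mem_domain {d : ℕ} (H₀ : L2 d →L[ℂ] L2 d) (ω : (Fin d → ℤ) → ℝ)
    (x : Fin d → ℤ) : basisVec x ∈ (hamiltonian H₀ ω).domain := by
  have e : (fun n => (ω n : ℂ) * (basisVec x : L2 d) n)
      = ((ω x : ℂ) • (basisVec x : L2 d) : L2 d) := by
    funext n
    rw [lp.coeFn_smul, Pi.smul_apply, smul_eq_mul]
    by_cases h : n = x
    · rw [h]
    · simp [basisVec, h]
  change Memℓp (fun n => (ω n : ℂ) * (basisVec x : L2 d) n) 2
  rw [e]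
  exact lp.memℓp _

/-- The matrix (in the basis `δ_x`, `x ∈ Λ`) of the compression `H^ω_Λ` of `H^ω` to the
finite-dimensional subspace `ℓ²(Λ)`: its entries are `⟨δ_x, H^ω δ_y⟩`. -/
def compression {d : ℕ} (H₀ : L2 d →L[ℂ] L2 d) (ω : (Fin d → ℤ) → ℝ)
    (Λ : Finset (Fin d → ℤ)) : Matrix Λ Λ ℂ :=
  fun x y => inner ℂ (basisVec x.1) (hamiltonian H₀ ω ⟨basisVec y.1, basisVec_mem_domain H₀ ω y.1⟩)

theorem compression_apply {d : ℕ} (H₀ : L2 d →L[ℂ] L2 d) (ω : (Fin d → ℤ) → ℝ)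
    (Λ : Finset (Fin d → ℤ)) (x y : Λ) :
    compression H₀ ω Λ x y
      = inner ℂ (basisVec x.1) (H₀ (basisVec y.1)) + if x = y then (ω x.1 : ℂ) else 0 := by
  have h : hamiltonian H₀ ω ⟨basisVec y.1, basisVec_mem_domain H₀ ω y.1⟩
      = H₀ (basisVec y.1)
        + ⟨fun n => (ω n : ℂ) * (basisVec y.1 : L2 d) n, basisVec_mem_domain H₀ ω y.1⟩ := rfl
  rw [compression, h, inner_add_right]
  congr 1
  rw [basisVec, lp.inner_single_left]
  by_cases hxy : x = y
  · subst hxy; simp [basisVec]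
  · have : (x : Fin d → ℤ) ≠ y := fun h => hxy (Subtype.ext h)
    simp [basisVec, hxy, this]

theorem compression_isHermitian {d : ℕ} {H₀ : L2 d →L[ℂ] L2 d} (hH₀ : IsSelfAdjoint H₀)
    (ω : (Fin d → ℤ) → ℝ) (Λ : Finset (Fin d → ℤ)) : (compression H₀ ω Λ).IsHermitian := by
  ext x y
  have hs : inner ℂ (H₀ (basisVec y.1)) (basisVec x.1)
      = inner ℂ (basisVec y.1) (H₀ (basisVec x.1)) :=
    hH₀.isSymmetric (basisVec y.1) (basisVec x.1)
  rw [Matrix.conjTranspose_apply, compression_apply, compression_apply, star_add]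
  congr 1
  · rw [← hs]
    exact inner_conj_symm _ _
  · by_cases hxy : x = y
    · subst hxy; simp
    · simp [hxy, Ne.symm hxy]

/-- The cube `Λ_L = {-L, …, L}^d`, which has `(2L+1)^d` points. -/
def centeredCube (d L : ℕ) : Finset (Fin d → ℤ) :=
  Finset.Icc (fun _ => -(L : ℤ)) (fun _ => (L : ℤ))

/-- The cube `∏_i {c_i, …, c_i + ℓ}` of `ℤ^d`. -/
def cube {d : ℕ} (c : Fin d → ℤ) (ℓ : ℕ) : Finset (Fin d → ℤ) :=
  Finset.Icc c (fun i => c i + (ℓ : ℤ))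

/-- The scale `β_L = (2L+1)^(d/α)`. -/
def scale (d : ℕ) (α : ℝ) (L : ℕ) : ℝ := (2 * (L : ℝ) + 1) ^ ((d : ℝ) / α)

open Classical in
/-- `ξ_{L,E}^ω(I) = Tr(χ_{Λ_L} 1_I(β_L (H^ω_{Λ_L} - E)))`: the number of eigenvalues `λ` of
`H^ω_{Λ_L}`, counted with multiplicity, such that `β_L (λ - E) ∈ I`. -/
def rescaledCount {d : ℕ} {H₀ : L2 d →L[ℂ] L2 d} (hH₀ : IsSelfAdjoint H₀) (α : ℝ) (L : ℕ)
    (E : ℝ) (ω : (Fin d → ℤ) → ℝ) (I : Set ℝ) : ℕ :=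
  (Finset.univ.filter fun i : centeredCube d L =>
    scale d α L * ((compression_isHermitian hH₀ ω (centeredCube d L)).eigenvalues i - E) ∈ I).card

/-- `μ` is uniformly `α`-Hölder continuous: `μ(J) ≤ C |J|^α` for every compact interval `J`. -/
def UniformlyHolder (α : ℝ) (μ : Measure ℝ) : Prop :=
  ∃ C : ℝ≥0, ∀ x r : ℝ, 0 ≤ r → μ (Set.Icc x (x + r)) ≤ ENNReal.ofReal (C * r ^ α)

/-- Exponential localization on `[a, b]` through fractional moments of the Green functions of
all sufficiently large cubes `Λ`, uniformly in `Λ`: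
`𝔼 |⟨δ_n, (H^ω_Λ - z)⁻¹ δ_m⟩|^s ≤ C exp (-γ |n - m|)` for all `z` with `Im z > 0`
and `Re z ∈ [a, b]`. The norm on `ℤ^d` is the maximum norm. -/
def FractionalMomentLocalization {d : ℕ} (H₀ : L2 d →L[ℂ] L2 d) {Ω : Type*} [MeasurableSpace Ω]
    (P : Measure Ω) (V : (Fin d → ℤ) → Ω → ℝ) (a b : ℝ) : Prop :=
  ∃ s γ C : ℝ, 0 < s ∧ 0 < γ ∧ ∃ ℓ₀ : ℕ, ∀ (c : Fin d → ℤ) (ℓ : ℕ), ℓ₀ ≤ ℓ →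
    ∀ z : ℂ, 0 < z.im → z.re ∈ Set.Icc a b → ∀ n m : cube c ℓ,
      ∫⁻ ω, ENNReal.ofReal
          (‖((compression H₀ (fun j => V j ω) (cube c ℓ) - z • 1)⁻¹) n m‖ ^ s) ∂P
        ≤ ENNReal.ofReal (C * Real.exp (-γ * ‖n.1 - m.1‖))

end Anderson

end

/-! Since `scale d α L ^ α` is the number of sites of the cube, the rescaled count is, up to a small
error in mean, a sum of many independent counts, each rarely nonzero and even more rarely larger
than one. The law of rare events then gives the Poisson limit. Three ingredients carry this.

Wegner and Minami bounds. As a function of the potential `t` at one site, the diagonal resolvent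
entry at that site is `1 / (t + 1 / g)`, where `g` is the entry for `t = 0`. Its imaginary part is a
Poisson kernel in `t` at least as wide as the imaginary part of the spectral parameter
(`exists_siteSum_rankOne`), so Hölder continuity of `μ` bounds its average
(`lintegral_poissonKernel_le`). Summing over sites yields `wegner`: the mean count of a subset is at
most a constant times its share of the volume. Changing one potential value moves the count by at
most one (`card_eigenvalues_le_add_one`); averaging over one site while the other eigenvalues are
counted independently of it yields `minami`, a bound on the second factorial moment by the square of
the Wegner bound.

Decoupling. The cube is cut into blocks of side about the square root of its own. An eigenvalue
count is the trace of an indicator function of the operator, hence a sum of diagonal entries. Deep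
inside a block these entries change little in mean when the cube is replaced by the block. For
resolvents this follows from the geometric resolvent identity and localization
(`comparable_cauchyFun`); partial fractions and Stone–Weierstrass extend it to trapezoids, and
spectral averaging pays for the approximation errors, including those at the endpoints of the
interval (`comparable_indicator`). The other sites form a vanishing fraction and are handled by
spectral averaging (`eventually_lintegral_boxCount_sub_le`).

Poisson approximation. The block counts depend on disjoint sets of sites, so they are independent.
Each characteristic function is within the square of the block density of that of a Poisson variable
with the same mean, and the errors add up to a multiple of the density, which vanishes
(`norm_charFun_blockSum_sub_le`). Closeness in mean transfers both the characteristic functions and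
the convergence of expectations between the cube and the sum of blocks
(`tendsto_charFun_boxCount_sub`). -/

noncomputable section

namespace Anderson

/-! ### Functional calculus of Hermitian matrices and rank one stability of eigenvalue counts -/

section LinearAlgebra

variable {ι : Type*} [Fintype ι] [DecidableEq ι]

/-- The weight `|v_i(n)|²` of the `i`-th eigenvector at the site `n`. -/
def siteWeight {A : Matrix ι ι ℂ} (hA : A.IsHermitian) (n i : ι) : ℝ :=
  ‖hA.eigenvectorBasis i n‖ ^ 2

/-- The diagonal entry `⟨δ_n, f(A) δ_n⟩` of a function of a Hermitian matrix. -/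
def siteSum {A : Matrix ι ι ℂ} (hA : A.IsHermitian) {F : Type*} [AddCommGroup F] [Module ℝ F]
    (f : ℝ → F) (n : ι) : F :=
  ∑ i, siteWeight hA n i • f (hA.eigenvalues i)

section
variable {A : Matrix ι ι ℂ} (hA : A.IsHermitian)

theorem siteWeight_nonneg (n i : ι) : 0 ≤ siteWeight hA n i := by
  unfold siteWeight; positivity

theorem sum_siteWeight_left (i : ι) : ∑ n, siteWeight hA n i = 1 := by
  have h := hA.eigenvectorBasis.orthonormal.1 i
  have h2 := EuclideanSpace.norm_sq_eq (hA.eigenvectorBasis i)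
  rw [h, one_pow] at h2
  exact h2.symm

/-- `U diag(f(λ)) U*`. -/
def matrixFun (f : ℝ → ℂ) : Matrix ι ι ℂ :=
  (hA.eigenvectorUnitary : Matrix ι ι ℂ) * Matrix.diagonal (fun i => f (hA.eigenvalues i)) *
    star (hA.eigenvectorUnitary : Matrix ι ι ℂ)

theorem matrixFun_apply (f : ℝ → ℂ) (n m : ι) : matrixFun hA f n m =
    ∑ i, hA.eigenvectorBasis i n * f (hA.eigenvalues i) * star (hA.eigenvectorBasis i m) := by
  rw [matrixFun, Matrix.mul_apply]
  simp only [Matrix.mul_diagonal, Matrix.IsHermitian.eigenvectorUnitary_apply, Matrix.star_apply]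

theorem matrixFun_apply_self (f : ℝ → ℂ) (n : ι) : matrixFun hA f n n = siteSum hA f n := by
  rw [matrixFun_apply, siteSum]
  refine Finset.sum_congr rfl fun i _ => ?_
  rw [siteWeight, Complex.real_smul]
  push_cast
  rw [← Complex.mul_conj']
  simp only [starRingEnd_apply]
  ring

theorem matrixFun_mul (f g : ℝ → ℂ) :
    matrixFun hA f * matrixFun hA g = matrixFun hA (fun x => f x * g x) := by
  have h : star (hA.eigenvectorUnitary : Matrix ι ι ℂ) * (hA.eigenvectorUnitary : Matrix ι ι ℂ) = 1 :=
    Unitary.coe_star_mul_self _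
  unfold matrixFun
  calc _ = (hA.eigenvectorUnitary : Matrix ι ι ℂ) * Matrix.diagonal (fun i => f (hA.eigenvalues i)) *
        (star (hA.eigenvectorUnitary : Matrix ι ι ℂ) * (hA.eigenvectorUnitary : Matrix ι ι ℂ)) *
        Matrix.diagonal (fun i => g (hA.eigenvalues i)) *
        star (hA.eigenvectorUnitary : Matrix ι ι ℂ) := by simp only [Matrix.mul_assoc]
    _ = _ := by
      rw [h, Matrix.mul_one, Matrix.mul_assoc (hA.eigenvectorUnitary : Matrix ι ι ℂ),
        Matrix.diagonal_mul_diagonal]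

theorem matrixFun_one : matrixFun hA (fun _ => 1) = 1 := by
  unfold matrixFun
  rw [Matrix.diagonal_one, Matrix.mul_one]
  exact Unitary.coe_mul_star_self _

theorem matrixFun_id : matrixFun hA (fun x => (x : ℂ)) = A := by
  conv_rhs => rw [hA.spectral_theorem]
  rfl

theorem matrixFun_sub_smul (f g : ℝ → ℂ) (z : ℂ) :
    matrixFun hA (fun x => f x - z * g x) = matrixFun hA f - z • matrixFun hA g := by
  ext n m
  simp only [matrixFun_apply, Matrix.sub_apply, Matrix.smul_apply, smul_eq_mul, Finset.mul_sum,
    ← Finset.sum_sub_distrib]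
  exact Finset.sum_congr rfl fun i _ => by ring

theorem sum_siteWeight_right (n : ι) : ∑ i, siteWeight hA n i = 1 := by
  have h := matrixFun_apply_self hA (fun _ => 1) n
  rw [matrixFun_one, Matrix.one_apply_eq, siteSum] at h
  have h2 : ((∑ i, siteWeight hA n i : ℝ) : ℂ) = 1 := by
    rw [h]; push_cast; simp
  exact_mod_cast h2

theorem sub_ofReal_ne_zero {z : ℂ} (hz : z.im ≠ 0) (x : ℝ) : (x : ℂ) - z ≠ 0 := by
  intro h
  apply hz
  have := congrArg Complex.im h
  simpa using this

theorem sub_mul_matrixFun_inv {z : ℂ} (hz : z.im ≠ 0) :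
    (A - z • 1) * matrixFun hA (fun x => ((x : ℂ) - z)⁻¹) = 1 := by
  have h : A - z • 1 = matrixFun hA (fun x => (x : ℂ) - z * 1) := by
    rw [matrixFun_sub_smul, matrixFun_id, matrixFun_one]
  rw [h, matrixFun_mul, ← matrixFun_one hA]
  congr 1
  funext x
  rw [mul_one, mul_inv_cancel₀ (sub_ofReal_ne_zero hz x)]

theorem resolvent_eq_matrixFun {z : ℂ} (hz : z.im ≠ 0) :
    (A - z • 1)⁻¹ = matrixFun hA (fun x => ((x : ℂ) - z)⁻¹) :=
  Matrix.inv_eq_right_inv (sub_mul_matrixFun_inv hA hz)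

theorem resolvent_apply_self {z : ℂ} (hz : z.im ≠ 0) (n : ι) :
    (A - z • 1)⁻¹ n n = siteSum hA (fun x => ((x : ℂ) - z)⁻¹) n := by
  rw [resolvent_eq_matrixFun hA hz, matrixFun_apply_self]

theorem sub_mul_resolvent (hA : A.IsHermitian) {z : ℂ} (hz : z.im ≠ 0) :
    (A - z • 1) * (A - z • 1)⁻¹ = 1 := by
  rw [resolvent_eq_matrixFun hA hz, sub_mul_matrixFun_inv hA hz]

theorem resolvent_mul_sub (hA : A.IsHermitian) {z : ℂ} (hz : z.im ≠ 0) :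
    (A - z • 1)⁻¹ * (A - z • 1) = 1 :=
  mul_eq_one_comm.1 (sub_mul_resolvent hA hz)

theorem pow_eq_matrixFun (k : ℕ) : A ^ k = matrixFun hA (fun x => (x : ℂ) ^ k) := by
  induction k with
  | zero => simp [matrixFun_one]
  | succ k ih =>
    calc A ^ (k + 1) = matrixFun hA (fun x => (x : ℂ) ^ k) * matrixFun hA (fun x => (x : ℂ)) := by
          rw [pow_succ, ih, matrixFun_id]
      _ = _ := by simp only [matrixFun_mul, pow_succ]

theorem siteSum_add {F : Type*} [AddCommGroup F] [Module ℝ F] (f g : ℝ → F) (n : ι) :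
    siteSum hA (fun x => f x + g x) n = siteSum hA f n + siteSum hA g n := by
  simp [siteSum, smul_add, Finset.sum_add_distrib]

theorem siteSum_sub {F : Type*} [AddCommGroup F] [Module ℝ F] (f g : ℝ → F) (n : ι) :
    siteSum hA (fun x => f x - g x) n = siteSum hA f n - siteSum hA g n := by
  simp [siteSum, smul_sub, Finset.sum_sub_distrib]

theorem siteSum_mul_left (c : ℂ) (f : ℝ → ℂ) (n : ι) :
    siteSum hA (fun x => c * f x) n = c * siteSum hA f n := by
  simp only [siteSum, Finset.mul_sum, mul_smul_comm]

theorem siteSum_mul_left_real (c : ℝ) (f : ℝ → ℝ) (n : ι) :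
    siteSum hA (fun x => c * f x) n = c * siteSum hA f n := by
  simp only [siteSum, Finset.mul_sum, mul_smul_comm]

theorem siteSum_ofReal (f : ℝ → ℝ) (n : ι) :
    siteSum hA (fun x => (f x : ℂ)) n = ((siteSum hA f n : ℝ) : ℂ) := by
  simp [siteSum]

theorem siteSum_conj (f : ℝ → ℂ) (n : ι) :
    siteSum hA (fun x => starRingEnd ℂ (f x)) n = starRingEnd ℂ (siteSum hA f n) := by
  simp [siteSum]

theorem siteSum_mono {f g : ℝ → ℝ} (h : ∀ x, f x ≤ g x) (n : ι) :
    siteSum hA f n ≤ siteSum hA g n :=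
  Finset.sum_le_sum fun i _ => mul_le_mul_of_nonneg_left (h _) (siteWeight_nonneg hA n i)

theorem siteSum_nonneg {f : ℝ → ℝ} (h : ∀ x, 0 ≤ f x) (n : ι) : 0 ≤ siteSum hA f n :=
  Finset.sum_nonneg fun i _ => mul_nonneg (siteWeight_nonneg hA n i) (h _)

theorem norm_siteSum_le (f : ℝ → ℂ) (n : ι) : ‖siteSum hA f n‖ ≤ siteSum hA (fun x => ‖f x‖) n := by
  refine (norm_sum_le _ _).trans (Finset.sum_le_sum fun i _ => ?_)
  rw [norm_smul, Real.norm_of_nonneg (siteWeight_nonneg hA n i), smul_eq_mul]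

theorem siteSum_const (c : ℝ) (n : ι) : siteSum hA (fun _ => c) n = c := by
  simp only [siteSum, smul_eq_mul, ← Finset.sum_mul, sum_siteWeight_right, one_mul]

open Classical in
theorem sum_siteSum_indicator (J : Set ℝ) :
    ∑ n, siteSum hA (J.indicator fun _ => (1 : ℝ)) n
      = ((Finset.univ.filter fun i => hA.eigenvalues i ∈ J).card : ℝ) := by
  simp only [siteSum]
  rw [Finset.sum_comm]
  simp only [smul_eq_mul, ← Finset.sum_mul, sum_siteWeight_left, one_mul, Set.indicator_apply]
  simp

end

/-- Parseval identity for `(A - c) w` in the eigenbasis of `A`. -/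
theorem norm_sq_sub_apply {A : Matrix ι ι ℂ} (hA : A.IsHermitian) (c : ℝ)
    (w : EuclideanSpace ℂ ι) :
    ‖Matrix.toEuclideanLin A w - (c : ℂ) • w‖ ^ 2
      = ∑ i, (hA.eigenvalues i - c) ^ 2 * ‖inner ℂ (hA.eigenvectorBasis i) w‖ ^ 2 := by
  rw [← hA.eigenvectorBasis.sum_sq_norm_inner_right]
  refine Finset.sum_congr rfl fun i _ => ?_
  have h1 : inner ℂ (hA.eigenvectorBasis i) (Matrix.toEuclideanLin A w)
      = (hA.eigenvalues i : ℂ) * inner ℂ (hA.eigenvectorBasis i) w := by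
    have hs := (Matrix.isSymmetric_toEuclideanLin_iff.mpr hA) (hA.eigenvectorBasis i) w
    rw [← hs]
    have : Matrix.toEuclideanLin A (hA.eigenvectorBasis i)
        = (hA.eigenvalues i : ℂ) • hA.eigenvectorBasis i := by
      apply PiLp.ext
      intro k
      have := congrFun (hA.mulVec_eigenvectorBasis i) k
      simpa [Matrix.toLpLin_apply] using this
    rw [this, inner_smul_left, Complex.conj_ofReal]
  rw [inner_sub_right, h1, inner_smul_right, ← sub_mul, norm_mul, mul_pow, ← Complex.ofReal_sub,
    Complex.norm_real, Real.norm_eq_abs, sq_abs]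

/-- Two Hermitian matrices that agree on vectors vanishing at `j` have eigenvalue counts in an
interval differing by at most one. -/
theorem card_eigenvalues_le_add_one {A B : Matrix ι ι ℂ} (hA : A.IsHermitian) (hB : B.IsHermitian)
    (j : ι) (hAB : ∀ k l, l ≠ j → A k l = B k l) (u v : ℝ) (J : Set ℝ) [DecidablePred (· ∈ J)]
    (hJ : J = Set.Ioo u v) :
    (Finset.univ.filter fun i => hA.eigenvalues i ∈ J).card
      ≤ (Finset.univ.filter fun i => hB.eigenvalues i ∈ J).card + 1 := by
  by_contra! hlt
  set c := (u + v) / 2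
  set r := (v - u) / 2
  have hmem : ∀ x, x ∈ J ↔ |x - c| < r := by
    intro x
    rw [hJ, Set.mem_Ioo, abs_lt]
    constructor <;> intro h <;> constructor <;> simp only [c, r] at * <;> linarith [h.1, h.2]
  have hr : 0 ≤ r := by
    have : (Finset.univ.filter fun i => hA.eigenvalues i ∈ J).card ≠ 0 := by omega
    obtain ⟨i, hi⟩ := Finset.card_pos.1 (Nat.pos_of_ne_zero this)
    exact (abs_nonneg _).trans ((hmem _).1 (Finset.mem_filter.1 hi).2).le
  -- A kernel vector lies in the span of the `A`-eigenvectors with eigenvalue in `J`, is orthogonal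
  -- to the corresponding `B`-eigenvectors, and vanishes at `j`. If the counts differed by more than
  -- one, there would be fewer constraints than dimensions. Such a vector satisfies `A w = B w`, yet
  -- the distance from `A w` to `c w` is less than `r ‖w‖` while that from `B w` is at least `r
  -- ‖w‖`.
  let T : EuclideanSpace ℂ ι →ₗ[ℂ] (({i // hA.eigenvalues i ∉ J} → ℂ) ×
      ({i // hB.eigenvalues i ∈ J} → ℂ)) × ℂ :=
    ((LinearMap.pi fun i => (innerSL ℂ (hA.eigenvectorBasis i.1)).toLinearMap).prod
      (LinearMap.pi fun i => (innerSL ℂ (hB.eigenvectorBasis i.1)).toLinearMap)).prod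
      (EuclideanSpace.proj j).toLinearMap
  have hker : LinearMap.ker T ≠ ⊥ := by
    apply LinearMap.ker_ne_bot_of_finrank_lt
    simp only [Module.finrank_prod, Module.finrank_fintype_fun_eq_card, Module.finrank_self,
      finrank_euclideanSpace, Fintype.card_subtype]
    have := Finset.card_filter_add_card_filter_not (s := (Finset.univ : Finset ι))
      (fun i => hA.eigenvalues i ∈ J)
    rw [Finset.card_univ] at this
    omega
  obtain ⟨w, hw, hw0⟩ := (Submodule.ne_bot_iff _).1 hker
  have hw1 : ∀ i, hA.eigenvalues i ∉ J → inner ℂ (hA.eigenvectorBasis i) w = 0 := fun i hi =>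
    congrFun (congrArg (fun x => x.1.1) (LinearMap.mem_ker.1 hw)) ⟨i, hi⟩
  have hw2 : ∀ i, hB.eigenvalues i ∈ J → inner ℂ (hB.eigenvectorBasis i) w = 0 := fun i hi =>
    congrFun (congrArg (fun x => x.1.2) (LinearMap.mem_ker.1 hw)) ⟨i, hi⟩
  have hw3 : w j = 0 := congrArg (fun x => x.2) (LinearMap.mem_ker.1 hw)
  have hABw : Matrix.toEuclideanLin A w = Matrix.toEuclideanLin B w := by
    apply PiLp.ext
    intro k
    simp only [Matrix.toLpLin_apply, Matrix.mulVec, dotProduct]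
    refine Finset.sum_congr rfl fun l _ => ?_
    by_cases hl : l = j
    · rw [hl, hw3, mul_zero, mul_zero]
    · rw [hAB k l hl]
  have h1 := norm_sq_sub_apply hA c w
  have h2 := norm_sq_sub_apply hB c w
  have h3 := hA.eigenvectorBasis.sum_sq_norm_inner_right w
  have h4 := hB.eigenvectorBasis.sum_sq_norm_inner_right w
  rw [hABw, h2] at h1
  have hB' : r ^ 2 * ‖w‖ ^ 2
      ≤ ∑ i, (hB.eigenvalues i - c) ^ 2 * ‖inner ℂ (hB.eigenvectorBasis i) w‖ ^ 2 := by
    rw [← h4, Finset.mul_sum]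
    refine Finset.sum_le_sum fun i _ => ?_
    by_cases hi : hB.eigenvalues i ∈ J
    · simp [hw2 i hi]
    · rw [hmem, not_lt] at hi
      rw [← sq_abs (hB.eigenvalues i - c)]
      gcongr
  obtain ⟨i0, hi0⟩ : ∃ i, inner ℂ (hA.eigenvectorBasis i) w ≠ 0 := by
    by_contra! h
    simp only [h, norm_zero] at h3
    simp at h3
    exact hw0 (by simpa using h3.symm)
  have hA' : ∑ i, (hA.eigenvalues i - c) ^ 2 * ‖inner ℂ (hA.eigenvectorBasis i) w‖ ^ 2
      < r ^ 2 * ‖w‖ ^ 2 := by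
    rw [← h3, Finset.mul_sum]
    have key : ∀ i, inner ℂ (hA.eigenvectorBasis i) w ≠ 0 →
        (hA.eigenvalues i - c) ^ 2 < r ^ 2 := by
      intro i hi
      have : hA.eigenvalues i ∈ J := by
        by_contra h
        exact hi (hw1 i h)
      rw [← sq_abs (hA.eigenvalues i - c)]
      exact pow_lt_pow_left₀ ((hmem _).1 this) (abs_nonneg _) two_ne_zero
    refine Finset.sum_lt_sum (fun i _ => ?_) ⟨i0, Finset.mem_univ _, ?_⟩
    · by_cases hi : inner ℂ (hA.eigenvectorBasis i) w = 0
      · simp [hi]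
      · exact mul_le_mul_of_nonneg_right (key i hi).le (by positivity)
    · exact mul_lt_mul_of_pos_right (key i0 hi0) (by positivity)
  linarith

end LinearAlgebra

/-! ### Continuous approximation of the indicator of an open interval -/

section Trapezoid

/-- A continuous function that vanishes off `(u, v)` and equals `1` on `[u + ε, v - ε]`. -/
def trapezoid (u v ε x : ℝ) : ℝ := max 0 (min 1 (min (x - u) (v - x) / ε))

theorem continuous_trapezoid (u v ε : ℝ) : Continuous (trapezoid u v ε) := by
  unfold trapezoid; fun_prop

theorem trapezoid_nonneg (u v ε x : ℝ) : 0 ≤ trapezoid u v ε x := le_max_left _ _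

theorem trapezoid_le_one (u v ε x : ℝ) : trapezoid u v ε x ≤ 1 :=
  max_le zero_le_one (min_le_left _ _)

theorem trapezoid_of_notMem {u v ε x : ℝ} (hε : 0 < ε) (hx : x ∉ Set.Ioo u v) :
    trapezoid u v ε x = 0 := by
  have h : min (x - u) (v - x) ≤ 0 := by
    rw [Set.mem_Ioo, not_and_or, not_lt, not_lt] at hx
    rw [min_le_iff]
    rcases hx with h | h
    · left; linarith
    · right; linarith
  exact max_eq_left ((min_le_right _ _).trans (div_nonpos_of_nonpos_of_nonneg h hε.le))

theorem trapezoid_of_le {u v ε x : ℝ} (hε : 0 < ε) (h1 : u + ε ≤ x) (h2 : x ≤ v - ε) :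
    trapezoid u v ε x = 1 := by
  have h : 1 ≤ min (x - u) (v - x) / ε := by
    rw [one_le_div hε, le_min_iff]
    constructor <;> linarith
  rw [trapezoid, min_eq_left h, max_eq_right zero_le_one]

/-- The error lives within `ε` of an endpoint, where `2ε` times the Poisson kernel of width `ε` is
at least one. Poisson kernels are chosen as majorants because spectral averaging bounds their means.
-/
theorem abs_indicator_sub_trapezoid_le {u v ε : ℝ} (hε : 0 < ε) (x : ℝ) :
    |(Set.Ioo u v).indicator (fun _ => (1 : ℝ)) x - trapezoid u v ε x|
      ≤ 2 * ε * (ε / ((x - u) ^ 2 + ε ^ 2)) + 2 * ε * (ε / ((x - v) ^ 2 + ε ^ 2)) := by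
  have hp : ∀ w : ℝ, 0 ≤ 2 * ε * (ε / ((x - w) ^ 2 + ε ^ 2)) := fun w => by positivity
  have hq : ∀ w : ℝ, |x - w| ≤ ε → 1 ≤ 2 * ε * (ε / ((x - w) ^ 2 + ε ^ 2)) := by
    intro w hw
    have : (x - w) ^ 2 ≤ ε ^ 2 := by
      rw [← sq_abs]; gcongr
    rw [← mul_div_assoc, one_le_div (by positivity)]
    nlinarith
  by_cases hx : x ∈ Set.Ioo u v
  · rw [Set.indicator_of_mem hx]
    by_cases h1 : u + ε ≤ x
    · by_cases h2 : x ≤ v - ε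
      · rw [trapezoid_of_le hε h1 h2, sub_self, abs_zero]
        exact add_nonneg (hp u) (hp v)
      · have := hq v (by rw [abs_le]; constructor <;> linarith [hx.2])
        rw [abs_of_nonneg (sub_nonneg.2 (trapezoid_le_one ..))]
        linarith [hp u, trapezoid_nonneg u v ε x]
    · have := hq u (by rw [abs_le]; constructor <;> linarith [hx.1])
      rw [abs_of_nonneg (sub_nonneg.2 (trapezoid_le_one ..))]
      linarith [hp v, trapezoid_nonneg u v ε x]
  · rw [Set.indicator_of_notMem hx, trapezoid_of_notMem hε hx, sub_self, abs_zero]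
    exact add_nonneg (hp u) (hp v)

theorem tendsto_trapezoid (u v x : ℝ) :
    Tendsto (fun k : ℕ => trapezoid u v (1 / ((k : ℝ) + 1)) x) atTop
      (𝓝 ((Set.Ioo u v).indicator (fun _ => (1 : ℝ)) x)) := by
  by_cases hx : x ∈ Set.Ioo u v
  · rw [Set.indicator_of_mem hx]
    have hlim := tendsto_one_div_add_atTop_nhds_zero_nat (𝕜 := ℝ)
    have h1 := hlim.eventually (gt_mem_nhds (sub_pos.2 hx.1))
    have h2 := hlim.eventually (gt_mem_nhds (sub_pos.2 hx.2))
    refine tendsto_const_nhds.congr' ?_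
    filter_upwards [h1, h2] with k hk1 hk2
    exact (trapezoid_of_le Nat.one_div_pos_of_nat (by linarith) (by linarith)).symm
  · rw [Set.indicator_of_notMem hx]
    refine tendsto_const_nhds.congr fun k => ?_
    exact (trapezoid_of_notMem Nat.one_div_pos_of_nat hx).symm

end Trapezoid

/-! ### Measurability of spectral quantities of random matrices -/

section Measurability

variable {ι : Type*} [Fintype ι] [DecidableEq ι] {Ω : Type*} [MeasurableSpace Ω]
  {A : Ω → Matrix ι ι ℂ}

theorem measurable_pow_apply (hm : ∀ i j, Measurable fun ω => A ω i j) (k : ℕ) (i j : ι) :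
    Measurable fun ω => (A ω ^ k) i j := by
  induction k generalizing i j with
  | zero => simp only [pow_zero]; exact measurable_const
  | succ k ih =>
    simp only [pow_succ, Matrix.mul_apply]
    exact Finset.measurable_sum _ fun l _ => (ih i l).mul (hm l j)

theorem measurable_det (hm : ∀ i j, Measurable fun ω => A ω i j) :
    Measurable fun ω => (A ω).det := by
  simp only [Matrix.det_apply]
  refine Finset.measurable_sum _ fun σ _ => ?_
  simp only [Units.smul_def, zsmul_eq_mul]
  exact measurable_const.mul (Finset.measurable_prod _ fun i _ => hm _ _)

theorem measurable_inv_apply (hm : ∀ i j, Measurable fun ω => A ω i j) (i j : ι) :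
    Measurable fun ω => (A ω)⁻¹ i j := by
  simp only [Matrix.inv_def, Matrix.smul_apply, Ring.inverse_eq_inv', smul_eq_mul,
    Matrix.adjugate_apply]
  refine (measurable_det hm).inv.mul (measurable_det fun k l => ?_)
  by_cases h : k = j
  · subst h; simp only [Matrix.updateRow_self]; exact measurable_const
  · simp only [Matrix.updateRow_ne h]; exact hm k l

theorem measurable_siteSum_of_tendsto (hA : ∀ ω, (A ω).IsHermitian) (n : ι) {f : ℝ → ℝ}
    (g : ℕ → ℝ → ℝ) (hg : ∀ k, Measurable fun ω => siteSum (hA ω) (g k) n)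
    (hlim : ∀ x, Tendsto (fun k => g k x) atTop (𝓝 (f x))) :
    Measurable fun ω => siteSum (hA ω) f n :=
  measurable_of_tendsto_metrizable hg <| tendsto_pi_nhds.2 fun _ =>
    tendsto_finsetSum _ fun _ _ => (hlim _).const_smul _

/-- The eigenbasis is an arbitrary choice for each `ω`, so nothing is known about the measurability
of individual eigenvectors. Diagonal entries of polynomials in the matrix are polynomial in its
entries; continuous functions and then indicators follow by pointwise limits. -/
theorem measurable_siteSum_polynomial (hA : ∀ ω, (A ω).IsHermitian)
    (hm : ∀ i j, Measurable fun ω => A ω i j) (n : ι) (p : Polynomial ℝ) :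
    Measurable fun ω => siteSum (hA ω) (fun x => p.eval x) n := by
  have h : ∀ ω, siteSum (hA ω) (fun x => p.eval x) n
      = ∑ k ∈ p.support, p.coeff k * ((A ω ^ k) n n).re := by
    intro ω
    have h1 : ∀ k, ((A ω ^ k) n n).re = siteSum (hA ω) (fun x => x ^ k) n := by
      intro k
      rw [pow_eq_matrixFun (hA ω), matrixFun_apply_self]
      have := siteSum_ofReal (hA ω) (fun x => x ^ k) n
      push_cast at this
      rw [this, Complex.ofReal_re]
    simp only [h1, siteSum, Polynomial.eval_eq_sum, Polynomial.sum, Finset.smul_sum,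
      Finset.mul_sum]
    rw [Finset.sum_comm]
    simp only [smul_eq_mul]
    exact Finset.sum_congr rfl fun _ _ => Finset.sum_congr rfl fun _ _ => by ring
  simp only [h]
  exact Finset.measurable_sum _ fun k _ => measurable_const.mul
    (Complex.measurable_re.comp (measurable_pow_apply hm k n n))

theorem measurable_siteSum (hA : ∀ ω, (A ω).IsHermitian)
    (hm : ∀ i j, Measurable fun ω => A ω i j) (n : ι) {f : ℝ → ℝ} (hf : Continuous f) :
    Measurable fun ω => siteSum (hA ω) f n := by
  -- Letting the interval grow while the error shrinks gives polynomials converging at every real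
  -- point, so no bound on the spectra is needed.
  have h : ∀ k : ℕ, ∃ p : Polynomial ℝ, ∀ x ∈ Set.Icc (-(k : ℝ)) k,
      |p.eval x - f x| < 1 / ((k : ℝ) + 1) := fun k =>
    exists_polynomial_near_of_continuousOn _ _ f hf.continuousOn _ Nat.one_div_pos_of_nat
  choose p hp using h
  refine measurable_siteSum_of_tendsto hA n (fun k x => (p k).eval x)
    (fun k => measurable_siteSum_polynomial hA hm n (p k)) fun x => ?_
  rw [tendsto_iff_norm_sub_tendsto_zero]
  refine squeeze_zero' (Eventually.of_forall fun _ => norm_nonneg _) ?_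
    (tendsto_one_div_add_atTop_nhds_zero_nat (𝕜 := ℝ))
  filter_upwards [tendsto_natCast_atTop_atTop.eventually_ge_atTop |x|] with k hk
  exact (hp k x (abs_le.1 hk)).le

theorem measurable_siteSum_indicator_Ioo (hA : ∀ ω, (A ω).IsHermitian)
    (hm : ∀ i j, Measurable fun ω => A ω i j) (n : ι) (u v : ℝ) :
    Measurable fun ω => siteSum (hA ω) ((Set.Ioo u v).indicator fun _ => (1 : ℝ)) n :=
  measurable_siteSum_of_tendsto hA n (fun k => trapezoid u v (1 / ((k : ℝ) + 1)))
    (fun _ => measurable_siteSum hA hm n (continuous_trapezoid ..)) (tendsto_trapezoid u v)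

open Classical in
/-- The number of eigenvalues in `J`, counted with multiplicity. -/
def eigenvalueCount {B : Matrix ι ι ℂ} (hB : B.IsHermitian) (J : Set ℝ) : ℕ :=
  (Finset.univ.filter fun i => hB.eigenvalues i ∈ J).card

theorem sum_siteSum_eq_eigenvalueCount {B : Matrix ι ι ℂ} (hB : B.IsHermitian) (J : Set ℝ) :
    ∑ n, siteSum hB (J.indicator fun _ => (1 : ℝ)) n = (eigenvalueCount hB J : ℝ) :=
  sum_siteSum_indicator hB J

theorem eigenvalueCount_le_card {B : Matrix ι ι ℂ} (hB : B.IsHermitian) (J : Set ℝ) :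
    eigenvalueCount hB J ≤ Fintype.card ι := by
  classical
  exact Finset.card_le_univ _

theorem eigenvalueCount_le_add_one {A B : Matrix ι ι ℂ} (hA : A.IsHermitian) (hB : B.IsHermitian)
    (j : ι) (hAB : ∀ k l, l ≠ j → A k l = B k l) (u v : ℝ) :
    eigenvalueCount hA (Set.Ioo u v) ≤ eigenvalueCount hB (Set.Ioo u v) + 1 := by
  classical
  unfold eigenvalueCount
  convert card_eigenvalues_le_add_one hA hB j hAB u v _ rfl

theorem measurable_eigenvalueCount (hA : ∀ ω, (A ω).IsHermitian)
    (hm : ∀ i j, Measurable fun ω => A ω i j) (u v : ℝ) :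
    Measurable fun ω => eigenvalueCount (hA ω) (Set.Ioo u v) := by
  have h : Measurable fun ω => (eigenvalueCount (hA ω) (Set.Ioo u v) : ℝ) := by
    simp only [← sum_siteSum_eq_eigenvalueCount]
    exact Finset.measurable_sum _ fun n _ => measurable_siteSum_indicator_Ioo hA hm n u v
  -- The floor brings measurability of the real-valued trace back to `ℕ`.
  have h2 := Nat.measurable_floor.comp h
  simpa [Function.comp_def] using h2

end Measurability

/-! ### Resolvents under rank one perturbation and restriction -/

section RankOne

variable {ι : Type*} [Fintype ι] [DecidableEq ι]

/-- The Stieltjes transform of the spectral measure has imaginary part a Poisson integral. -/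
theorem im_siteSum_resolvent {A : Matrix ι ι ℂ} (hA : A.IsHermitian) (c e : ℝ) (n : ι) :
    (siteSum hA (fun x => ((x : ℂ) - ⟨c, e⟩)⁻¹) n).im
      = siteSum hA (fun x => e / ((x - c) ^ 2 + e ^ 2)) n := by
  simp only [siteSum, Complex.im_sum, Complex.smul_im, Complex.inv_im, Complex.normSq_apply,
    Complex.sub_im, Complex.sub_re, Complex.ofReal_re, Complex.ofReal_im, smul_eq_mul]
  refine Finset.sum_congr rfl fun i _ => ?_
  congr 1
  ring_nf

/-- Jensen's inequality for the probability weights `siteWeight`: the imaginary part is `e` times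
the mean of the squared modulus, which dominates the square of the mean. Equivalently, `-Im (1 / g)
≥ e` for the resolvent entry `g`. -/
theorem im_mul_norm_sq_resolvent_le {A : Matrix ι ι ℂ} (hA : A.IsHermitian) (c : ℝ) {e : ℝ}
    (he : 0 < e) (n : ι) :
    e * ‖siteSum hA (fun x => ((x : ℂ) - ⟨c, e⟩)⁻¹) n‖ ^ 2
      ≤ (siteSum hA (fun x => ((x : ℂ) - ⟨c, e⟩)⁻¹) n).im := by
  have h1 : ∀ x : ℝ, e / ((x - c) ^ 2 + e ^ 2) = e * ‖((x : ℂ) - ⟨c, e⟩)⁻¹‖ ^ 2 := by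
    intro x
    rw [norm_inv, inv_pow, ← Complex.normSq_eq_norm_sq, Complex.normSq_apply]
    simp only [Complex.sub_im, Complex.sub_re, Complex.ofReal_re, Complex.ofReal_im]
    rw [div_eq_mul_inv]
    ring_nf
  rw [im_siteSum_resolvent]
  simp only [h1]
  rw [siteSum_mul_left_real]
  refine mul_le_mul_of_nonneg_left ?_ he.le
  set a : ℝ → ℝ := fun x => ‖((x : ℂ) - ⟨c, e⟩)⁻¹‖
  set m := siteSum hA a n
  have h2 := norm_siteSum_le hA (fun x => ((x : ℂ) - ⟨c, e⟩)⁻¹) n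
  have h3 : 0 ≤ siteSum hA (fun x => (a x ^ 2 - (2 * m) * a x) + m ^ 2) n :=
    siteSum_nonneg hA (fun x => by nlinarith [sq_nonneg (a x - m)]) n
  rw [siteSum_add, siteSum_sub, siteSum_mul_left_real, siteSum_const] at h3
  calc _ ≤ m ^ 2 := by gcongr
    _ ≤ _ := by
      change 0 ≤ siteSum hA (fun x => a x ^ 2) n - 2 * m * m + m ^ 2 at h3
      linarith

/-- The diagonal resolvent entry at the site of a rank one perturbation. -/
theorem resolvent_add_single {A A' : Matrix ι ι ℂ} (hA : A.IsHermitian) (hA' : A'.IsHermitian)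
    (j : ι) (t : ℝ) (h : A' = A + Matrix.single j j (t : ℂ)) {z : ℂ} (hz : z.im ≠ 0) :
    (A' - z • 1)⁻¹ j j * (1 + t * (A - z • 1)⁻¹ j j) = (A - z • 1)⁻¹ j j := by
  have h1 := resolvent_mul_sub hA hz
  have h2 := sub_mul_resolvent hA' hz
  set R := (A - z • 1)⁻¹
  set R' := (A' - z • 1)⁻¹
  have h3 : R' + R * Matrix.single j j (t : ℂ) * R' = R := by
    calc R' + R * Matrix.single j j (t : ℂ) * R'
        = (R * (A - z • 1)) * R' + R * Matrix.single j j (t : ℂ) * R' := by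
          rw [h1, Matrix.one_mul]
      _ = R * ((A' - z • 1) * R') := by
          rw [h, add_sub_right_comm, Matrix.add_mul, Matrix.mul_add, Matrix.mul_assoc,
            Matrix.mul_assoc]
      _ = R := by rw [h2, Matrix.mul_one]
  have h4 := congrFun (congrFun h3 j) j
  have h5 : (R * Matrix.single j j (t : ℂ) * R') j j = R j j * t * R' j j := by
    rw [Matrix.mul_apply, Finset.sum_eq_single j]
    · rw [Matrix.mul_single_apply_same]
    · intro b _ hb
      rw [Matrix.mul_single_apply_of_ne _ _ _ _ _ hb, zero_mul]
    · simp
  rw [Matrix.add_apply, h5] at h4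
  linear_combination h4

/-- By the rank one formula the resolvent entry at `j` is `1 / (t + 1 / g)`, with `g` independent of
`t`; here `X` and `-Y` are the real and imaginary parts of `1 / g`. That `X` and `Y` do not depend
on `t` is what allows integration over `t`, and the lower bound on `Y` makes the result uniform in
the other potential values. -/
theorem exists_siteSum_rankOne {A : Matrix ι ι ℂ} (hA : A.IsHermitian) (j : ι) (c : ℝ) {e : ℝ}
    (he : 0 < e) : ∃ X Y : ℝ, e ≤ Y ∧ ∀ (t : ℝ) (A' : Matrix ι ι ℂ) (hA' : A'.IsHermitian),
      A' = A + Matrix.single j j (t : ℂ) →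
      siteSum hA' (fun x => e / ((x - c) ^ 2 + e ^ 2)) j = Y / ((t + X) ^ 2 + Y ^ 2) := by
  set z : ℂ := ⟨c, e⟩ with hzdef
  have hz : z.im ≠ 0 := he.ne'
  set g := (A - z • 1)⁻¹ j j with hg
  have hgs := resolvent_apply_self hA hz j
  have hgn := im_mul_norm_sq_resolvent_le hA c he j
  rw [← hzdef, ← hgs, ← hg] at hgn
  have him : 0 < g.im := by
    rw [hg, hgs, hzdef, im_siteSum_resolvent]
    have h1 : ∀ i, 0 < e / ((hA.eigenvalues i - c) ^ 2 + e ^ 2) := fun i => by positivity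
    obtain ⟨i, -, hi⟩ : ∃ i ∈ Finset.univ, siteWeight hA j i ≠ 0 := by
      apply Finset.exists_ne_zero_of_sum_ne_zero
      rw [sum_siteWeight_right]
      exact one_ne_zero
    refine Finset.sum_pos' (fun i _ => mul_nonneg (siteWeight_nonneg _ _ _) (h1 i).le)
      ⟨i, Finset.mem_univ _, mul_pos (lt_of_le_of_ne (siteWeight_nonneg _ _ _) hi.symm) (h1 i)⟩
  have hg0 : g ≠ 0 := fun h => by rw [h] at him; simp at him
  have hgp : 0 < Complex.normSq g := Complex.normSq_pos.2 hg0
  refine ⟨(g⁻¹).re, -(g⁻¹).im, ?_, ?_⟩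
  · rw [Complex.inv_im, neg_div, neg_neg, le_div_iff₀ hgp, Complex.normSq_eq_norm_sq]
    exact hgn
  · intro t A' hA' h
    have h1 := resolvent_add_single hA hA' j t h hz
    rw [← hg] at h1
    have h2 : (A' - z • 1)⁻¹ j j = ((t : ℂ) + g⁻¹)⁻¹ := by
      have h3 : (A' - z • 1)⁻¹ j j * ((t : ℂ) + g⁻¹) = 1 := by
        have : (t : ℂ) + g⁻¹ = (1 + t * g) * g⁻¹ := by field_simp; ring
        rw [this, ← mul_assoc, h1, mul_inv_cancel₀ hg0]
      exact eq_inv_of_mul_eq_one_left h3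
    rw [← im_siteSum_resolvent, ← hzdef, ← resolvent_apply_self hA' hz, h2, Complex.inv_im,
      Complex.normSq_apply]
    simp only [Complex.add_re, Complex.add_im, Complex.ofReal_re, Complex.ofReal_im, zero_add]
    congr 1
    ring

/-- The resolvent identity comparing a matrix with one of its principal submatrices. -/
theorem resolvent_submatrix {κ : Type*} [Fintype κ] [DecidableEq κ] {A : Matrix ι ι ℂ}
    {B : Matrix κ κ ℂ} (hA : A.IsHermitian) (hB : B.IsHermitian) (φ : κ → ι)
    (hφ : Function.Injective φ) (hAB : ∀ k l, B k l = A (φ k) (φ l)) {z : ℂ} (hz : z.im ≠ 0)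
    (n : κ) :
    (B - z • 1)⁻¹ n n - (A - z • 1)⁻¹ (φ n) (φ n)
      = ∑ k, ∑ m with m ∉ Set.range φ,
          (B - z • 1)⁻¹ n k * A (φ k) m * (A - z • 1)⁻¹ m (φ n) := by
  have h1 := resolvent_mul_sub hB hz
  have h2 := sub_mul_resolvent hA hz
  set R := (A - z • 1)⁻¹
  set S := (B - z • 1)⁻¹
  have h3 : ∀ k, ∑ l, (B - z • 1) k l * R (φ l) (φ n)
      + ∑ m with m ∉ Set.range φ, A (φ k) m * R m (φ n) = (1 : Matrix κ κ ℂ) k n := by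
    intro k
    have h4 := congrFun (congrFun h2 (φ k)) (φ n)
    rw [Matrix.mul_apply, ← Finset.sum_filter_add_sum_filter_not _ (fun m => m ∈ Set.range φ)] at h4
    have h5 : (1 : Matrix κ κ ℂ) k n = (1 : Matrix ι ι ℂ) (φ k) (φ n) := by
      simp [Matrix.one_apply, hφ.eq_iff]
    rw [h5, ← h4]
    congr 1
    · have h6 : (Finset.univ.filter fun m => m ∈ Set.range φ) = Finset.univ.map ⟨φ, hφ⟩ := by
        ext m; simp
      rw [h6, Finset.sum_map]
      refine Finset.sum_congr rfl fun l _ => ?_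
      simp [Matrix.sub_apply, hAB, Matrix.one_apply, hφ.eq_iff]
    · refine Finset.sum_congr rfl fun m hm => ?_
      have h7 : φ k ≠ m := fun h => (Finset.mem_filter.1 hm).2 ⟨k, h⟩
      simp [Matrix.sub_apply, h7]
  have h4 : ∑ k, S n k * (∑ l, (B - z • 1) k l * R (φ l) (φ n)
      + ∑ m with m ∉ Set.range φ, A (φ k) m * R m (φ n)) = S n n := by
    simp only [h3, Matrix.one_apply]
    simp
  have h5 : ∑ k, S n k * ∑ l, (B - z • 1) k l * R (φ l) (φ n) = R (φ n) (φ n) := by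
    simp only [Finset.mul_sum, ← mul_assoc]
    rw [Finset.sum_comm]
    simp only [← Finset.sum_mul, ← Matrix.mul_apply, h1]
    simp [Matrix.one_apply]
  simp only [mul_add, Finset.sum_add_distrib] at h4
  rw [h5] at h4
  rw [← h4, add_sub_cancel_left]
  simp only [Finset.mul_sum, mul_assoc]

end RankOne

/-! ### Spectral averaging and the Wegner and Minami estimates for product measures -/

section Averaging

/-- `μ([x, x + r]) ≤ C r ^ α`. -/
def HolderBound (α : ℝ) (C : ℝ≥0) (μ : Measure ℝ) : Prop :=
  ∀ x r : ℝ, 0 ≤ r → μ (Set.Icc x (x + r)) ≤ ENNReal.ofReal (C * r ^ α)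

/-- The constant in the spectral averaging bound. -/
def averagingConst (C : ℝ≥0) : ℝ := ∑' k : ℤ, 3 * C * (1 / (1 + (k : ℝ) ^ 2))

theorem summable_one_div_one_add_sq : Summable fun k : ℤ => 1 / (1 + (k : ℝ) ^ 2) := by
  refine Summable.of_nonneg_of_le (fun k => by positivity) (fun k => ?_)
    ((Real.summable_one_div_int_pow (p := 2)).2 one_lt_two |>.add
      (summable_of_ne_finset_zero (f := fun k : ℤ => if k = 0 then (1 : ℝ) else 0) (s := {0})
        (by simp)))
  by_cases hk : k = 0
  · simp [hk]
  · have : 0 < (k : ℝ) ^ 2 := by positivity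
    simp only [hk, if_false, add_zero]
    gcongr
    linarith

theorem averagingConst_nonneg (C : ℝ≥0) : 0 ≤ averagingConst C :=
  tsum_nonneg fun k => by positivity

/-- Tile the line by intervals of length `Y`. Each has measure at most `C * Y ^ α`, and on the
`k`-th one the kernel is at most `3 / (Y * (1 + k ^ 2))`, which is summable in `k`. -/
theorem lintegral_poissonKernel_le {α : ℝ} {C : ℝ≥0} {μ : Measure ℝ} (hμ : HolderBound α C μ)
    (X : ℝ) {Y : ℝ} (hY : 0 < Y) :
    ∫⁻ t, ENNReal.ofReal (Y / ((t + X) ^ 2 + Y ^ 2)) ∂μ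
      ≤ ENNReal.ofReal (averagingConst C * Y ^ (α - 1)) := by
  set J : ℤ → Set ℝ := fun k => Set.Icc (k * Y - X) (k * Y - X + Y)
  set a : ℤ → ℝ := fun k => 3 / Y * (1 / (1 + (k : ℝ) ^ 2))
  have hpt : ∀ t, ENNReal.ofReal (Y / ((t + X) ^ 2 + Y ^ 2))
      ≤ ∑' k, (J k).indicator (fun _ => ENNReal.ofReal (a k)) t := by
    intro t
    set k := ⌊(t + X) / Y⌋
    have h1 : (k : ℝ) * Y ≤ t + X := (le_div_iff₀ hY).1 (Int.floor_le _)
    have h2 : t + X < (k + 1) * Y := (div_lt_iff₀ hY).1 (Int.lt_floor_add_one _)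
    have hk : t ∈ J k := ⟨by linarith, by linarith⟩
    refine le_trans ?_ (ENNReal.le_tsum k)
    rw [Set.indicator_of_mem hk]
    apply ENNReal.ofReal_le_ofReal
    -- `k * Y` is within `Y` of `t + X`. Adding `Y ^ 2` to both sides produces the constant 3.
    have h3 : ((k : ℝ) * Y) ^ 2 ≤ 2 * (t + X) ^ 2 + 2 * Y ^ 2 := by
      nlinarith [sq_nonneg (2 * (t + X) - k * Y), sq_nonneg (t + X - k * Y), mul_pos hY hY]
    simp only [a]
    rw [div_mul_div_comm, mul_one, div_le_div_iff₀ (by positivity) (by positivity)]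
    nlinarith [sq_nonneg (t + X)]
  have hμJ : ∀ k, μ (J k) ≤ ENNReal.ofReal (C * Y ^ α) := fun k => hμ _ _ hY.le
  have hterm : ∀ k : ℤ, a k * (C * Y ^ α) = 3 * C * (1 / (1 + (k : ℝ) ^ 2)) * Y ^ (α - 1) := by
    intro k
    simp only [a]
    rw [Real.rpow_sub_one hY.ne']
    ring
  have hs : Summable fun k : ℤ => 3 * (C : ℝ) * (1 / (1 + (k : ℝ) ^ 2)) :=
    summable_one_div_one_add_sq.mul_left _
  calc _ ≤ ∫⁻ t, ∑' k, (J k).indicator (fun _ => ENNReal.ofReal (a k)) t ∂μ := lintegral_mono hpt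
    _ = ∑' k, ENNReal.ofReal (a k) * μ (J k) := by
      rw [lintegral_tsum fun k => (measurable_const.indicator measurableSet_Icc).aemeasurable]
      exact tsum_congr fun k => lintegral_indicator_const measurableSet_Icc _
    _ ≤ ∑' k : ℤ, ENNReal.ofReal (3 * C * (1 / (1 + (k : ℝ) ^ 2)) * Y ^ (α - 1)) := by
      refine ENNReal.tsum_le_tsum fun k => ?_
      rw [← hterm, ENNReal.ofReal_mul (p := a k) (by positivity)]
      exact mul_le_mul_right (hμJ k) _
    _ = _ := by
      rw [← ENNReal.ofReal_tsum_of_nonneg (fun k => by positivity) (hs.mul_right _), tsum_mul_right]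
      rfl

variable {ι : Type*} [DecidableEq ι]

/-- A matrix with a random potential on the diagonal. -/
def potentialMatrix (B : Matrix ι ι ℂ) (x : ι → ℝ) : Matrix ι ι ℂ :=
  B + Matrix.diagonal fun i => (x i : ℂ)

theorem potentialMatrix_isHermitian {B : Matrix ι ι ℂ} (hB : B.IsHermitian) (x : ι → ℝ) :
    (potentialMatrix B x).IsHermitian :=
  hB.add (Matrix.isHermitian_diagonal_of_self_adjoint _ (by
    ext i; simp))

theorem measurable_potentialMatrix (B : Matrix ι ι ℂ) (i j : ι) :
    Measurable fun x : ι → ℝ => potentialMatrix B x i j := by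
  simp only [potentialMatrix, Matrix.add_apply, Matrix.diagonal_apply]
  split_ifs with h
  · exact measurable_const.add (Complex.measurable_ofReal.comp (measurable_pi_apply i))
  · exact measurable_const

theorem potentialMatrix_update (B : Matrix ι ι ℂ) (x : ι → ℝ) (j : ι) (t : ℝ) :
    potentialMatrix B (Function.update x j t)
      = potentialMatrix B (Function.update x j 0) + Matrix.single j j (t : ℂ) := by
  ext k l
  by_cases hk : k = j
  · subst hk
    by_cases hl : k = l
    · subst hl; simp [potentialMatrix]
    · simp [potentialMatrix, hl]
  · have : ¬ (j = k ∧ j = l) := fun h => hk h.1.symm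
    simp [potentialMatrix, Matrix.diagonal_apply, hk, this]

variable [Fintype ι]

/-- Spectral averaging over the potential at one site. -/
theorem lintegral_update_poisson_le {α : ℝ} (hα : α ≤ 1) {C : ℝ≥0} {μ : Measure ℝ}
    (hμ : HolderBound α C μ) {B : Matrix ι ι ℂ} (hB : B.IsHermitian) (x : ι → ℝ) (j : ι) (c : ℝ)
    {e : ℝ} (he : 0 < e) :
    ∫⁻ t, ENNReal.ofReal (siteSum (potentialMatrix_isHermitian hB (Function.update x j t))
        (fun y => e / ((y - c) ^ 2 + e ^ 2)) j) ∂μ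
      ≤ ENNReal.ofReal (averagingConst C * e ^ (α - 1)) := by
  obtain ⟨X, Y, hY, h⟩ := exists_siteSum_rankOne
    (potentialMatrix_isHermitian hB (Function.update x j 0)) j c he
  simp only [fun t => h t _ (potentialMatrix_isHermitian hB (Function.update x j t))
    (potentialMatrix_update B x j t)]
  refine (lintegral_poissonKernel_le hμ X (he.trans_le hY)).trans (ENNReal.ofReal_le_ofReal ?_)
  -- The exponent `α - 1` is nonpositive, so widening the kernel from `e` to `Y` only lowers the
  -- bound.
  exact mul_le_mul_of_nonneg_left (Real.rpow_le_rpow_of_nonpos he hY (by linarith))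
    (averagingConst_nonneg C)

theorem indicator_Ioo_le_poisson (c : ℝ) {e : ℝ} (he : 0 < e) (y : ℝ) :
    (Set.Ioo (c - e) (c + e)).indicator (fun _ => (1 : ℝ)) y
      ≤ 2 * e * (e / ((y - c) ^ 2 + e ^ 2)) := by
  by_cases hy : y ∈ Set.Ioo (c - e) (c + e)
  · rw [Set.indicator_of_mem hy, ← mul_div_assoc, one_le_div (by positivity)]
    nlinarith [hy.1, hy.2]
  · rw [Set.indicator_of_notMem hy]
    positivity

theorem ofReal_siteSum_indicator_le {A : Matrix ι ι ℂ} (hA : A.IsHermitian) (j : ι) (c : ℝ) {e : ℝ}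
    (he : 0 < e) :
    ENNReal.ofReal (siteSum hA ((Set.Ioo (c - e) (c + e)).indicator fun _ => (1 : ℝ)) j)
      ≤ ENNReal.ofReal (2 * e) *
        ENNReal.ofReal (siteSum hA (fun y => e / ((y - c) ^ 2 + e ^ 2)) j) := by
  rw [← ENNReal.ofReal_mul (by positivity), ← siteSum_mul_left_real]
  exact ENNReal.ofReal_le_ofReal (siteSum_mono hA (indicator_Ioo_le_poisson c he) j)

theorem ofReal_two_mul_averaging {α : ℝ} (C : ℝ≥0) {e : ℝ} (he : 0 < e) :
    ENNReal.ofReal (2 * e) * ENNReal.ofReal (averagingConst C * e ^ (α - 1))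
      = ENNReal.ofReal (2 * averagingConst C * e ^ α) := by
  rw [← ENNReal.ofReal_mul (by positivity), Real.rpow_sub_one he.ne']
  congr 1
  field_simp

theorem lintegral_update_indicator_le {α : ℝ} (hα : α ≤ 1) {C : ℝ≥0} {μ : Measure ℝ}
    (hμ : HolderBound α C μ) {B : Matrix ι ι ℂ} (hB : B.IsHermitian) (x : ι → ℝ) (j : ι) (c : ℝ)
    {e : ℝ} (he : 0 < e) :
    ∫⁻ t, ENNReal.ofReal (siteSum (potentialMatrix_isHermitian hB (Function.update x j t))
        ((Set.Ioo (c - e) (c + e)).indicator fun _ => (1 : ℝ)) j) ∂μ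
      ≤ ENNReal.ofReal (2 * averagingConst C * e ^ α) := by
  rw [← ofReal_two_mul_averaging C he]
  refine (lintegral_mono fun t => ofReal_siteSum_indicator_le _ j c he).trans ?_
  rw [lintegral_const_mul' _ _ ENNReal.ofReal_ne_top]
  gcongr
  exact lintegral_update_poisson_le hα hμ hB x j c he

/-- Resampling one coordinate independently does not change a product law. Only the discarded
coordinate contributes an extra factor, the total mass one. This is what lets the potential at one
site be integrated separately. -/
theorem measurePreserving_update (μ : Measure ℝ) [IsProbabilityMeasure μ] (j : ι) :
    MeasurePreserving (fun p : (ι → ℝ) × ℝ => Function.update p.1 j p.2)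
      ((Measure.pi fun _ : ι => μ).prod μ) (Measure.pi fun _ : ι => μ) := by
  have hmeas : Measurable fun p : (ι → ℝ) × ℝ => Function.update p.1 j p.2 := by
    refine measurable_pi_lambda _ fun i => ?_
    by_cases h : i = j
    · subst h; simpa using measurable_snd
    · simpa [h] using (by fun_prop : Measurable fun p : (ι → ℝ) × ℝ => p.1 i)
  refine ⟨hmeas, ?_⟩
  symm
  refine Measure.pi_eq fun s hs => ?_
  rw [Measure.map_apply hmeas (MeasurableSet.univ_pi hs)]
  have h : (fun p : (ι → ℝ) × ℝ => Function.update p.1 j p.2) ⁻¹' Set.univ.pi s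
      = (Set.univ.pi (Function.update s j Set.univ)) ×ˢ s j := by
    ext p
    simp only [Set.mem_preimage, Set.mem_univ_pi, Set.mem_prod]
    constructor
    · intro h
      refine ⟨fun i => ?_, by simpa using h j⟩
      by_cases hi : i = j
      · subst hi; simp
      · simpa [hi] using h i
    · rintro ⟨h1, h2⟩ i
      by_cases hi : i = j
      · subst hi; simpa using h2
      · simpa [hi] using h1 i
  rw [h, Measure.prod_prod, Measure.pi_pi,
    ← Finset.prod_erase_mul _ _ (Finset.mem_univ j), ← Finset.prod_erase_mul (a := j) _ _
      (Finset.mem_univ j)]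
  simp only [Function.update_self, measure_univ, mul_one]
  congr 1
  refine Finset.prod_congr rfl fun i hi => ?_
  rw [Function.update_of_ne (Finset.ne_of_mem_erase hi)]

theorem lintegral_pi_eq_update (μ : Measure ℝ) [IsProbabilityMeasure μ] (j : ι)
    {F : (ι → ℝ) → ℝ≥0∞} (hF : Measurable F) :
    ∫⁻ x, F x ∂(Measure.pi fun _ : ι => μ)
      = ∫⁻ x, ∫⁻ t, F (Function.update x j t) ∂μ ∂(Measure.pi fun _ : ι => μ) := by
  have hp := measurePreserving_update μ j
  rw [← hp.lintegral_comp hF, lintegral_prod (fun p : (ι → ℝ) × ℝ => F (Function.update p.1 j p.2))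
    (hF.comp hp.measurable).aemeasurable]

theorem lintegral_pi_poisson_le {α : ℝ} (hα : α ≤ 1) {C : ℝ≥0} {μ : Measure ℝ}
    [IsProbabilityMeasure μ] (hμ : HolderBound α C μ) {B : Matrix ι ι ℂ} (hB : B.IsHermitian)
    (j : ι) (c : ℝ) {e : ℝ} (he : 0 < e) :
    ∫⁻ x, ENNReal.ofReal (siteSum (potentialMatrix_isHermitian hB x)
        (fun y => e / ((y - c) ^ 2 + e ^ 2)) j) ∂(Measure.pi fun _ : ι => μ)
      ≤ ENNReal.ofReal (averagingConst C * e ^ (α - 1)) := by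
  have hcont : Continuous fun y : ℝ => e / ((y - c) ^ 2 + e ^ 2) :=
    continuous_const.div (by fun_prop) fun y => by positivity
  rw [lintegral_pi_eq_update μ j (measurable_siteSum (potentialMatrix_isHermitian hB)
    (measurable_potentialMatrix B) j hcont).ennreal_ofReal]
  refine (lintegral_mono fun x => lintegral_update_poisson_le hα hμ hB x j c he).trans ?_
  rw [lintegral_const, measure_univ, mul_one]

theorem lintegral_pi_indicator_le {α : ℝ} (hα : α ≤ 1) {C : ℝ≥0} {μ : Measure ℝ}
    [IsProbabilityMeasure μ] (hμ : HolderBound α C μ) {B : Matrix ι ι ℂ} (hB : B.IsHermitian)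
    (j : ι) (c : ℝ) {e : ℝ} (he : 0 < e) :
    ∫⁻ x, ENNReal.ofReal (siteSum (potentialMatrix_isHermitian hB x)
        ((Set.Ioo (c - e) (c + e)).indicator fun _ => (1 : ℝ)) j) ∂(Measure.pi fun _ : ι => μ)
      ≤ ENNReal.ofReal (2 * averagingConst C * e ^ α) := by
  rw [← ofReal_two_mul_averaging C he]
  refine (lintegral_mono fun x => ofReal_siteSum_indicator_le _ j c he).trans ?_
  rw [lintegral_const_mul' _ _ ENNReal.ofReal_ne_top]
  gcongr
  exact lintegral_pi_poisson_le hα hμ hB j c he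

theorem natCast_eigenvalueCount_eq {A : Matrix ι ι ℂ} (hA : A.IsHermitian) (J : Set ℝ) :
    (eigenvalueCount hA J : ℝ≥0∞)
      = ∑ j, ENNReal.ofReal (siteSum hA (J.indicator fun _ => (1 : ℝ)) j) := by
  rw [← ENNReal.ofReal_sum_of_nonneg fun j _ => siteSum_nonneg hA
    (fun x => Set.indicator_nonneg (fun _ _ => zero_le_one) x) j, sum_siteSum_eq_eigenvalueCount,
    ENNReal.ofReal_natCast]

/-- The Wegner estimate. -/
theorem wegner_pi {α : ℝ} (hα : α ≤ 1) {C : ℝ≥0} {μ : Measure ℝ}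
    [IsProbabilityMeasure μ] (hμ : HolderBound α C μ) {B : Matrix ι ι ℂ} (hB : B.IsHermitian)
    (c : ℝ) {e : ℝ} (he : 0 < e) :
    ∫⁻ x, (eigenvalueCount (potentialMatrix_isHermitian hB x) (Set.Ioo (c - e) (c + e)) : ℝ≥0∞)
        ∂(Measure.pi fun _ : ι => μ)
      ≤ Fintype.card ι * ENNReal.ofReal (2 * averagingConst C * e ^ α) := by
  simp only [natCast_eigenvalueCount_eq]
  rw [lintegral_finsetSum _ fun j _ => (measurable_siteSum_indicator_Ioo
    (potentialMatrix_isHermitian hB) (measurable_potentialMatrix B) j _ _).ennreal_ofReal]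
  refine (Finset.sum_le_sum fun j _ => lintegral_pi_indicator_le hα hμ hB j c he).trans ?_
  rw [Finset.sum_const, Finset.card_univ, nsmul_eq_mul]

/-- The Minami estimate. -/
theorem minami_pi {α : ℝ} (hα : α ≤ 1) {C : ℝ≥0} {μ : Measure ℝ}
    [IsProbabilityMeasure μ] (hμ : HolderBound α C μ) {B : Matrix ι ι ℂ} (hB : B.IsHermitian)
    (c : ℝ) {e : ℝ} (he : 0 < e) :
    ∫⁻ x, ((eigenvalueCount (potentialMatrix_isHermitian hB x) (Set.Ioo (c - e) (c + e)) *
        (eigenvalueCount (potentialMatrix_isHermitian hB x) (Set.Ioo (c - e) (c + e)) - 1) : ℕ)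
          : ℝ≥0∞) ∂(Measure.pi fun _ : ι => μ)
      ≤ (Fintype.card ι * ENNReal.ofReal (2 * averagingConst C * e ^ α)) ^ 2 := by
  set J := Set.Ioo (c - e) (c + e) with hJ
  set N : (ι → ℝ) → ℕ := fun x => eigenvalueCount (potentialMatrix_isHermitian hB x) J with hN
  set s : ι → (ι → ℝ) → ℝ≥0∞ := fun j x => ENNReal.ofReal
    (siteSum (potentialMatrix_isHermitian hB x) (J.indicator fun _ => (1 : ℝ)) j) with hs
  set a := ENNReal.ofReal (2 * averagingConst C * e ^ α)
  have hsm : ∀ j, Measurable (s j) := fun j => (measurable_siteSum_indicator_Ioo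
    (potentialMatrix_isHermitian hB) (measurable_potentialMatrix B) j _ _).ennreal_ofReal
  have hNm : Measurable N := measurable_eigenvalueCount
    (potentialMatrix_isHermitian hB) (measurable_potentialMatrix B) _ _
  have hNm' : Measurable fun x => ((N x - 1 : ℕ) : ℝ≥0∞) :=
    (measurable_from_top (f := fun n : ℕ => ((n - 1 : ℕ) : ℝ≥0∞))).comp hNm
  have hW : ∫⁻ x, (N x : ℝ≥0∞) ∂(Measure.pi fun _ : ι => μ) ≤ Fintype.card ι * a :=
    wegner_pi hα hμ hB c he
  -- The two matrices differ only in the entry at `(j, j)`, so the counts differ by at most one. The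
  -- bound `N x` does not involve the resampled value `t`.
  have hstep : ∀ j x t, N (Function.update x j t) - 1 ≤ N x := by
    intro j x t
    rw [Nat.sub_le_iff_le_add]
    refine eigenvalueCount_le_add_one _ _ j (fun k l hl => ?_) _ _
    simp only [potentialMatrix, Matrix.add_apply, Matrix.diagonal_apply]
    by_cases hkl : k = l
    · subst hkl; simp [hl]
    · simp [hkl]
  -- After resampling site `j`, only the weight at `j` depends on `t`. Spectral averaging bounds its
  -- integral by `a`, and the Wegner estimate handles the remaining `N x`.
  have hj : ∀ j, ∫⁻ x, s j x * ((N x - 1 : ℕ) : ℝ≥0∞) ∂(Measure.pi fun _ : ι => μ)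
      ≤ Fintype.card ι * a * a := by
    intro j
    rw [lintegral_pi_eq_update μ j (F := fun x => s j x * ((N x - 1 : ℕ) : ℝ≥0∞))
      ((hsm j).mul hNm')]
    calc _ ≤ ∫⁻ x, a * (N x : ℝ≥0∞) ∂(Measure.pi fun _ : ι => μ) := by
          refine lintegral_mono fun x => ?_
          calc _ ≤ ∫⁻ t, s j (Function.update x j t) * (N x : ℝ≥0∞) ∂μ := by
                refine lintegral_mono fun t => ?_
                gcongr
                exact hstep j x t
            _ = (∫⁻ t, s j (Function.update x j t) ∂μ) * (N x : ℝ≥0∞) :=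
                lintegral_mul_const' _ _ (ENNReal.natCast_ne_top _)
            _ ≤ _ := by
                gcongr
                exact lintegral_update_indicator_le hα hμ hB x j c he
      _ = a * ∫⁻ x, (N x : ℝ≥0∞) ∂(Measure.pi fun _ : ι => μ) :=
          lintegral_const_mul' _ _ ENNReal.ofReal_ne_top
      _ ≤ a * (Fintype.card ι * a) := by gcongr
      _ = _ := mul_comm _ _
  calc _ = ∫⁻ x, ∑ j, s j x * ((N x - 1 : ℕ) : ℝ≥0∞) ∂(Measure.pi fun _ : ι => μ) := by
        refine lintegral_congr fun x => ?_
        rw [Nat.cast_mul, ← Finset.sum_mul]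
        congr 1
        exact natCast_eigenvalueCount_eq _ J
    _ = ∑ j, ∫⁻ x, s j x * ((N x - 1 : ℕ) : ℝ≥0∞) ∂(Measure.pi fun _ : ι => μ) :=
        lintegral_finsetSum _ fun j _ => (hsm j).mul hNm'
    _ ≤ ∑ _j : ι, Fintype.card ι * a * a := Finset.sum_le_sum fun j _ => hj j
    _ = _ := by
        rw [Finset.sum_const, Finset.card_univ, nsmul_eq_mul]
        ring

end Averaging

/-! ### Transfer of the estimates to the Anderson model at the scale of eigenvalue spacing -/

section Model

variable {d : ℕ} {H₀ : L2 d →L[ℂ] L2 d}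

theorem siteSum_congr {ι : Type*} [Fintype ι] [DecidableEq ι] {A B : Matrix ι ι ℂ} (h : A = B)
    (hA : A.IsHermitian) (hB : B.IsHermitian) {F : Type*} [AddCommGroup F] [Module ℝ F]
    (f : ℝ → F) (n : ι) : siteSum hA f n = siteSum hB f n := by
  subst h; rfl

theorem eigenvalueCount_congr {ι : Type*} [Fintype ι] [DecidableEq ι] {A B : Matrix ι ι ℂ}
    (h : A = B) (hA : A.IsHermitian) (hB : B.IsHermitian) (J : Set ℝ) :
    eigenvalueCount hA J = eigenvalueCount hB J := by
  subst h; rfl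

theorem compression_eq_potentialMatrix (H₀ : L2 d →L[ℂ] L2 d) (ω : (Fin d → ℤ) → ℝ)
    (Λ : Finset (Fin d → ℤ)) :
    compression H₀ ω Λ = potentialMatrix (compression H₀ 0 Λ) fun x : Λ => ω x := by
  ext x y
  rw [potentialMatrix, Matrix.add_apply, compression_apply, compression_apply,
    Matrix.diagonal_apply]
  simp

theorem measurable_compression {Ω : Type*} [MeasurableSpace Ω] {V : (Fin d → ℤ) → Ω → ℝ}
    (hV : ∀ j, Measurable (V j)) (Λ : Finset (Fin d → ℤ)) (x y : Λ) :
    Measurable fun ω => compression H₀ (fun j => V j ω) Λ x y := by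
  simp only [compression_apply]
  refine measurable_const.add ?_
  split_ifs
  · exact Complex.measurable_ofReal.comp (hV _)
  · exact measurable_const

theorem norm_basisVec (x : Fin d → ℤ) : ‖basisVec x‖ = 1 := by
  rw [basisVec, lp.norm_single (by norm_num), norm_one]

theorem norm_compression_le_of_ne (ω : (Fin d → ℤ) → ℝ) (Λ : Finset (Fin d → ℤ)) {x y : Λ}
    (h : x ≠ y) : ‖compression H₀ ω Λ x y‖ ≤ ‖H₀‖ := by
  rw [compression_apply, if_neg h, add_zero]
  refine (norm_inner_le_norm _ _).trans ?_
  rw [norm_basisVec, one_mul]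
  refine (H₀.le_opNorm _).trans ?_
  rw [norm_basisVec, mul_one]

/-- An independent identically distributed family with common law `μ`. -/
structure IsIIDPotential {Ω : Type*} [MeasurableSpace Ω] (P : Measure Ω)
    (V : (Fin d → ℤ) → Ω → ℝ) (μ : Measure ℝ) : Prop where
  measurable : ∀ j, Measurable (V j)
  indep : iIndepFun V P
  law : ∀ j, P.map (V j) = μ

variable {Ω : Type*} [MeasurableSpace Ω] {P : Measure Ω} [IsProbabilityMeasure P]
  {V : (Fin d → ℤ) → Ω → ℝ} {μ : Measure ℝ}

theorem IsIIDPotential.isProbabilityMeasure (hV : IsIIDPotential P V μ) :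
    IsProbabilityMeasure μ := by
  rw [← hV.law 0]
  exact Measure.isProbabilityMeasure_map (hV.measurable 0).aemeasurable

theorem IsIIDPotential.measurePreserving (hV : IsIIDPotential P V μ) (Λ : Finset (Fin d → ℤ)) :
    MeasurePreserving (fun ω (x : Λ) => V x ω) P (Measure.pi fun _ : Λ => μ) := by
  refine ⟨measurable_pi_lambda _ fun x => hV.measurable x, ?_⟩
  have h := (iIndepFun_iff_map_fun_eq_pi_map (f := fun (x : Λ) => V x)
    fun x => (hV.measurable x).aemeasurable).1 (hV.indep.precomp Subtype.val_injective)
  rw [h]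
  simp only [hV.law]

/-- The number of points of the cube of side `2L + 1`. -/
def volumeAt (d L : ℕ) : ℝ := (2 * (L : ℝ) + 1) ^ d

theorem volumeAt_pos (d L : ℕ) : 0 < volumeAt d L := by
  unfold volumeAt; positivity

theorem scale_pos (d : ℕ) (α : ℝ) (L : ℕ) : 0 < scale d α L := by
  unfold scale; positivity

/-- This identity fixes the choice of scale: an energy window of width `1 / β_L` has Hölder weight
of order one over the volume, so averaged counts in the full cube stay bounded. -/
theorem scale_rpow (d : ℕ) {α : ℝ} (hα : 0 < α) (L : ℕ) : scale d α L ^ α = volumeAt d L := by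
  rw [scale, volumeAt, ← Real.rpow_mul (by positivity), div_mul_cancel₀ _ hα.ne', Real.rpow_natCast]

theorem one_le_scale (d : ℕ) {α : ℝ} (hα : 0 < α) (L : ℕ) : 1 ≤ scale d α L :=
  Real.one_le_rpow (by linarith [Nat.cast_nonneg (α := ℝ) L]) (by positivity)

/-- The matrix element `⟨δ_n, f(β_L (H_Λ - E)) δ_n⟩`, and `0` if `n ∉ Λ`. -/
def siteObs (hH₀ : IsSelfAdjoint H₀) (α E : ℝ) (L : ℕ) (Λ : Finset (Fin d → ℤ))
    (ω : (Fin d → ℤ) → ℝ) {F : Type*} [AddCommGroup F] [Module ℝ F] (f : ℝ → F)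
    (n : Fin d → ℤ) : F :=
  if h : n ∈ Λ then siteSum (compression_isHermitian hH₀ ω Λ)
    (fun y => f (scale d α L * (y - E))) ⟨n, h⟩ else 0

/-- The number of eigenvalues `λ` of `H_Λ` with `β_L (λ - E) ∈ I`. -/
def boxCount (hH₀ : IsSelfAdjoint H₀) (α E : ℝ) (L : ℕ) (Λ : Finset (Fin d → ℤ))
    (ω : (Fin d → ℤ) → ℝ) (I : Set ℝ) : ℕ :=
  eigenvalueCount (compression_isHermitian hH₀ ω Λ) {y | scale d α L * (y - E) ∈ I}

theorem rescaledCount_eq_boxCount (hH₀ : IsSelfAdjoint H₀) (α E : ℝ) (L : ℕ)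
    (ω : (Fin d → ℤ) → ℝ) (I : Set ℝ) :
    rescaledCount hH₀ α L E ω I = boxCount hH₀ α E L (centeredCube d L) ω I := rfl

theorem scaled_preimage_Ioo (d : ℕ) (α E : ℝ) (L : ℕ) (u v : ℝ) :
    {y | scale d α L * (y - E) ∈ Set.Ioo u v}
      = Set.Ioo (E + u / scale d α L) (E + v / scale d α L) := by
  have hβ := scale_pos d α L
  ext y
  simp only [Set.mem_ofPred_eq, Set.mem_Ioo]
  rw [← sub_lt_iff_lt_add', div_lt_iff₀' hβ |>.symm.trans lt_sub_iff_add_lt',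
    lt_div_iff₀' hβ]

theorem scaled_preimage_Ioo' (d : ℕ) (α E : ℝ) (L : ℕ) (u v : ℝ) :
    {y | scale d α L * (y - E) ∈ Set.Ioo u v}
      = Set.Ioo ((E + (u + v) / 2 / scale d α L) - (v - u) / 2 / scale d α L)
        ((E + (u + v) / 2 / scale d α L) + (v - u) / 2 / scale d α L) := by
  rw [scaled_preimage_Ioo]
  congr 1 <;> ring

variable (hH₀ : IsSelfAdjoint H₀) (α E : ℝ) (L : ℕ) (Λ : Finset (Fin d → ℤ))

theorem siteObs_mono (ω : (Fin d → ℤ) → ℝ) {f g : ℝ → ℝ} (h : ∀ x, f x ≤ g x) (n : Fin d → ℤ) :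
    siteObs hH₀ α E L Λ ω f n ≤ siteObs hH₀ α E L Λ ω g n := by
  unfold siteObs
  split_ifs
  · exact siteSum_mono _ (fun _ => h _) _
  · exact le_rfl

theorem siteObs_nonneg (ω : (Fin d → ℤ) → ℝ) {f : ℝ → ℝ} (h : ∀ x, 0 ≤ f x) (n : Fin d → ℤ) :
    0 ≤ siteObs hH₀ α E L Λ ω f n := by
  unfold siteObs
  split_ifs
  · exact siteSum_nonneg _ (fun _ => h _) _
  · exact le_rfl

theorem norm_siteObs_le (ω : (Fin d → ℤ) → ℝ) (f : ℝ → ℂ) (n : Fin d → ℤ) :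
    ‖siteObs hH₀ α E L Λ ω f n‖ ≤ siteObs hH₀ α E L Λ ω (fun x => ‖f x‖) n := by
  unfold siteObs
  split_ifs
  · exact norm_siteSum_le _ _ _
  · simp

theorem siteObs_add {F : Type*} [AddCommGroup F] [Module ℝ F] (ω : (Fin d → ℤ) → ℝ) (f g : ℝ → F)
    (n : Fin d → ℤ) : siteObs hH₀ α E L Λ ω (fun x => f x + g x) n
      = siteObs hH₀ α E L Λ ω f n + siteObs hH₀ α E L Λ ω g n := by
  unfold siteObs
  split_ifs
  · exact siteSum_add _ _ _ _
  · simp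

theorem siteObs_sub {F : Type*} [AddCommGroup F] [Module ℝ F] (ω : (Fin d → ℤ) → ℝ) (f g : ℝ → F)
    (n : Fin d → ℤ) : siteObs hH₀ α E L Λ ω (fun x => f x - g x) n
      = siteObs hH₀ α E L Λ ω f n - siteObs hH₀ α E L Λ ω g n := by
  unfold siteObs
  split_ifs
  · exact siteSum_sub _ _ _ _
  · simp

theorem siteObs_mul_left (ω : (Fin d → ℤ) → ℝ) (c : ℂ) (f : ℝ → ℂ) (n : Fin d → ℤ) :
    siteObs hH₀ α E L Λ ω (fun x => c * f x) n = c * siteObs hH₀ α E L Λ ω f n := by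
  unfold siteObs
  split_ifs
  · exact siteSum_mul_left _ _ _ _
  · simp

theorem siteObs_mul_left_real (ω : (Fin d → ℤ) → ℝ) (c : ℝ) (f : ℝ → ℝ) (n : Fin d → ℤ) :
    siteObs hH₀ α E L Λ ω (fun x => c * f x) n = c * siteObs hH₀ α E L Λ ω f n := by
  unfold siteObs
  split_ifs
  · exact siteSum_mul_left_real _ _ _ _
  · simp

theorem siteObs_ofReal (ω : (Fin d → ℤ) → ℝ) (f : ℝ → ℝ) (n : Fin d → ℤ) :
    siteObs hH₀ α E L Λ ω (fun x => (f x : ℂ)) n = ((siteObs hH₀ α E L Λ ω f n : ℝ) : ℂ) := by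
  unfold siteObs
  split_ifs
  · exact siteSum_ofReal _ _ _
  · simp

theorem siteObs_conj (ω : (Fin d → ℤ) → ℝ) (f : ℝ → ℂ) (n : Fin d → ℤ) :
    siteObs hH₀ α E L Λ ω (fun x => starRingEnd ℂ (f x)) n
      = starRingEnd ℂ (siteObs hH₀ α E L Λ ω f n) := by
  unfold siteObs
  split_ifs
  · exact siteSum_conj _ _ _
  · simp

theorem sum_siteObs_indicator (ω : (Fin d → ℤ) → ℝ) (I : Set ℝ) :
    ∑ n ∈ Λ, siteObs hH₀ α E L Λ ω (I.indicator fun _ => (1 : ℝ)) n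
      = (boxCount hH₀ α E L Λ ω I : ℝ) := by
  rw [boxCount, ← sum_siteSum_eq_eigenvalueCount, ← Finset.sum_coe_sort]
  refine Finset.sum_congr rfl fun n _ => ?_
  rw [siteObs, dif_pos n.2]
  rfl

theorem measurable_siteObs (hV : ∀ j, Measurable (V j)) {f : ℝ → ℝ} (hf : Continuous f)
    (n : Fin d → ℤ) : Measurable fun ω => siteObs hH₀ α E L Λ (fun j => V j ω) f n := by
  unfold siteObs
  split_ifs
  · exact measurable_siteSum _ (measurable_compression hV Λ) _ (by fun_prop)
  · exact measurable_const

theorem measurable_siteObs_complex (hV : ∀ j, Measurable (V j)) {f : ℝ → ℂ} (hf : Continuous f)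
    (n : Fin d → ℤ) : Measurable fun ω => siteObs hH₀ α E L Λ (fun j => V j ω) f n := by
  have h : ∀ ω : Ω, siteObs hH₀ α E L Λ (fun j => V j ω) f n
      = ((siteObs hH₀ α E L Λ (fun j => V j ω) (fun x => (f x).re) n : ℝ) : ℂ)
        + Complex.I * ((siteObs hH₀ α E L Λ (fun j => V j ω) (fun x => (f x).im) n : ℝ) : ℂ) := by
    intro ω
    rw [← siteObs_ofReal, ← siteObs_ofReal, ← siteObs_mul_left, ← siteObs_add]
    congr 1
    funext x
    rw [mul_comm, Complex.re_add_im]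
  simp only [h]
  have h1 := measurable_siteObs hH₀ α E L Λ hV (Complex.continuous_re.comp hf) n
  have h2 := measurable_siteObs hH₀ α E L Λ hV (Complex.continuous_im.comp hf) n
  exact (Complex.measurable_ofReal.comp h1).add
    (measurable_const.mul (Complex.measurable_ofReal.comp h2))

theorem measurable_boxCount (hV : ∀ j, Measurable (V j)) (u v : ℝ) :
    Measurable fun ω => boxCount hH₀ α E L Λ (fun j => V j ω) (Set.Ioo u v) := by
  unfold boxCount
  rw [scaled_preimage_Ioo]
  exact measurable_eigenvalueCount _ (measurable_compression hV Λ) _ _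

theorem measurable_siteObs_indicator (hV : ∀ j, Measurable (V j)) (u v : ℝ) (n : Fin d → ℤ) :
    Measurable fun ω => siteObs hH₀ α E L Λ (fun j => V j ω)
      ((Set.Ioo u v).indicator fun _ => (1 : ℝ)) n := by
  unfold siteObs
  split_ifs with h
  · have := measurable_siteSum_indicator_Ioo (A := fun ω => compression H₀ (fun j => V j ω) Λ)
      (fun ω => compression_isHermitian hH₀ (fun j => V j ω) Λ)
      (measurable_compression hV Λ) ⟨n, h⟩ (E + u / scale d α L) (E + v / scale d α L)
    rw [← scaled_preimage_Ioo] at this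
    exact this
  · exact measurable_const

variable {α} {C : ℝ≥0}

theorem lintegral_siteSum_poisson_le (hα₁ : α ≤ 1) (hV : IsIIDPotential P V μ)
    (hμ : HolderBound α C μ) (n : Λ) (c : ℝ) {e : ℝ} (he : 0 < e) :
    ∫⁻ ω, ENNReal.ofReal (siteSum (compression_isHermitian hH₀ (fun j => V j ω) Λ)
        (fun y => e / ((y - c) ^ 2 + e ^ 2)) n) ∂P
      ≤ ENNReal.ofReal (averagingConst C * e ^ (α - 1)) := by
  have := hV.isProbabilityMeasure
  have hcont : Continuous fun y : ℝ => e / ((y - c) ^ 2 + e ^ 2) :=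
    continuous_const.div (by fun_prop) fun y => by positivity
  have h := lintegral_pi_poisson_le hα₁ hμ (compression_isHermitian hH₀ 0 Λ) n c he
  rw [← (hV.measurePreserving Λ).lintegral_comp
    (f := fun x => ENNReal.ofReal (siteSum
      (potentialMatrix_isHermitian (compression_isHermitian hH₀ 0 Λ) x)
        (fun y => e / ((y - c) ^ 2 + e ^ 2)) n)) (measurable_siteSum
        (potentialMatrix_isHermitian (compression_isHermitian hH₀ 0 Λ)) (measurable_potentialMatrix _)
        n hcont).ennreal_ofReal] at h
  simpa only [siteSum_congr (compression_eq_potentialMatrix H₀ _ Λ)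
    (compression_isHermitian hH₀ _ Λ) (potentialMatrix_isHermitian
      (compression_isHermitian hH₀ 0 Λ) _)] using h

/-- Spectral averaging for the rescaled Poisson kernel. -/
theorem lintegral_siteObs_poisson_le (hα₀ : 0 < α) (hα₁ : α ≤ 1) (hV : IsIIDPotential P V μ)
    (hμ : HolderBound α C μ) (n : Fin d → ℤ) (c : ℝ) {e : ℝ} (he : 0 < e) :
    ∫⁻ ω, ENNReal.ofReal (siteObs hH₀ α E L Λ (fun j => V j ω)
        (fun x => e / ((x - c) ^ 2 + e ^ 2)) n) ∂P
      ≤ ENNReal.ofReal (averagingConst C * e ^ (α - 1) / volumeAt d L) := by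
  have hβ := scale_pos d α L
  set β := scale d α L with hβdef
  unfold siteObs
  split_ifs with hn
  -- Rescaling the energy turns the kernel of width `e` into `1 / β` times a kernel of width `e / β`
  -- centred at `E + c / β`. With the factor `(e / β) ^ (α - 1)` this gives `β ^ (-α)`, the inverse
  -- volume.
  · have hfun : ∀ y : ℝ, e / ((β * (y - E) - c) ^ 2 + e ^ 2)
        = β⁻¹ * ((e / β) / ((y - (E + c / β)) ^ 2 + (e / β) ^ 2)) := by
      intro y
      have h1 : (0:ℝ) < (β * (y - E) - c) ^ 2 + e ^ 2 := by positivity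
      have h2 : (y - (E + c / β)) ^ 2 + (e / β) ^ 2 = ((β * (y - E) - c) ^ 2 + e ^ 2) / β ^ 2 := by
        field_simp
        ring
      rw [h2]
      field_simp
    simp only [← hβdef, hfun, siteSum_mul_left_real]
    simp only [ENNReal.ofReal_mul (inv_nonneg.2 hβ.le)]
    rw [lintegral_const_mul' _ _ ENNReal.ofReal_ne_top]
    calc _ ≤ ENNReal.ofReal β⁻¹ * ENNReal.ofReal (averagingConst C * (e / β) ^ (α - 1)) := by
          gcongr
          exact lintegral_siteSum_poisson_le hH₀ Λ hα₁ hV hμ ⟨n, hn⟩ (E + c / β) (by positivity)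
      _ = _ := by
          rw [← ENNReal.ofReal_mul (by positivity), ← scale_rpow d hα₀, ← hβdef,
            Real.div_rpow he.le hβ.le, Real.rpow_sub_one hβ.ne']
          congr 1
          field_simp
  · simp

theorem wegner (hα₀ : 0 < α) (hα₁ : α ≤ 1) (hV : IsIIDPotential P V μ)
    (hμ : HolderBound α C μ) {u v : ℝ} (huv : u < v) :
    ∫⁻ ω, (boxCount hH₀ α E L Λ (fun j => V j ω) (Set.Ioo u v) : ℝ≥0∞) ∂P
      ≤ ENNReal.ofReal (Λ.card * (2 * averagingConst C * ((v - u) / 2) ^ α / volumeAt d L)) := by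
  have := hV.isProbabilityMeasure
  have hβ := scale_pos d α L
  have h := wegner_pi hα₁ hμ (compression_isHermitian hH₀ 0 Λ)
    (E + (u + v) / 2 / scale d α L) (e := (v - u) / 2 / scale d α L)
    (div_pos (by linarith) hβ)
  rw [← (hV.measurePreserving Λ).lintegral_comp
    (f := fun x => (eigenvalueCount (potentialMatrix_isHermitian
      (compression_isHermitian hH₀ 0 Λ) x) _ : ℝ≥0∞))
      (measurable_from_top.comp (measurable_eigenvalueCount
        (potentialMatrix_isHermitian (compression_isHermitian hH₀ 0 Λ))
        (measurable_potentialMatrix _) _ _))] at h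
  unfold boxCount
  rw [scaled_preimage_Ioo']
  simp only [eigenvalueCount_congr (compression_eq_potentialMatrix H₀ _ Λ)
    (compression_isHermitian hH₀ _ Λ) (potentialMatrix_isHermitian
      (compression_isHermitian hH₀ 0 Λ) _)]
  refine h.trans_eq ?_
  rw [ENNReal.ofReal_mul (p := (Λ.card : ℝ)) (by positivity), ENNReal.ofReal_natCast, Fintype.card_coe,
    Real.div_rpow (by linarith) hβ.le, scale_rpow d hα₀, mul_div_assoc]

theorem minami (hα₀ : 0 < α) (hα₁ : α ≤ 1) (hV : IsIIDPotential P V μ)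
    (hμ : HolderBound α C μ) {u v : ℝ} (huv : u < v) :
    ∫⁻ ω, ((boxCount hH₀ α E L Λ (fun j => V j ω) (Set.Ioo u v) *
        (boxCount hH₀ α E L Λ (fun j => V j ω) (Set.Ioo u v) - 1) : ℕ) : ℝ≥0∞) ∂P
      ≤ ENNReal.ofReal
        ((Λ.card * (2 * averagingConst C * ((v - u) / 2) ^ α / volumeAt d L)) ^ 2) := by
  have := hV.isProbabilityMeasure
  have hβ := scale_pos d α L
  have h := minami_pi hα₁ hμ (compression_isHermitian hH₀ 0 Λ)
    (E + (u + v) / 2 / scale d α L) (e := (v - u) / 2 / scale d α L)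
    (div_pos (by linarith) hβ)
  have hm := (measurable_from_top (f := fun k : ℕ => ((k * (k - 1) : ℕ) : ℝ≥0∞))).comp
    (measurable_eigenvalueCount (potentialMatrix_isHermitian (compression_isHermitian hH₀ 0 Λ))
      (measurable_potentialMatrix _)
      ((E + (u + v) / 2 / scale d α L) - (v - u) / 2 / scale d α L)
        ((E + (u + v) / 2 / scale d α L) + (v - u) / 2 / scale d α L))
  have h2 := (hV.measurePreserving Λ).lintegral_comp hm
  simp only [Function.comp_def] at h2
  rw [← h2] at h
  unfold boxCount
  rw [scaled_preimage_Ioo']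
  simp only [eigenvalueCount_congr (compression_eq_potentialMatrix H₀ _ Λ)
    (compression_isHermitian hH₀ _ Λ) (potentialMatrix_isHermitian
      (compression_isHermitian hH₀ 0 Λ) _)]
  refine h.trans_eq ?_
  have hK := averagingConst_nonneg C
  have hvol := volumeAt_pos d L
  have h0 : 0 ≤ (v - u) / 2 := by linarith
  rw [ENNReal.ofReal_pow (by positivity), ENNReal.ofReal_mul (p := (Λ.card : ℝ)) (by positivity),
    ENNReal.ofReal_natCast, Fintype.card_coe,
    Real.div_rpow h0 hβ.le, scale_rpow d hα₀, mul_div_assoc]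

end Model

/-! ### A priori bounds and length scales -/

/-- In the spectral expansion the product of two eigenvector components is at most the mean of their
squares, and the squares sum to one over the eigenbasis. -/
theorem norm_resolvent_apply_le {ι : Type*} [Fintype ι] [DecidableEq ι] {A : Matrix ι ι ℂ}
    (hA : A.IsHermitian) {z : ℂ} (hz : 0 < z.im) (n k : ι) :
    ‖(A - z • 1)⁻¹ n k‖ ≤ 1 / z.im := by
  rw [resolvent_eq_matrixFun hA hz.ne', matrixFun_apply]
  have hb : ∀ x : ℝ, ‖((x : ℂ) - z)⁻¹‖ ≤ 1 / z.im := by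
    intro x
    rw [norm_inv, inv_eq_one_div]
    refine one_div_le_one_div_of_le hz ?_
    have := Complex.abs_im_le_norm ((x : ℂ) - z)
    simpa [abs_of_pos hz] using this
  calc _ ≤ ∑ i, (siteWeight hA n i + siteWeight hA k i) / 2 * (1 / z.im) := by
        refine (norm_sum_le _ _).trans (Finset.sum_le_sum fun i _ => ?_)
        rw [norm_mul, norm_mul, norm_star, mul_right_comm]
        refine mul_le_mul ?_ (hb _) (norm_nonneg _) ?_
        · unfold siteWeight
          nlinarith [sq_nonneg (‖hA.eigenvectorBasis i n‖ - ‖hA.eigenvectorBasis i k‖)]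
        · have := siteWeight_nonneg hA n i
          have := siteWeight_nonneg hA k i
          positivity
    _ = 1 / z.im := by
        rw [← Finset.sum_mul, ← Finset.sum_div, Finset.sum_add_distrib, sum_siteWeight_right,
          sum_siteWeight_right]
        norm_num

/-- A bounded variable with a small fractional moment has a small mean. -/
theorem lintegral_le_of_fractional_moment {Ω : Type*} [MeasurableSpace Ω] {P : Measure Ω}
    [IsProbabilityMeasure P] {X : Ω → ℝ} {M s A δ : ℝ} (hX0 : ∀ ω, 0 ≤ X ω)
    (hX : ∀ ω, X ω ≤ M) (hM : 0 ≤ M) (hs : 0 < s) (hA : 0 ≤ A) (hδ : 0 < δ)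
    (h : ∫⁻ ω, ENNReal.ofReal (X ω ^ s) ∂P ≤ ENNReal.ofReal A) :
    ∫⁻ ω, ENNReal.ofReal (X ω) ∂P ≤ ENNReal.ofReal (δ + M * δ ^ (-s) * A) := by
  -- Where `X` exceeds `δ`, the factor `(X / δ) ^ s` is at least one, so it can be inserted in the
  -- deterministic bound `M`.
  have hpt : ∀ ω, ENNReal.ofReal (X ω)
      ≤ ENNReal.ofReal δ + ENNReal.ofReal (M * δ ^ (-s)) * ENNReal.ofReal (X ω ^ s) := by
    intro ω
    rw [← ENNReal.ofReal_mul (by positivity), ← ENNReal.ofReal_add hδ.le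
      (mul_nonneg (by positivity) (Real.rpow_nonneg (hX0 ω) _))]
    apply ENNReal.ofReal_le_ofReal
    by_cases hle : X ω ≤ δ
    · have : 0 ≤ M * δ ^ (-s) * X ω ^ s :=
        mul_nonneg (by positivity) (Real.rpow_nonneg (hX0 ω) _)
      linarith
    · push Not at hle
      have h1 : 1 ≤ δ ^ (-s) * X ω ^ s := by
        rw [Real.rpow_neg hδ.le, inv_mul_eq_div, one_le_div (by positivity)]
        gcongr
      nlinarith [hX ω]
  calc _ ≤ ∫⁻ ω, (ENNReal.ofReal δ + ENNReal.ofReal (M * δ ^ (-s)) * ENNReal.ofReal (X ω ^ s)) ∂P :=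
        lintegral_mono hpt
    _ = ENNReal.ofReal δ + ENNReal.ofReal (M * δ ^ (-s)) * ∫⁻ ω, ENNReal.ofReal (X ω ^ s) ∂P := by
        rw [lintegral_add_left measurable_const, lintegral_const, measure_univ, mul_one,
          lintegral_const_mul' _ _ ENNReal.ofReal_ne_top]
    _ ≤ ENNReal.ofReal δ + ENNReal.ofReal (M * δ ^ (-s)) * ENNReal.ofReal A := by gcongr
    _ = _ := by
        rw [← ENNReal.ofReal_mul (by positivity), ← ENNReal.ofReal_add hδ.le (by positivity)]

/-- The side (in points) of the small cubes. -/
def blockSide (L : ℕ) : ℕ := Nat.sqrt (2 * L + 1)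

/-- The thickness of the boundary layer of the small cubes. -/
def layer (L : ℕ) : ℕ := Nat.sqrt (blockSide L)

theorem lt_layer_pow (L : ℕ) : 2 * L + 1 < (layer L + 1) ^ 4 := by
  have h1 : 2 * L + 1 < (blockSide L + 1) ^ 2 := Nat.lt_succ_sqrt' _
  have h2 : blockSide L + 1 ≤ (layer L + 1) ^ 2 := Nat.lt_succ_sqrt' _
  calc _ < (blockSide L + 1) ^ 2 := h1
    _ ≤ ((layer L + 1) ^ 2) ^ 2 := by gcongr
    _ = _ := by ring

theorem tendsto_sqrt_atTop : Tendsto Nat.sqrt atTop atTop :=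
  Filter.tendsto_atTop_atTop.2 fun b => ⟨b * b, fun _ ha => Nat.le_sqrt.2 ha⟩

theorem tendsto_blockSide : Tendsto blockSide atTop atTop :=
  tendsto_sqrt_atTop.comp (tendsto_atTop_mono (fun L => by simp only [id]; omega) tendsto_id)

theorem tendsto_layer : Tendsto layer atTop atTop :=
  tendsto_sqrt_atTop.comp tendsto_blockSide

theorem centeredCube_eq_cube (d L : ℕ) :
    centeredCube d L = cube (fun _ => -(L : ℤ)) (2 * L) := by
  unfold centeredCube cube
  congr 1
  funext i
  push_cast
  ring

theorem card_centeredCube (d L : ℕ) : ((centeredCube d L).card : ℝ) = volumeAt d L := by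
  unfold centeredCube volumeAt
  rw [Pi.card_Icc]
  simp only [Int.card_Icc, Finset.prod_const, Finset.card_univ, Fintype.card_fin]
  have : ((L : ℤ) + 1 - -(L : ℤ)).toNat = 2 * L + 1 := by omega
  rw [this]
  push_cast
  ring

/-- `2 * L + 1` is below the fourth power of `layer L + 1`, so every power of the volume is
polynomial in the layer and loses to exponential decay across it. -/
theorem tendsto_polynomial_mul_exp_layer (d : ℕ) {α : ℝ} (hα : 0 < α) {κ : ℝ} (hκ : 0 < κ) :
    Tendsto (fun L => volumeAt d L ^ 3 * scale d α L * Real.exp (-κ * layer L)) atTop (𝓝 0) := by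
  set p : ℝ := (d : ℝ) * 3 + (d : ℝ) / α
  have hp : 0 ≤ p := by positivity
  have h1 := (tendsto_rpow_mul_exp_neg_mul_atTop_nhds_zero (4 * p) κ hκ).comp
    (tendsto_atTop_add_const_right _ (1 : ℝ) (tendsto_natCast_atTop_atTop.comp tendsto_layer))
  have h2 := h1.const_mul (Real.exp κ)
  rw [mul_zero] at h2
  refine squeeze_zero (fun L => ?_) (fun L => ?_) h2
  · have := volumeAt_pos d L
    have := scale_pos d α L
    positivity
  · have hx : (0 : ℝ) < 2 * (L : ℝ) + 1 := by positivity
    have h3 : volumeAt d L ^ 3 * scale d α L = (2 * (L : ℝ) + 1) ^ p := by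
      rw [volumeAt, scale, ← pow_mul, Real.rpow_add hx, ← Real.rpow_natCast]
      push_cast
      rfl
    have h4 : 2 * (L : ℝ) + 1 ≤ ((layer L : ℝ) + 1) ^ 4 := by
      exact_mod_cast (lt_layer_pow L).le
    simp only [Function.comp_def]
    rw [h3, mul_left_comm, ← Real.exp_add]
    have h5 : κ + -κ * ((layer L : ℝ) + 1) = -κ * layer L := by ring
    rw [h5]
    gcongr
    rw [Real.rpow_mul (by positivity)]
    refine Real.rpow_le_rpow hx.le ?_ hp
    exact_mod_cast h4

/-! ### Resolvents of the cube and of its subsets agree deep inside -/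

section Comparison

variable {d : ℕ} {H₀ : L2 d →L[ℂ] L2 d} (hH₀ : IsSelfAdjoint H₀) (α E : ℝ)
  {Ω : Type*} [MeasurableSpace Ω] (P : Measure Ω) (V : (Fin d → ℤ) → Ω → ℝ)

/-- The diagonal matrix elements of `f(β_L (H_Λ - E))` for `Λ = Λ_L` and for subsets `Γ` of `Λ`
agree up to `o(1 / |Λ|)` in mean, at sites at distance at least `layer L` from `Λ \ Γ`. -/
def Comparable (f : ℝ → ℂ) : Prop :=
  ∀ ε > 0, ∀ᶠ L in atTop, ∀ Γ ⊆ centeredCube d L, ∀ n ∈ Γ,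
    (∀ m ∈ centeredCube d L, m ∉ Γ → (layer L : ℝ) ≤ ‖n - m‖) →
    ∫⁻ ω, ‖siteObs hH₀ α E L (centeredCube d L) (fun j => V j ω) f n
        - siteObs hH₀ α E L Γ (fun j => V j ω) f n‖ₑ ∂P
      ≤ ENNReal.ofReal (ε / volumeAt d L)

variable {α E P V}

/-- The function `x ↦ 1 / (x - iη)`. -/
def cauchyFun (η : ℝ) (x : ℝ) : ℂ := ((x : ℂ) - η * Complex.I)⁻¹

/-- On the microscopic scale a Cauchy kernel is a resolvent at distance `η / β_L` from the real
axis, the regime in which the localization hypothesis speaks. -/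
theorem siteObs_cauchyFun (L : ℕ) {η : ℝ} (hη : 0 < η) (Λ : Finset (Fin d → ℤ))
    (ω : (Fin d → ℤ) → ℝ) {n : Fin d → ℤ} (hn : n ∈ Λ) :
    siteObs hH₀ α E L Λ ω (cauchyFun η) n = ((scale d α L)⁻¹ : ℝ) *
      (compression H₀ ω Λ - (⟨E, η / scale d α L⟩ : ℂ) • 1)⁻¹ ⟨n, hn⟩ ⟨n, hn⟩ := by
  have hβ := scale_pos d α L
  rw [siteObs, dif_pos hn, resolvent_apply_self (compression_isHermitian hH₀ ω Λ)
    (div_pos hη hβ).ne', ← siteSum_mul_left]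
  congr 1
  funext y
  have hβ' : ((scale d α L : ℝ) : ℂ) ≠ 0 := by exact_mod_cast hβ.ne'
  have hz : (⟨E, η / scale d α L⟩ : ℂ) = E + η / (scale d α L : ℝ) * Complex.I := by
    apply Complex.ext <;> simp [← Complex.ofReal_div]
  rw [cauchyFun, hz, Complex.ofReal_inv, ← mul_inv]
  congr 1
  push_cast
  field_simp
  ring

variable [IsProbabilityMeasure P]

/-- In the geometric resolvent identity the resolvent of `Γ` is bounded by `β / η`, the hopping by
`‖H₀‖`, and the resolvent of the large cube joins `n` to a site outside `Γ`, hence across the layer.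
Localization is thus used only for the large cube, so `Γ` may be any subset. The hopping may have
long range, so all pairs of sites are summed: this costs two volume factors, and the required
precision `ε / volumeAt d L` a third. -/
theorem comparable_cauchyFun (hα : 0 < α) (hV : ∀ j, Measurable (V j)) {a b : ℝ}
    (hE : E ∈ Set.Icc a b) (hloc : FractionalMomentLocalization H₀ P V a b) {η : ℝ} (hη : 0 < η) :
    Comparable hH₀ α E P V (cauchyFun η) := by
  obtain ⟨s, γ, C, hs, hγ, ℓ₀, hG⟩ := hloc
  intro ε hε
  -- The threshold `δ = exp (-γ D / (2 s))` makes `δ ^ (-s) * exp (-γ D)` equal to `exp (-γ D / 2)`;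
  -- `κ` is the smaller of the two decay rates.
  set κ := min (γ / (2 * s)) (γ / 2) with hκdef
  have hκ : 0 < κ := lt_min (by positivity) (by positivity)
  set K : ℝ := (1 / η) * ‖H₀‖ * (1 + (1 / η) * |C|) with hK
  have hK0 : 0 ≤ K := by positivity
  have hev := ((tendsto_polynomial_mul_exp_layer d hα hκ).const_mul K).eventually
    (gt_mem_nhds (show K * 0 < ε by rwa [mul_zero]))
  filter_upwards [hev, eventually_ge_atTop ℓ₀] with L hL hLℓ Γ hΓ n hn hdist
  have hβ := scale_pos d α L
  have hβ1 := one_le_scale d hα L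
  have hvol := volumeAt_pos d L
  set β := scale d α L with hβdef
  set Λ := centeredCube d L with hΛ
  set D : ℝ := (layer L : ℝ) with hD
  set z : ℂ := ⟨E, η / β⟩ with hz
  have hzim : 0 < z.im := div_pos hη hβ
  have hG' : ∀ n m : Λ, ∫⁻ ω, ENNReal.ofReal
      (‖((compression H₀ (fun j => V j ω) Λ - z • 1)⁻¹) n m‖ ^ s) ∂P
        ≤ ENNReal.ofReal (C * Real.exp (-γ * ‖n.1 - m.1‖)) := by
    rw [hΛ, centeredCube_eq_cube]
    exact hG _ (2 * L) (by omega) z hzim hE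
  have hRb : ∀ (Λ' : Finset (Fin d → ℤ)) (ω : Ω) (k m : Λ'),
      ‖(compression H₀ (fun j => V j ω) Λ' - z • 1)⁻¹ k m‖ ≤ β / η := by
    intro Λ' ω k m
    refine (norm_resolvent_apply_le (compression_isHermitian hH₀ _ Λ') hzim k m).trans_eq ?_
    simp only [hz, one_div_div]
  have hdecay : ∀ m n' : Λ, D ≤ ‖m.1 - n'.1‖ → ∫⁻ ω, ENNReal.ofReal
      ‖((compression H₀ (fun j => V j ω) Λ - z • 1)⁻¹) m n'‖ ∂P
        ≤ ENNReal.ofReal ((1 + β / η * |C|) * Real.exp (-κ * D)) := by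
    intro m n' hmn
    have h1 : ∫⁻ ω, ENNReal.ofReal
        (‖((compression H₀ (fun j => V j ω) Λ - z • 1)⁻¹) m n'‖ ^ s) ∂P
          ≤ ENNReal.ofReal (|C| * Real.exp (-γ * D)) := by
      refine (hG' m n').trans (ENNReal.ofReal_le_ofReal ?_)
      refine mul_le_mul (le_abs_self C) (Real.exp_le_exp.2 ?_) (Real.exp_nonneg _) (abs_nonneg _)
      nlinarith
    refine (lintegral_le_of_fractional_moment (fun _ => norm_nonneg _) (fun ω => hRb Λ ω m n')
      (by positivity) hs (by positivity) (Real.exp_pos (-(γ / (2 * s)) * D)) h1).trans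
      (ENNReal.ofReal_le_ofReal ?_)
    have hD0 : 0 ≤ D := Nat.cast_nonneg _
    have h2 : Real.exp (-(γ / (2 * s)) * D) ^ (-s) * Real.exp (-γ * D)
        = Real.exp (-(γ / 2) * D) := by
      rw [← Real.exp_mul, ← Real.exp_add]
      congr 1
      field_simp
      ring
    have h3 : Real.exp (-(γ / (2 * s)) * D) ≤ Real.exp (-κ * D) := by
      apply Real.exp_le_exp.2
      nlinarith [min_le_left (γ / (2 * s)) (γ / 2)]
    have h4 : Real.exp (-(γ / 2) * D) ≤ Real.exp (-κ * D) := by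
      apply Real.exp_le_exp.2
      nlinarith [min_le_right (γ / (2 * s)) (γ / 2)]
    calc _ = Real.exp (-(γ / (2 * s)) * D) + β / η * |C| *
          (Real.exp (-(γ / (2 * s)) * D) ^ (-s) * Real.exp (-γ * D)) := by ring
      _ ≤ Real.exp (-κ * D) + β / η * |C| * Real.exp (-κ * D) := by
          rw [h2]; gcongr
      _ = _ := by ring
  have hpt : ∀ ω, ‖siteObs hH₀ α E L Λ (fun j => V j ω) (cauchyFun η) n
        - siteObs hH₀ α E L Γ (fun j => V j ω) (cauchyFun η) n‖ₑ
      ≤ ∑ _k : Γ, ∑ m : Λ with m ∉ Set.range (fun x : Γ => (⟨x.1, hΓ x.2⟩ : Λ)),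
        ENNReal.ofReal (1 / η * ‖H₀‖) * ENNReal.ofReal
          ‖((compression H₀ (fun j => V j ω) Λ - z • 1)⁻¹) m ⟨n, hΓ hn⟩‖ := by
    intro ω
    have hres := resolvent_submatrix (compression_isHermitian hH₀ (fun j => V j ω) Λ)
      (compression_isHermitian hH₀ (fun j => V j ω) Γ) (fun x : Γ => (⟨x.1, hΓ x.2⟩ : Λ))
      (fun x y h => Subtype.ext (congrArg (fun w : Λ => w.1) h))
      (fun k l => by
        rw [compression_apply, compression_apply,
          if_congr (⟨fun h => by rw [h], fun h => Subtype.ext (congrArg (fun w : Λ => w.1) h)⟩ :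
            k = l ↔ (⟨k.1, hΓ k.2⟩ : Λ) = ⟨l.1, hΓ l.2⟩) rfl rfl]) hzim.ne' ⟨n, hn⟩
    rw [siteObs_cauchyFun hH₀ L hη Λ _ (hΓ hn), siteObs_cauchyFun hH₀ L hη Γ _ hn, ← mul_sub,
      ← neg_sub ((compression H₀ (fun j => V j ω) Γ - _)⁻¹ _ _), hres, ← ofReal_norm]
    simp only [← ENNReal.ofReal_mul (by positivity : 0 ≤ 1 / η * ‖H₀‖)]
    have hterm : ∀ (k : Γ) (m : Λ), (⟨k.1, hΓ k.2⟩ : Λ) ≠ m →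
        ‖(compression H₀ (fun j => V j ω) Γ - z • 1)⁻¹ ⟨n, hn⟩ k *
          compression H₀ (fun j => V j ω) Λ ⟨k.1, hΓ k.2⟩ m *
          (compression H₀ (fun j => V j ω) Λ - z • 1)⁻¹ m ⟨n, hΓ hn⟩‖
        ≤ β * (1 / η * ‖H₀‖ *
          ‖(compression H₀ (fun j => V j ω) Λ - z • 1)⁻¹ m ⟨n, hΓ hn⟩‖) := by
      intro k m hkm
      rw [norm_mul, norm_mul]
      calc _ ≤ β / η * ‖H₀‖ *
            ‖(compression H₀ (fun j => V j ω) Λ - z • 1)⁻¹ m ⟨n, hΓ hn⟩‖ := by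
            gcongr
            · exact hRb Γ ω _ _
            · exact norm_compression_le_of_ne _ _ hkm
        _ = _ := by ring
    rw [norm_mul, norm_neg, Complex.norm_real, Real.norm_of_nonneg (inv_nonneg.2 hβ.le)]
    refine (ENNReal.ofReal_le_ofReal (q := ∑ _k : Γ, ∑ m : Λ with
      m ∉ Set.range (fun x : Γ => (⟨x.1, hΓ x.2⟩ : Λ)), 1 / η * ‖H₀‖ *
        ‖((compression H₀ (fun j => V j ω) Λ - z • 1)⁻¹) m ⟨n, hΓ hn⟩‖) ?_).trans_eq ?_
    · rw [inv_mul_le_iff₀ hβ, Finset.mul_sum]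
      refine (norm_sum_le _ _).trans (Finset.sum_le_sum fun k _ => ?_)
      rw [Finset.mul_sum]
      refine (norm_sum_le _ _).trans (Finset.sum_le_sum fun m hm => ?_)
      exact hterm k m fun h => (Finset.mem_filter.1 hm).2 ⟨k, h⟩
    · rw [ENNReal.ofReal_sum_of_nonneg fun _ _ => Finset.sum_nonneg fun _ _ => by positivity]
      refine Finset.sum_congr rfl fun _ _ => ?_
      rw [ENNReal.ofReal_sum_of_nonneg fun _ _ => by positivity]
  have hmeas : ∀ m n' : Λ, Measurable fun ω => ENNReal.ofReal (1 / η * ‖H₀‖) * ENNReal.ofReal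
      ‖((compression H₀ (fun j => V j ω) Λ - z • 1)⁻¹) m n'‖ := by
    intro m n'
    refine measurable_const.mul (Measurable.ennreal_ofReal (Measurable.norm ?_))
    refine measurable_inv_apply (fun i j => ?_) m n'
    simp only [Matrix.sub_apply]
    exact (measurable_compression hV Λ i j).sub measurable_const
  set B : ℝ := 1 / η * ‖H₀‖ * ((1 + β / η * |C|) * Real.exp (-κ * D)) with hB
  have hB0 : 0 ≤ B := by positivity
  have hΓcard : (Γ.card : ℝ) ≤ volumeAt d L := by
    rw [← card_centeredCube]
    exact_mod_cast Finset.card_le_card hΓ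
  calc _ ≤ ∫⁻ ω, ∑ _k : Γ, ∑ m : Λ with m ∉ Set.range (fun x : Γ => (⟨x.1, hΓ x.2⟩ : Λ)),
        ENNReal.ofReal (1 / η * ‖H₀‖) * ENNReal.ofReal
          ‖((compression H₀ (fun j => V j ω) Λ - z • 1)⁻¹) m ⟨n, hΓ hn⟩‖ ∂P := lintegral_mono hpt
    _ ≤ ∑ _k : Γ, ∑ m : Λ with m ∉ Set.range (fun x : Γ => (⟨x.1, hΓ x.2⟩ : Λ)),
        ENNReal.ofReal B := by
      rw [lintegral_finsetSum _ fun _ _ => Finset.measurable_sum _ fun m _ => hmeas m _]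
      refine Finset.sum_le_sum fun k _ => ?_
      rw [lintegral_finsetSum _ fun m _ => hmeas m _]
      refine Finset.sum_le_sum fun m hm => ?_
      rw [lintegral_const_mul' _ _ ENNReal.ofReal_ne_top, hB,
        ENNReal.ofReal_mul (p := 1 / η * ‖H₀‖) (by positivity)]
      gcongr
      refine hdecay m _ ?_
      rw [← norm_sub_rev]
      refine hdist m.1 m.2 fun hmΓ => (Finset.mem_filter.1 hm).2 ⟨⟨m.1, hmΓ⟩, rfl⟩
    _ ≤ ∑ _k : Γ, ∑ _m : Λ, ENNReal.ofReal B :=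
      Finset.sum_le_sum fun _ _ => Finset.sum_le_sum_of_subset (Finset.filter_subset _ _)
    _ = ENNReal.ofReal (Γ.card * (Λ.card * B)) := by
      simp only [Finset.sum_const, Finset.card_univ, Fintype.card_coe, nsmul_eq_mul]
      rw [ENNReal.ofReal_mul (p := (Γ.card : ℝ)) (by positivity),
        ENNReal.ofReal_mul (p := (Λ.card : ℝ)) (by positivity), ENNReal.ofReal_natCast, ENNReal.ofReal_natCast]
    _ ≤ _ := by
      apply ENNReal.ofReal_le_ofReal
      rw [le_div_iff₀ hvol, hΛ, card_centeredCube]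
      have hBK : B ≤ K * β * Real.exp (-κ * D) := by
        have : (1 + β / η * |C|) ≤ β * (1 + 1 / η * |C|) := by
          have : β / η * |C| = β * (1 / η * |C|) := by ring
          rw [this]
          linarith
        calc B ≤ 1 / η * ‖H₀‖ * ((β * (1 + 1 / η * |C|)) * Real.exp (-κ * D)) := by
              rw [hB]; gcongr
          _ = _ := by rw [hK]; ring
      calc (Γ.card : ℝ) * (volumeAt d L * B) * volumeAt d L
          ≤ volumeAt d L * (volumeAt d L * (K * β * Real.exp (-κ * D))) * volumeAt d L := by
            gcongr
        _ = K * (volumeAt d L ^ 3 * β * Real.exp (-κ * D)) := by ring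
        _ ≤ ε := hL.le

end Comparison

/-! ### Algebra of Cauchy kernels -/

theorem sub_mul_I_ne_zero {η : ℝ} (hη : η ≠ 0) (x : ℝ) : (x : ℂ) - η * Complex.I ≠ 0 := by
  intro h
  have := congrArg Complex.im h
  simp at this
  exact hη this

theorem continuous_cauchyFun {η : ℝ} (hη : η ≠ 0) : Continuous (cauchyFun η) :=
  Continuous.inv₀ (by fun_prop) (sub_mul_I_ne_zero hη)

/-- Partial fractions. Comparability is a linear condition, and this is how products of kernels
become accessible to it. -/
theorem cauchyFun_mul_cauchyFun {η η' : ℝ} (hη : η ≠ 0) (hη' : η' ≠ 0) (h : η ≠ η') (x : ℝ) :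
    cauchyFun η x * cauchyFun η' x
      = (((η : ℂ) - η') * Complex.I)⁻¹ * (cauchyFun η x - cauchyFun η' x) := by
  have h1 := sub_mul_I_ne_zero hη x
  have h2 := sub_mul_I_ne_zero hη' x
  have h3 : ((η : ℂ) - η') * Complex.I ≠ 0 :=
    mul_ne_zero (sub_ne_zero.2 (by exact_mod_cast h)) Complex.I_ne_zero
  unfold cauchyFun
  rw [inv_sub_inv h1 h2, eq_inv_mul_iff_mul_eq₀ h3]
  field_simp
  ring

theorem normSq_sub_mul_I (η x : ℝ) : ‖(x : ℂ) - η * Complex.I‖ ^ 2 = x ^ 2 + η ^ 2 := by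
  rw [← Complex.normSq_eq_norm_sq, Complex.normSq_apply]
  simp
  ring

theorem norm_cauchyFun_sq (η x : ℝ) : ‖cauchyFun η x‖ ^ 2 = (x ^ 2 + η ^ 2)⁻¹ := by
  rw [cauchyFun, norm_inv, inv_pow, normSq_sub_mul_I]

theorem cauchyFun_neg (η x : ℝ) : cauchyFun (-η) x = starRingEnd ℂ (cauchyFun η x) := by
  simp [cauchyFun]

theorem cauchyFun_one_mul (x : ℝ) :
    cauchyFun 1 x * cauchyFun (-1) x = ((1 / (1 + x ^ 2) : ℝ) : ℂ) := by
  rw [cauchyFun_neg, Complex.mul_conj, Complex.normSq_eq_norm_sq, norm_cauchyFun_sq]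
  congr 1
  rw [one_pow, add_comm, one_div]

theorem cauchyFun_one_re (x : ℝ) : (((x / (1 + x ^ 2) : ℝ)) : ℂ)
    = (1 / 2 : ℂ) * (cauchyFun 1 x + cauchyFun (-1) x) := by
  rw [cauchyFun_neg, Complex.add_conj]
  have : (cauchyFun 1 x).re = x / (1 + x ^ 2) := by
    rw [cauchyFun, Complex.inv_re, Complex.normSq_eq_norm_sq, normSq_sub_mul_I]
    simp [add_comm]
  rw [this]
  push_cast
  ring

theorem cauchyFun_one_im (x : ℝ) : (((1 / (1 + x ^ 2) : ℝ)) : ℂ)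
    = (2 * Complex.I)⁻¹ * (cauchyFun 1 x - cauchyFun (-1) x) := by
  rw [cauchyFun_neg, Complex.sub_conj]
  have : (cauchyFun 1 x).im = 1 / (1 + x ^ 2) := by
    rw [cauchyFun, Complex.inv_im, Complex.normSq_eq_norm_sq, normSq_sub_mul_I]
    simp [add_comm]
  rw [this, eq_inv_mul_iff_mul_eq₀ (by simp)]
  push_cast
  ring

/-! ### From resolvents to indicators: closure properties of comparability and Stone–Weierstrass -/

section Closure

variable {d : ℕ} {H₀ : L2 d →L[ℂ] L2 d} {hH₀ : IsSelfAdjoint H₀} {α E : ℝ}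
  {Ω : Type*} [MeasurableSpace Ω] {P : Measure Ω} {V : (Fin d → ℤ) → Ω → ℝ}

theorem Comparable.add {f g : ℝ → ℂ} (hV : ∀ j, Measurable (V j)) (hfc : Continuous f)
    (hf : Comparable hH₀ α E P V f) (hg : Comparable hH₀ α E P V g) :
    Comparable hH₀ α E P V (fun x => f x + g x) := by
  intro ε hε
  filter_upwards [hf (ε / 2) (half_pos hε), hg (ε / 2) (half_pos hε)] with L h1 h2 Γ hΓ n hn hd
  have hvol := volumeAt_pos d L
  simp only [siteObs_add, add_sub_add_comm]
  calc _ ≤ ∫⁻ ω, (‖siteObs hH₀ α E L (centeredCube d L) (fun j => V j ω) f n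
        - siteObs hH₀ α E L Γ (fun j => V j ω) f n‖ₑ
        + ‖siteObs hH₀ α E L (centeredCube d L) (fun j => V j ω) g n
        - siteObs hH₀ α E L Γ (fun j => V j ω) g n‖ₑ) ∂P :=
        lintegral_mono fun ω => enorm_add_le _ _
    _ ≤ ENNReal.ofReal (ε / 2 / volumeAt d L) + ENNReal.ofReal (ε / 2 / volumeAt d L) := by
        have hm : Measurable fun ω => ‖siteObs hH₀ α E L (centeredCube d L) (fun j => V j ω) f n
            - siteObs hH₀ α E L Γ (fun j => V j ω) f n‖ₑ :=
          ((measurable_siteObs_complex hH₀ α E L _ hV hfc n).sub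
            (measurable_siteObs_complex hH₀ α E L _ hV hfc n)).enorm
        rw [lintegral_add_left hm]
        exact add_le_add (h1 Γ hΓ n hn hd) (h2 Γ hΓ n hn hd)
    _ = _ := by
        rw [← ENNReal.ofReal_add (by positivity) (by positivity)]
        congr 1
        ring

theorem Comparable.const_mul {f : ℝ → ℂ} (c : ℂ) (hf : Comparable hH₀ α E P V f) :
    Comparable hH₀ α E P V (fun x => c * f x) := by
  intro ε hε
  filter_upwards [hf (ε / (‖c‖ + 1)) (by positivity)] with L h1 Γ hΓ n hn hd
  have hvol := volumeAt_pos d L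
  simp only [siteObs_mul_left, ← mul_sub, enorm_mul]
  rw [lintegral_const_mul' _ _ enorm_ne_top]
  calc _ ≤ ENNReal.ofReal ‖c‖ * ENNReal.ofReal (ε / (‖c‖ + 1) / volumeAt d L) := by
        rw [ofReal_norm]
        gcongr
        exact h1 Γ hΓ n hn hd
    _ ≤ _ := by
        rw [← ENNReal.ofReal_mul (norm_nonneg _)]
        apply ENNReal.ofReal_le_ofReal
        rw [← mul_div_assoc]
        gcongr
        rw [← mul_div_assoc, div_le_iff₀ (by positivity)]
        nlinarith [norm_nonneg c]

theorem Comparable.conj {f : ℝ → ℂ} (hf : Comparable hH₀ α E P V f) :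
    Comparable hH₀ α E P V (fun x => starRingEnd ℂ (f x)) := by
  intro ε hε
  filter_upwards [hf ε hε] with L h1 Γ hΓ n hn hd
  refine le_of_eq_of_le ?_ (h1 Γ hΓ n hn hd)
  refine lintegral_congr fun ω => ?_
  rw [siteObs_conj, siteObs_conj, ← map_sub, ← ofReal_norm, ← ofReal_norm, RCLike.norm_conj]

/-- Approximation by comparable functions, with errors that are small on average. -/
theorem comparable_of_approx {f : ℝ → ℂ} (hV : ∀ j, Measurable (V j))
    (h : ∀ ε > 0, ∃ (g : ℝ → ℂ) (q : ℝ → ℝ), Comparable hH₀ α E P V g ∧ Continuous q ∧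
      (∀ x, ‖f x - g x‖ ≤ q x) ∧ ∀ (L : ℕ) (Λ : Finset (Fin d → ℤ)) (n : Fin d → ℤ),
        ∫⁻ ω, ENNReal.ofReal (siteObs hH₀ α E L Λ (fun j => V j ω) q n) ∂P
          ≤ ENNReal.ofReal (ε / volumeAt d L)) : Comparable hH₀ α E P V f := by
  intro ε hε
  obtain ⟨g, q, hg, hqc, hq, hqs⟩ := h (ε / 3) (by positivity)
  filter_upwards [hg (ε / 3) (by positivity)] with L h1 Γ hΓ n hn hd
  have hvol := volumeAt_pos d L
  set Λ := centeredCube d L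
  have hm : ∀ Λ, Measurable fun ω => ENNReal.ofReal
      (siteObs hH₀ α E L Λ (fun j => V j ω) q n) :=
    fun Λ => (measurable_siteObs hH₀ α E L Λ hV hqc n).ennreal_ofReal
  have hb : ∀ Λ ω, ‖siteObs hH₀ α E L Λ (fun j => V j ω) (fun x => f x - g x) n‖ₑ
      ≤ ENNReal.ofReal (siteObs hH₀ α E L Λ (fun j => V j ω) q n) := by
    intro Λ ω
    rw [← ofReal_norm]
    exact ENNReal.ofReal_le_ofReal ((norm_siteObs_le ..).trans (siteObs_mono _ _ _ _ _ _ hq n))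
  calc _ ≤ ∫⁻ ω, (‖siteObs hH₀ α E L Λ (fun j => V j ω) g n
        - siteObs hH₀ α E L Γ (fun j => V j ω) g n‖ₑ
        + ENNReal.ofReal (siteObs hH₀ α E L Λ (fun j => V j ω) q n)
        + ENNReal.ofReal (siteObs hH₀ α E L Γ (fun j => V j ω) q n)) ∂P := by
        refine lintegral_mono fun ω => ?_
        have e1 : siteObs hH₀ α E L Λ (fun j => V j ω) f n - siteObs hH₀ α E L Γ (fun j => V j ω) f n
            = (siteObs hH₀ α E L Λ (fun j => V j ω) g n
              - siteObs hH₀ α E L Γ (fun j => V j ω) g n)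
              + siteObs hH₀ α E L Λ (fun j => V j ω) (fun x => f x - g x) n
              - siteObs hH₀ α E L Γ (fun j => V j ω) (fun x => f x - g x) n := by
          rw [siteObs_sub, siteObs_sub]; ring
        rw [e1]
        refine enorm_sub_le.trans (add_le_add ((enorm_add_le _ _).trans ?_) (hb Γ ω))
        gcongr
        exact hb Λ ω
    _ ≤ ENNReal.ofReal (ε / 3 / volumeAt d L) + ENNReal.ofReal (ε / 3 / volumeAt d L)
        + ENNReal.ofReal (ε / 3 / volumeAt d L) := by
        rw [lintegral_add_right _ (hm Γ), lintegral_add_right _ (hm Λ)]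
        exact add_le_add (add_le_add (h1 Γ hΓ n hn hd) (hqs L Λ n)) (hqs L Γ n)
    _ = _ := by
        rw [← ENNReal.ofReal_add (by positivity) (by positivity),
          ← ENNReal.ofReal_add (by positivity) (by positivity)]
        congr 1
        ring

/-- Bounded continuous functions whose product with every `1 / (x - iη)` is comparable. -/
structure CauchyComparable (hH₀ : IsSelfAdjoint H₀) (α E : ℝ) (P : Measure Ω)
    (V : (Fin d → ℤ) → Ω → ℝ) (f : ℝ → ℂ) : Prop where
  continuous : Continuous f
  bounded : ∃ M : ℝ, ∀ x, ‖f x‖ ≤ M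
  comparable : ∀ η : ℝ, η ≠ 0 → Comparable hH₀ α E P V fun x => f x * cauchyFun η x

theorem CauchyComparable.add {f g : ℝ → ℂ} (hV : ∀ j, Measurable (V j))
    (hf : CauchyComparable hH₀ α E P V f) (hg : CauchyComparable hH₀ α E P V g) :
    CauchyComparable hH₀ α E P V (fun x => f x + g x) := by
  obtain ⟨M, hM⟩ := hf.bounded
  obtain ⟨M', hM'⟩ := hg.bounded
  refine ⟨hf.continuous.add hg.continuous,
    ⟨M + M', fun x => (norm_add_le _ _).trans (add_le_add (hM x) (hM' x))⟩, fun η hη => ?_⟩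
  simp only [add_mul]
  exact (hf.comparable η hη).add hV (hf.continuous.mul (continuous_cauchyFun hη))
    (hg.comparable η hη)

theorem CauchyComparable.const_mul {f : ℝ → ℂ} (c : ℂ) (hf : CauchyComparable hH₀ α E P V f) :
    CauchyComparable hH₀ α E P V (fun x => c * f x) := by
  obtain ⟨M, hM⟩ := hf.bounded
  refine ⟨continuous_const.mul hf.continuous, ⟨‖c‖ * M, fun x => ?_⟩, fun η hη => ?_⟩
  · rw [norm_mul]
    exact mul_le_mul_of_nonneg_left (hM x) (norm_nonneg _)
  · simp only [mul_assoc]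
    exact (hf.comparable η hη).const_mul c

variable [IsProbabilityMeasure P] {μ : Measure ℝ} {C : ℝ≥0}

/-- The weight `1 / (1 + x ^ 2)` is the Poisson kernel of width one, so spectral averaging bounds
its mean at each site by a constant over the volume, which is the precision demanded. A plain
uniform error would leave `ε` per site. -/
theorem comparable_of_weighted_approx {f : ℝ → ℂ} (hα₀ : 0 < α) (hα₁ : α ≤ 1)
    (hV : IsIIDPotential P V μ) (hμ : HolderBound α C μ)
    (h : ∀ ε > 0, ∃ g : ℝ → ℂ, Comparable hH₀ α E P V g ∧
      ∀ x, ‖f x - g x‖ ≤ ε * (1 / (1 + x ^ 2))) : Comparable hH₀ α E P V f := by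
  refine comparable_of_approx hV.measurable fun ε hε => ?_
  have hK := averagingConst_nonneg C
  obtain ⟨g, hg, hfg⟩ := h (ε / (averagingConst C + 1)) (by positivity)
  refine ⟨g, _, hg, ?_, hfg, fun L Λ n => ?_⟩
  · exact continuous_const.mul (continuous_const.div (by fun_prop) fun x => by positivity)
  · have hvol := volumeAt_pos d L
    have h1 := lintegral_siteObs_poisson_le hH₀ E L Λ hα₀ hα₁ hV hμ n 0 one_pos
    simp only [sub_zero, one_pow, Real.one_rpow, mul_one, add_comm _ (1 : ℝ)] at h1
    simp only [siteObs_mul_left_real,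
      ENNReal.ofReal_mul (p := ε / (averagingConst C + 1)) (by positivity)]
    rw [lintegral_const_mul' _ _ ENNReal.ofReal_ne_top]
    calc _ ≤ ENNReal.ofReal (ε / (averagingConst C + 1)) *
          ENNReal.ofReal (averagingConst C / volumeAt d L) := by gcongr
      _ ≤ _ := by
        rw [← ENNReal.ofReal_mul (by positivity)]
        apply ENNReal.ofReal_le_ofReal
        rw [← mul_div_assoc]
        gcongr
        rw [div_mul_eq_mul_div, div_le_iff₀ (by positivity)]
        nlinarith

theorem norm_cauchyFun_le {η : ℝ} (hη : η ≠ 0) (x : ℝ) : ‖cauchyFun η x‖ ≤ |η|⁻¹ := by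
  refine (pow_le_pow_iff_left₀ (norm_nonneg _) (by positivity) two_ne_zero).1 ?_
  rw [norm_cauchyFun_sq, inv_pow, sq_abs]
  apply inv_anti₀ (by positivity)
  nlinarith [sq_nonneg x]

/-- A double pole is a limit of pairs of distinct poles, with an error that decays like the spectral
averaging weight. -/
theorem norm_cauchyFun_mul_sub_le {η : ℝ} (hη : η ≠ 0) {δ : ℝ} (hδ : 0 < δ) :
    ∃ η', η' ≠ 0 ∧ η' ≠ η ∧ ∀ x, ‖cauchyFun η x * (cauchyFun η x - cauchyFun η' x)‖
      ≤ δ * (1 / (1 + x ^ 2)) := by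
  -- The pole is moved away from the real axis by `t`, so `|η'| ≥ |η|`. The error is then at most `t
  -- / (|η| * (x ^ 2 + η ^ 2))`, and `x ^ 2 + η ^ 2` is at least `min 1 (η ^ 2) * (1 + x ^ 2)`.
  set t := min 1 (δ * (|η| * (min 1 (η ^ 2))))
  have hmin : 0 < min 1 (η ^ 2) := lt_min one_pos (by positivity)
  have ht : 0 < t := lt_min one_pos (by positivity)
  set η' := η * (1 + t / |η|)
  have habs : |η' - η| = t := by
    have : η' - η = η / |η| * t := by simp only [η']; ring
    rw [this, abs_mul, abs_div, abs_abs, div_self (abs_ne_zero.2 hη), one_mul, abs_of_pos ht]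
  have hη' : |η| ≤ |η'| := by
    simp only [η']
    rw [abs_mul, abs_of_pos (by positivity : 0 < 1 + t / |η|)]
    have : 0 ≤ t / |η| := by positivity
    nlinarith [abs_nonneg η]
  have hη'0 : η' ≠ 0 := abs_pos.1 ((abs_pos.2 hη).trans_le hη')
  have hne : η' ≠ η := fun h => by rw [h, sub_self, abs_zero] at habs; exact ht.ne habs
  refine ⟨η', hη'0, hne, fun x => ?_⟩
  have h1 := cauchyFun_mul_cauchyFun hη hη'0 hne.symm x
  have h3 : ((η : ℂ) - η') * Complex.I ≠ 0 :=
    mul_ne_zero (sub_ne_zero.2 (by exact_mod_cast hne.symm)) Complex.I_ne_zero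
  rw [eq_inv_mul_iff_mul_eq₀ h3] at h1
  have h4 : ‖((η : ℂ) - η') * Complex.I‖ = t := by
    rw [norm_mul, Complex.norm_I, mul_one, ← Complex.ofReal_sub, Complex.norm_real,
      Real.norm_eq_abs, abs_sub_comm, habs]
  rw [← h1, norm_mul, norm_mul (_ * Complex.I), h4, norm_mul (cauchyFun η x) (cauchyFun η' x)]
  have h5 : ‖cauchyFun η x‖ * ‖cauchyFun η x‖ = (x ^ 2 + η ^ 2)⁻¹ := by
    rw [← norm_cauchyFun_sq, sq]
  have h6 : ‖cauchyFun η' x‖ ≤ |η|⁻¹ :=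
    (norm_cauchyFun_le hη'0 x).trans (inv_anti₀ (abs_pos.2 hη) hη')
  have h7 : (x ^ 2 + η ^ 2)⁻¹ ≤ (min 1 (η ^ 2))⁻¹ * (1 / (1 + x ^ 2)) := by
    rw [one_div, ← mul_inv]
    apply inv_anti₀ (by positivity)
    nlinarith [min_le_left 1 (η ^ 2), min_le_right 1 (η ^ 2), sq_nonneg x]
  calc ‖cauchyFun η x‖ * (t * (‖cauchyFun η x‖ * ‖cauchyFun η' x‖))
      = t * (‖cauchyFun η x‖ * ‖cauchyFun η x‖) * ‖cauchyFun η' x‖ := by ring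
    _ ≤ (δ * (|η| * (min 1 (η ^ 2)))) * ((min 1 (η ^ 2))⁻¹ * (1 / (1 + x ^ 2))) * |η|⁻¹ := by
      rw [h5]
      gcongr
      exact min_le_right _ _
    _ = _ := by
      have := hmin.ne'
      have := abs_ne_zero.2 hη
      field_simp

/-- For a new pole different from `η₀`, partial fractions reduce the product to comparable terms.
When the poles coincide, boundedness of `f` allows one of them to be perturbed with a weighted
error. -/
theorem CauchyComparable.mul_cauchyFun {f : ℝ → ℂ} (hα₀ : 0 < α) (hα₁ : α ≤ 1)
    (hV : IsIIDPotential P V μ) (hμ : HolderBound α C μ) (hf : CauchyComparable hH₀ α E P V f)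
    {η₀ : ℝ} (hη₀ : η₀ ≠ 0) : CauchyComparable hH₀ α E P V (fun x => f x * cauchyFun η₀ x) := by
  obtain ⟨M, hM⟩ := hf.bounded
  have hM0 : 0 ≤ M := (norm_nonneg _).trans (hM 0)
  have hne : ∀ η : ℝ, η ≠ 0 → η ≠ η₀ →
      Comparable hH₀ α E P V fun x => f x * cauchyFun η₀ x * cauchyFun η x := by
    intro η hη hηη₀
    simp only [mul_assoc, cauchyFun_mul_cauchyFun hη₀ hη hηη₀.symm]
    have hc : Continuous fun x => f x * cauchyFun η₀ x :=
      hf.continuous.mul (continuous_cauchyFun hη₀)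
    have h := (Comparable.add hV.measurable hc (hf.comparable η₀ hη₀)
      ((hf.comparable η hη).const_mul (-1))).const_mul (((η₀ : ℂ) - η) * Complex.I)⁻¹
    convert h using 2
    ring
  refine ⟨hf.continuous.mul (continuous_cauchyFun hη₀), ⟨M * |η₀|⁻¹, fun x => ?_⟩, fun η hη => ?_⟩
  · rw [norm_mul]
    exact mul_le_mul (hM x) (norm_cauchyFun_le hη₀ x) (norm_nonneg _) hM0
  · by_cases h : η = η₀
    · subst h
      refine comparable_of_weighted_approx hα₀ hα₁ hV hμ fun ε hε => ?_
      obtain ⟨η', hη', hne', hb⟩ := norm_cauchyFun_mul_sub_le hη (δ := ε / (M + 1)) (by positivity)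
      refine ⟨_, hne η' hη' hne', fun x => ?_⟩
      calc _ = ‖f x‖ * ‖cauchyFun η x * (cauchyFun η x - cauchyFun η' x)‖ := by
            rw [← norm_mul]; congr 1; ring
        _ ≤ M * (ε / (M + 1) * (1 / (1 + x ^ 2))) :=
            mul_le_mul (hM x) (hb x) (norm_nonneg _) hM0
        _ = M / (M + 1) * (ε * (1 / (1 + x ^ 2))) := by ring
        _ ≤ 1 * (ε * (1 / (1 + x ^ 2))) := by
            gcongr
            rw [div_le_one (by positivity)]
            linarith
        _ = _ := one_mul _
    · exact hne η hη h

/-- Restrictions to `ℝ` of the generators `x / (1 + x²)`, `1 / (1 + x²)` of an algebra of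
continuous functions on the one point compactification. -/
def cauchyRe : C(OnePoint ℝ, ℝ) :=
  OnePoint.continuousMapMk ⟨fun x : ℝ => x / (1 + x ^ 2),
    continuous_id.div (by fun_prop) fun x => by positivity⟩ 0 (by
      rw [coclosedCompact_eq_cocompact]
      refine squeeze_zero_norm (fun x => ?_)
        (tendsto_inv_atTop_zero.comp (tendsto_norm_cocompact_atTop (E := ℝ)))
      simp only [ContinuousMap.coe_mk, Function.comp, norm_div, Real.norm_eq_abs]
      rw [abs_of_pos (by positivity : 0 < 1 + x ^ 2)]
      by_cases hx : x = 0
      · simp [hx]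
      · have := abs_pos.2 hx
        rw [div_le_iff₀ (by positivity), inv_mul_eq_div, le_div_iff₀ this]
        nlinarith [sq_abs x])

/-- The function `1 / (1 + x²)` on the one point compactification. -/
def cauchyIm : C(OnePoint ℝ, ℝ) :=
  OnePoint.continuousMapMk ⟨fun x : ℝ => 1 / (1 + x ^ 2),
    continuous_const.div (by fun_prop) fun x => by positivity⟩ 0 (by
      rw [coclosedCompact_eq_cocompact]
      have h := (tendsto_norm_cocompact_atTop (E := ℝ))
      have h2 := (tendsto_atTop_add_const_left _ (1 : ℝ)
        ((tendsto_pow_atTop two_ne_zero).comp h)).inv_tendsto_atTop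
      refine h2.congr fun x => ?_
      simp)

/-- `cauchyIm` vanishes only at infinity, and where it takes equal values at two reals, `cauchyRe`
distinguishes them because it is `x` times `cauchyIm`. -/
theorem separatesPoints_adjoin_cauchy :
    (Algebra.adjoin ℝ {cauchyRe, cauchyIm} : Subalgebra ℝ C(OnePoint ℝ, ℝ)).SeparatesPoints := by
  have hre : cauchyRe ∈ Algebra.adjoin ℝ {cauchyRe, cauchyIm} :=
    Algebra.subset_adjoin (by simp)
  have him : cauchyIm ∈ Algebra.adjoin ℝ {cauchyRe, cauchyIm} :=
    Algebra.subset_adjoin (by simp)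
  have hpos : ∀ x : ℝ, cauchyIm (x : OnePoint ℝ) ≠ cauchyIm OnePoint.infty := by
    intro x
    change 1 / (1 + x ^ 2) ≠ 0
    positivity
  intro a b hab
  by_cases h : cauchyIm a = cauchyIm b
  · refine ⟨_, ⟨_, hre, rfl⟩, ?_⟩
    induction a using OnePoint.rec with
    | infty =>
      induction b using OnePoint.rec with
      | infty => exact absurd rfl hab
      | coe y => exact absurd h.symm (hpos y)
    | coe x =>
      induction b using OnePoint.rec with
      | infty => exact absurd h (hpos x)
      | coe y =>
        change 1 / (1 + x ^ 2) = 1 / (1 + y ^ 2) at h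
        change x / (1 + x ^ 2) ≠ y / (1 + y ^ 2)
        intro h2
        rw [div_eq_mul_one_div, div_eq_mul_one_div y, h] at h2
        have : (1 / (1 + y ^ 2)) ≠ 0 := by positivity
        exact hab (congrArg _ (mul_right_cancel₀ this h2))
  · exact ⟨_, ⟨_, him, rfl⟩, h⟩

/-- Elements of the algebra are treated as multipliers acting on all `f`. With `f` quantified inside
the induction, the product case is composition of multipliers; both generators are combinations of
Cauchy kernels with poles at `i` and `-i`. -/
theorem cauchyComparable_mul_of_mem_adjoin (hα₀ : 0 < α) (hα₁ : α ≤ 1)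
    (hV : IsIIDPotential P V μ) (hμ : HolderBound α C μ) {g : C(OnePoint ℝ, ℝ)}
    (hg : g ∈ Algebra.adjoin ℝ {cauchyRe, cauchyIm}) :
    ∀ f, CauchyComparable hH₀ α E P V f →
      CauchyComparable hH₀ α E P V fun x => f x * ((g (x : OnePoint ℝ) : ℝ) : ℂ) := by
  induction hg using Algebra.adjoin_induction with
  | mem g hg =>
    intro f hf
    have h1 := hf.mul_cauchyFun hα₀ hα₁ hV hμ (one_ne_zero)
    have h2 := hf.mul_cauchyFun hα₀ hα₁ hV hμ (neg_ne_zero.2 one_ne_zero)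
    rcases hg with rfl | rfl
    · convert (h1.add hV.measurable h2).const_mul (1 / 2) using 2 with x
      have : cauchyRe (x : OnePoint ℝ) = x / (1 + x ^ 2) := rfl
      rw [this, cauchyFun_one_re]
      ring
    · convert (h1.add hV.measurable (h2.const_mul (-1))).const_mul (2 * Complex.I)⁻¹ using 2 with x
      have : cauchyIm (x : OnePoint ℝ) = 1 / (1 + x ^ 2) := rfl
      rw [this, cauchyFun_one_im]
      ring
  | algebraMap r =>
    intro f hf
    convert hf.const_mul (r : ℂ) using 2 with x
    exact mul_comm _ _
  | add g h _ _ ihg ihh =>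
    intro f hf
    convert (ihg f hf).add hV.measurable (ihh f hf) using 2 with x
    rw [ContinuousMap.add_apply]
    push_cast
    ring
  | mul g h _ _ ihg ihh =>
    intro f hf
    convert ihh _ (ihg f hf) using 2 with x
    rw [ContinuousMap.mul_apply]
    push_cast
    ring

theorem comparable_cauchyFun_of_ne_zero (hα₀ : 0 < α) (hV : ∀ j, Measurable (V j)) {a b : ℝ}
    (hE : E ∈ Set.Icc a b) (hloc : FractionalMomentLocalization H₀ P V a b) {η : ℝ} (hη : η ≠ 0) :
    Comparable hH₀ α E P V (cauchyFun η) := by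
  rcases lt_or_gt_of_ne hη with h | h
  · have := (comparable_cauchyFun hH₀ hα₀ hV hE hloc (neg_pos.2 h)).conj
    simpa only [← cauchyFun_neg, neg_neg] using this
  · exact comparable_cauchyFun hH₀ hα₀ hV hE hloc h

/-- Stone–Weierstrass is applied to the trapezoid times `1 + x ^ 2`, which has compact support and
extends by zero to infinity. Multiplying the approximant by `cauchyFun 1 * cauchyFun (-1)` removes
the factor and turns the uniform error into a weighted one. -/
theorem comparable_trapezoid (hα₀ : 0 < α) (hα₁ : α ≤ 1) (hV : IsIIDPotential P V μ)
    (hμ : HolderBound α C μ) {a b : ℝ} (hE : E ∈ Set.Icc a b)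
    (hloc : FractionalMomentLocalization H₀ P V a b) (u v : ℝ) {r : ℝ} (hr : 0 < r) :
    Comparable hH₀ α E P V fun x => ((trapezoid u v r x : ℝ) : ℂ) := by
  have hone : CauchyComparable hH₀ α E P V fun _ => 1 :=
    ⟨continuous_const, ⟨1, fun _ => by simp⟩, fun η hη => by
      simpa only [one_mul] using
        comparable_cauchyFun_of_ne_zero hα₀ hV.measurable hE hloc hη⟩
  let h : C(OnePoint ℝ, ℝ) := OnePoint.continuousMapMk
    ⟨fun x => trapezoid u v r x * (1 + x ^ 2),
      (continuous_trapezoid u v r).mul (by fun_prop)⟩ 0 (by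
      rw [coclosedCompact_eq_cocompact]
      refine tendsto_const_nhds.congr' ?_
      filter_upwards [(isCompact_Icc (a := u) (b := v)).compl_mem_cocompact] with x hx
      have : trapezoid u v r x = 0 :=
        trapezoid_of_notMem hr fun hx' => hx (Set.Ioo_subset_Icc_self hx')
      simp [this])
  refine comparable_of_weighted_approx hα₀ hα₁ hV hμ fun ε hε => ?_
  obtain ⟨⟨g, hgm⟩, hg⟩ := ContinuousMap.exists_mem_subalgebra_near_continuous_of_separatesPoints
    _ separatesPoints_adjoin_cauchy h h.continuous ε hε
  have h1 := (cauchyComparable_mul_of_mem_adjoin hα₀ hα₁ hV hμ hgm _ hone).mul_cauchyFun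
    hα₀ hα₁ hV hμ one_ne_zero |>.comparable (-1) (neg_ne_zero.2 one_ne_zero)
  refine ⟨_, h1, fun x => ?_⟩
  have h2 := (hg x).le
  have h3 : h (x : OnePoint ℝ) = trapezoid u v r x * (1 + x ^ 2) := rfl
  have h4 : (0 : ℝ) < 1 + x ^ 2 := by positivity
  rw [one_mul, mul_assoc, cauchyFun_one_mul, ← Complex.ofReal_mul, ← Complex.ofReal_sub,
    Complex.norm_real]
  have h5 : trapezoid u v r x - g (x : OnePoint ℝ) * (1 / (1 + x ^ 2))
      = (h (x : OnePoint ℝ) - g (x : OnePoint ℝ)) * (1 / (1 + x ^ 2)) := by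
    rw [h3]; field_simp
  rw [h5, norm_mul, Real.norm_of_nonneg (by positivity : 0 ≤ 1 / (1 + x ^ 2)), norm_sub_rev]
  exact mul_le_mul_of_nonneg_right h2 (by positivity)

/-- Uniform approximation fails at the jumps, but the error is confined to Poisson kernels at the
two endpoints, whose averaged contribution vanishes with their width by Hölder continuity. -/
theorem comparable_indicator (hα₀ : 0 < α) (hα₁ : α ≤ 1) (hV : IsIIDPotential P V μ)
    (hμ : HolderBound α C μ) {a b : ℝ} (hE : E ∈ Set.Icc a b)
    (hloc : FractionalMomentLocalization H₀ P V a b) (u v : ℝ) :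
    Comparable hH₀ α E P V fun x => (((Set.Ioo u v).indicator (fun _ => (1 : ℝ)) x : ℝ) : ℂ) := by
  refine comparable_of_approx hV.measurable fun ε hε => ?_
  set K := averagingConst C
  have hK : 0 ≤ K := averagingConst_nonneg C
  -- Each of the two endpoints contributes `2 r * K r ^ (α - 1) = 2 K r ^ α`, up to the volume
  -- factor.
  obtain ⟨r, hr, hrε⟩ : ∃ r > 0, 4 * K * r ^ α ≤ ε := by
    refine ⟨(ε / (4 * K + 1)) ^ (1 / α), by positivity, ?_⟩
    rw [← Real.rpow_mul (by positivity), one_div_mul_cancel hα₀.ne', Real.rpow_one,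
      mul_div_assoc', div_le_iff₀ (by positivity)]
    nlinarith
  have hpc : ∀ w : ℝ, Continuous fun x : ℝ => r / ((x - w) ^ 2 + r ^ 2) := fun w =>
    continuous_const.div (by fun_prop) fun x => by positivity
  refine ⟨_, fun x => 2 * r * (r / ((x - u) ^ 2 + r ^ 2)) + 2 * r * (r / ((x - v) ^ 2 + r ^ 2)),
    comparable_trapezoid hα₀ hα₁ hV hμ hE hloc u v hr, ?_, fun x => ?_, fun L Λ n => ?_⟩
  · exact (continuous_const.mul (hpc u)).add (continuous_const.mul (hpc v))
  · rw [← Complex.ofReal_sub, Complex.norm_real]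
    exact abs_indicator_sub_trapezoid_le hr x
  · have hvol := volumeAt_pos d L
    have hb : ∀ w : ℝ, ∫⁻ ω, ENNReal.ofReal (2 * r) * ENNReal.ofReal
        (siteObs hH₀ α E L Λ (fun j => V j ω) (fun x => r / ((x - w) ^ 2 + r ^ 2)) n) ∂P
          ≤ ENNReal.ofReal (ε / 2 / volumeAt d L) := by
      intro w
      rw [lintegral_const_mul' _ _ ENNReal.ofReal_ne_top]
      calc _ ≤ ENNReal.ofReal (2 * r) * ENNReal.ofReal (K * r ^ (α - 1) / volumeAt d L) := by
            gcongr
            exact lintegral_siteObs_poisson_le hH₀ E L Λ hα₀ hα₁ hV hμ n w hr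
        _ ≤ _ := by
            rw [← ENNReal.ofReal_mul (by positivity)]
            apply ENNReal.ofReal_le_ofReal
            rw [← mul_div_assoc, Real.rpow_sub_one hr.ne']
            gcongr
            have : 2 * r * (K * (r ^ α / r)) = 2 * K * r ^ α := by field_simp
            rw [this]
            linarith
    have hnn : ∀ (w : ℝ) (ω : Ω), 0 ≤ siteObs hH₀ α E L Λ (fun j => V j ω)
        (fun x => r / ((x - w) ^ 2 + r ^ 2)) n := fun w ω =>
      siteObs_nonneg _ _ _ _ _ _ (fun x => by positivity) _
    calc _ = ∫⁻ ω, (ENNReal.ofReal (2 * r) * ENNReal.ofReal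
            (siteObs hH₀ α E L Λ (fun j => V j ω) (fun x => r / ((x - u) ^ 2 + r ^ 2)) n)
          + ENNReal.ofReal (2 * r) * ENNReal.ofReal
            (siteObs hH₀ α E L Λ (fun j => V j ω) (fun x => r / ((x - v) ^ 2 + r ^ 2)) n)) ∂P := by
          refine lintegral_congr fun ω => ?_
          rw [siteObs_add, siteObs_mul_left_real, siteObs_mul_left_real,
            ENNReal.ofReal_add (mul_nonneg (by positivity) (hnn u ω))
              (mul_nonneg (by positivity) (hnn v ω)),
            ENNReal.ofReal_mul (p := 2 * r) (by positivity),
            ENNReal.ofReal_mul (p := 2 * r) (by positivity)]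
      _ ≤ ENNReal.ofReal (ε / 2 / volumeAt d L) + ENNReal.ofReal (ε / 2 / volumeAt d L) := by
          have hm : Measurable fun ω => ENNReal.ofReal (2 * r) * ENNReal.ofReal
              (siteObs hH₀ α E L Λ (fun j => V j ω) (fun x => r / ((x - u) ^ 2 + r ^ 2)) n) :=
            measurable_const.mul
              (measurable_siteObs hH₀ α E L Λ hV.measurable (hpc u) n).ennreal_ofReal
          rw [lintegral_add_left hm]
          exact add_le_add (hb u) (hb v)
      _ = _ := by
          rw [← ENNReal.ofReal_add (by positivity) (by positivity)]
          congr 1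
          ring

end Closure

/-! ### Partition of the cube into blocks with cores -/

section Geometry

/-- The number of small cubes per direction. -/
def blockNum (L : ℕ) : ℕ := (2 * L + 1) / blockSide L

/-- The small cubes. -/
def block (d L : ℕ) (j : Fin d → Fin (blockNum L)) : Finset (Fin d → ℤ) :=
  Finset.Icc (fun i => -(L : ℤ) + blockSide L * (j i : ℕ))
    (fun i => -(L : ℤ) + blockSide L * (j i : ℕ) + (blockSide L - 1))

/-- The small cubes without their boundary layer. -/
def blockCore (d L : ℕ) (j : Fin d → Fin (blockNum L)) : Finset (Fin d → ℤ) :=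
  Finset.Icc (fun i => -(L : ℤ) + blockSide L * (j i : ℕ) + layer L)
    (fun i => -(L : ℤ) + blockSide L * (j i : ℕ) + (blockSide L - 1) - layer L)

variable {d L : ℕ}

theorem blockSide_pos (L : ℕ) : 0 < blockSide L := Nat.sqrt_pos.2 (by omega)

theorem blockCore_subset_block (j : Fin d → Fin (blockNum L)) :
    blockCore d L j ⊆ block d L j := by
  intro x hx
  rw [blockCore, Finset.mem_Icc] at hx
  rw [block, Finset.mem_Icc]
  refine ⟨fun i => ?_, fun i => ?_⟩
  · have := hx.1 i; simp only at this ⊢; omega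
  · have := hx.2 i; simp only at this ⊢; omega

theorem block_subset_centeredCube (j : Fin d → Fin (blockNum L)) :
    block d L j ⊆ centeredCube d L := by
  intro x hx
  rw [block, Finset.mem_Icc] at hx
  rw [centeredCube, Finset.mem_Icc]
  refine ⟨fun i => ?_, fun i => ?_⟩
  · have h1 := hx.1 i
    have : (0 : ℤ) ≤ blockSide L * (j i : ℕ) := by positivity
    simp only at h1 ⊢; omega
  · have h1 := hx.2 i
    have h2 : blockSide L * ((j i : ℕ) + 1) ≤ 2 * L + 1 :=
      (Nat.mul_le_mul_left _ (j i).2).trans (Nat.mul_div_le _ _)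
    have h3 : (blockSide L : ℤ) * (j i : ℕ) + blockSide L ≤ 2 * L + 1 := by
      have : (blockSide L * ((j i : ℕ) + 1) : ℤ) ≤ 2 * L + 1 := by exact_mod_cast h2
      linarith
    simp only at h1 ⊢; linarith

theorem disjoint_block {j j' : Fin d → Fin (blockNum L)} (h : j ≠ j') :
    Disjoint (block d L j) (block d L j') := by
  rw [Finset.disjoint_left]
  intro x hx hx'
  apply h
  funext i
  rw [block, Finset.mem_Icc] at hx hx'
  have h1 := hx.1 i
  have h2 := hx.2 i
  have h3 := hx'.1 i
  have h4 := hx'.2 i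
  simp only at h1 h2 h3 h4
  have hq : (0 : ℤ) < blockSide L := by exact_mod_cast blockSide_pos L
  -- The block index is recovered from a site as a Euclidean quotient, coordinate by coordinate.
  have e : ∀ a : ℕ, -(L : ℤ) + blockSide L * a ≤ x i →
      x i ≤ -(L : ℤ) + blockSide L * a + (blockSide L - 1) →
      (x i + L) / (blockSide L : ℤ) = a := by
    intro a ha hb
    exact ((Int.ediv_emod_unique hq (r := x i + L - blockSide L * a)).2
      ⟨by ring, by linarith, by linarith⟩).1
  have := (e _ h1 h2).symm.trans (e _ h3 h4)
  exact Fin.ext (by exact_mod_cast this)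

theorem card_block (j : Fin d → Fin (blockNum L)) : (block d L j).card = blockSide L ^ d := by
  rw [block, Pi.card_Icc]
  have : ∀ i : Fin d, (Finset.Icc (-(L : ℤ) + blockSide L * (j i : ℕ))
      (-(L : ℤ) + blockSide L * (j i : ℕ) + (blockSide L - 1))).card = blockSide L := by
    intro i
    rw [Int.card_Icc]
    omega
  simp [this]

theorem card_blockCore (j : Fin d → Fin (blockNum L)) :
    (blockCore d L j).card = (blockSide L - 2 * layer L) ^ d := by
  rw [blockCore, Pi.card_Icc]
  have : ∀ i : Fin d, (Finset.Icc (-(L : ℤ) + blockSide L * (j i : ℕ) + layer L)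
      (-(L : ℤ) + blockSide L * (j i : ℕ) + (blockSide L - 1) - layer L)).card
      = blockSide L - 2 * layer L := by
    intro i
    rw [Int.card_Icc]
    omega
  simp [this]

theorem layer_le_norm_sub {j : Fin d → Fin (blockNum L)} {n m : Fin d → ℤ}
    (hn : n ∈ blockCore d L j) (hm : m ∉ block d L j) : (layer L : ℝ) ≤ ‖n - m‖ := by
  rw [blockCore, Finset.mem_Icc] at hn
  obtain ⟨i, hi⟩ : ∃ i, (layer L : ℤ) ≤ |n i - m i| := by
    by_contra! hlt
    apply hm
    rw [block, Finset.mem_Icc]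
    refine ⟨fun i => ?_, fun i => ?_⟩
    · have h1 := hn.1 i
      have h2 := (abs_lt.1 (hlt i)).2
      simp only at h1 ⊢; omega
    · have h1 := hn.2 i
      have h2 := (abs_lt.1 (hlt i)).1
      simp only at h1 ⊢; omega
  refine le_trans ?_ (norm_le_pi_norm (n - m) i)
  rw [Pi.sub_apply, Int.norm_eq_abs]
  exact_mod_cast hi

theorem sum_card_block_le : ((Finset.univ : Finset (Fin d → Fin (blockNum L))).card : ℝ)
    * (blockSide L : ℝ) ^ d ≤ volumeAt d L := by
  have h : (Finset.univ.biUnion (block d L)).card ≤ (centeredCube d L).card :=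
    Finset.card_le_card (Finset.biUnion_subset.2 fun j _ => block_subset_centeredCube j)
  rw [Finset.card_biUnion fun j _ j' _ h => disjoint_block h] at h
  simp only [card_block, Finset.sum_const, smul_eq_mul] at h
  rw [← card_centeredCube]
  exact_mod_cast h

/-- The fraction of sites that lie in the cores of the small cubes. -/
def coreFraction (d L : ℕ) : ℝ :=
  ((Finset.univ : Finset (Fin d → Fin (blockNum L))).card : ℝ)
    * ((blockSide L - 2 * layer L : ℕ) : ℝ) ^ d / volumeAt d L

theorem coreFraction_nonneg (d L : ℕ) : 0 ≤ coreFraction d L := by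
  have := volumeAt_pos d L
  unfold coreFraction
  positivity

theorem blockSide_sq_le (L : ℕ) : (blockSide L : ℝ) ^ 2 ≤ 2 * L + 1 := by
  have : blockSide L ^ 2 ≤ 2 * L + 1 := Nat.sqrt_le' _
  exact_mod_cast this

theorem coreFraction_le_one (d L : ℕ) : coreFraction d L ≤ 1 := by
  rw [coreFraction, div_le_one (volumeAt_pos d L)]
  refine le_trans ?_ sum_card_block_le
  gcongr
  exact Nat.sub_le _ _

/-- In each direction the incomplete last block wastes a fraction at most `1 / blockSide L`, and the
two boundary layers a fraction at most `2 / layer L` of each block, since each length is at most the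
square root of the next larger one. -/
theorem tendsto_coreFraction (d : ℕ) : Tendsto (coreFraction d) atTop (𝓝 1) := by
  have hq : Tendsto (fun L => (1 - (blockSide L : ℝ)⁻¹)) atTop (𝓝 (1 - 0)) :=
    tendsto_const_nhds.sub
      (tendsto_inv_atTop_zero.comp (tendsto_natCast_atTop_atTop.comp tendsto_blockSide))
  have hD : Tendsto (fun L => (1 - 2 * (layer L : ℝ)⁻¹)) atTop (𝓝 (1 - 2 * 0)) :=
    tendsto_const_nhds.sub (tendsto_const_nhds.mul
      (tendsto_inv_atTop_zero.comp (tendsto_natCast_atTop_atTop.comp tendsto_layer)))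
  have h := (hq.mul hD).pow d
  norm_num at h
  refine tendsto_of_tendsto_of_tendsto_of_le_of_le' h tendsto_const_nhds ?_
    (Eventually.of_forall fun L => coreFraction_le_one d L)
  filter_upwards [tendsto_layer.eventually_ge_atTop 2] with L hL2
  have hL : (2 : ℝ) ≤ layer L := by exact_mod_cast hL2
  have hlay : (layer L : ℝ) ^ 2 ≤ blockSide L := by
    have : layer L ^ 2 ≤ blockSide L := Nat.sqrt_le' _
    exact_mod_cast this
  have hq0 : (0 : ℝ) < blockSide L := by exact_mod_cast blockSide_pos L
  have hq1 : (1 : ℝ) ≤ blockSide L := by exact_mod_cast blockSide_pos L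
  have hsq := blockSide_sq_le L
  have hx : (0 : ℝ) < 2 * L + 1 := by positivity
  have h1 : (2 * L + 1 : ℝ) - blockSide L ≤ blockNum L * blockSide L := by
    have := Nat.lt_div_mul_add (a := 2 * L + 1) (blockSide_pos L)
    have h' : (2 * L + 1 : ℝ) < blockNum L * blockSide L + blockSide L := by
      unfold blockNum
      exact_mod_cast this
    linarith
  have h2 : (blockSide L : ℝ) - 2 * layer L ≤ ((blockSide L - 2 * layer L : ℕ) : ℝ) := by
    have : blockSide L ≤ (blockSide L - 2 * layer L) + 2 * layer L := by omega
    have h' : (blockSide L : ℝ) ≤ ((blockSide L - 2 * layer L : ℕ) : ℝ) + 2 * layer L := by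
      exact_mod_cast this
    linarith
  have h3 : 1 - (blockSide L : ℝ)⁻¹ ≤ blockNum L * blockSide L / (2 * L + 1) := by
    rw [le_div_iff₀ hx]
    have : (blockSide L : ℝ) ≤ (blockSide L : ℝ)⁻¹ * (2 * L + 1) := by
      rw [inv_mul_eq_div, le_div_iff₀ hq0]; nlinarith
    linarith
  have h4 : 1 - 2 * (layer L : ℝ)⁻¹ ≤ ((blockSide L - 2 * layer L : ℕ) : ℝ) / blockSide L := by
    rw [le_div_iff₀ hq0]
    have : (layer L : ℝ) ≤ (layer L : ℝ)⁻¹ * blockSide L := by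
      rw [inv_mul_eq_div, le_div_iff₀ (by linarith)]; nlinarith
    linarith
  have h5 : 0 ≤ 1 - (blockSide L : ℝ)⁻¹ := sub_nonneg.2 (inv_le_one_of_one_le₀ hq1)
  have h6 : 0 ≤ 1 - 2 * (layer L : ℝ)⁻¹ := by
    rw [sub_nonneg, ← div_eq_mul_inv, div_le_one (by linarith)]; exact hL
  have h7 : coreFraction d L = ((blockNum L * blockSide L / (2 * L + 1)) *
      (((blockSide L - 2 * layer L : ℕ) : ℝ) / blockSide L)) ^ d := by
    rw [coreFraction, volumeAt]
    simp only [Finset.card_univ, Fintype.card_pi, Fintype.card_fin, Finset.prod_const]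
    push_cast
    rw [← mul_pow, ← div_pow]
    congr 1
    field_simp
  rw [h7]
  gcongr

/-- Single blocks are asymptotically negligible, which makes the law of rare events applicable. In
dimension zero the density would be one. -/
theorem tendsto_block_density {d : ℕ} (hd : 1 ≤ d) :
    Tendsto (fun L => (blockSide L : ℝ) ^ d / volumeAt d L) atTop (𝓝 0) := by
  have h := tendsto_inv_atTop_zero.comp (tendsto_natCast_atTop_atTop (R := ℝ).comp tendsto_blockSide)
  refine squeeze_zero (fun L => ?_) (fun L => ?_) h
  · have := volumeAt_pos d L
    positivity
  · have hq0 : (0 : ℝ) < blockSide L := by exact_mod_cast blockSide_pos L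
    have hq1 : (1 : ℝ) ≤ blockSide L := by exact_mod_cast blockSide_pos L
    have hx : (0 : ℝ) < 2 * L + 1 := by positivity
    simp only [Function.comp]
    rw [volumeAt, ← div_pow]
    have h1 : (blockSide L : ℝ) / (2 * L + 1) ≤ (blockSide L : ℝ)⁻¹ := by
      rw [div_le_iff₀ hx, inv_mul_eq_div, le_div_iff₀ hq0]
      nlinarith [blockSide_sq_le L]
    refine (pow_le_pow_left₀ (by positivity) h1 d).trans ?_
    exact pow_le_of_le_one (by positivity) (inv_le_one_of_one_le₀ hq1) (by omega)

end Geometry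

/-! ### The cube count as a sum of block counts, in mean -/

section BlockComparison

variable {d : ℕ} {H₀ : L2 d →L[ℂ] L2 d} (hH₀ : IsSelfAdjoint H₀) {α : ℝ} (E : ℝ)
  {Ω : Type*} [MeasurableSpace Ω] {P : Measure Ω} [IsProbabilityMeasure P]
  {V : (Fin d → ℤ) → Ω → ℝ} {μ : Measure ℝ} {C : ℝ≥0}

theorem lintegral_siteObs_indicator_le (hα₀ : 0 < α) (hα₁ : α ≤ 1) (hV : IsIIDPotential P V μ)
    (hμ : HolderBound α C μ) (L : ℕ) (Λ : Finset (Fin d → ℤ)) (n : Fin d → ℤ) {u v : ℝ}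
    (huv : u < v) :
    ∫⁻ ω, ENNReal.ofReal (siteObs hH₀ α E L Λ (fun j => V j ω)
        ((Set.Ioo u v).indicator fun _ => (1 : ℝ)) n) ∂P
      ≤ ENNReal.ofReal (2 * averagingConst C * ((v - u) / 2) ^ α / volumeAt d L) := by
  have he : 0 < (v - u) / 2 := by linarith
  set c := (u + v) / 2
  set e := (v - u) / 2
  have hu : u = c - e := by simp only [c, e]; ring
  have hv : v = c + e := by simp only [c, e]; ring
  rw [hu, hv]
  calc _ ≤ ∫⁻ ω, ENNReal.ofReal (2 * e) * ENNReal.ofReal (siteObs hH₀ α E L Λ (fun j => V j ω)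
        (fun x => e / ((x - c) ^ 2 + e ^ 2)) n) ∂P := by
        refine lintegral_mono fun ω => ?_
        rw [← ENNReal.ofReal_mul (by positivity), ← siteObs_mul_left_real]
        exact ENNReal.ofReal_le_ofReal
          (siteObs_mono hH₀ α E L Λ _ (indicator_Ioo_le_poisson c he) n)
    _ ≤ ENNReal.ofReal (2 * e) * ENNReal.ofReal (averagingConst C * e ^ (α - 1) / volumeAt d L) := by
        rw [lintegral_const_mul' _ _ ENNReal.ofReal_ne_top]
        gcongr
        exact lintegral_siteObs_poisson_le hH₀ E L Λ hα₀ hα₁ hV hμ n c he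
    _ = _ := by
        rw [← ENNReal.ofReal_mul (by positivity), Real.rpow_sub_one he.ne']
        congr 1
        field_simp

/-- The sum of the eigenvalue counts of the small cubes. -/
def blockSum (α : ℝ) (L : ℕ) (ω : (Fin d → ℤ) → ℝ) (I : Set ℝ) : ℝ :=
  ∑ j : Fin d → Fin (blockNum L), (boxCount hH₀ α E L (block d L j) ω I : ℝ)

/-- Both counts are traces, hence can be split by sites: comparability controls the differences on
the cores, and the other two sums run over few sites. -/
theorem boxCount_sub_blockSum (L : ℕ) (ω : (Fin d → ℤ) → ℝ) (I : Set ℝ) :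
    (boxCount hH₀ α E L (centeredCube d L) ω I : ℝ) - blockSum hH₀ E α L ω I
      = ∑ j, ∑ n ∈ blockCore d L j,
          (siteObs hH₀ α E L (centeredCube d L) ω (I.indicator fun _ => (1 : ℝ)) n
            - siteObs hH₀ α E L (block d L j) ω (I.indicator fun _ => (1 : ℝ)) n)
        + ∑ n ∈ centeredCube d L \ Finset.univ.biUnion (blockCore d L),
            siteObs hH₀ α E L (centeredCube d L) ω (I.indicator fun _ => (1 : ℝ)) n
        - ∑ j, ∑ n ∈ block d L j \ blockCore d L j,
            siteObs hH₀ α E L (block d L j) ω (I.indicator fun _ => (1 : ℝ)) n := by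
  have hsub : Finset.univ.biUnion (blockCore d L) ⊆ centeredCube d L :=
    Finset.biUnion_subset.2 fun j _ =>
      (blockCore_subset_block j).trans (block_subset_centeredCube j)
  have h1 := Finset.sum_sdiff (f := siteObs hH₀ α E L (centeredCube d L) ω
    (I.indicator fun _ => (1 : ℝ))) hsub
  rw [Finset.sum_biUnion fun j _ j' _ h => (disjoint_block h).mono
    (blockCore_subset_block j) (blockCore_subset_block j')] at h1
  have h2 : ∀ j, _ := fun j => Finset.sum_sdiff (f := siteObs hH₀ α E L (block d L j) ω
    (I.indicator fun _ => (1 : ℝ))) (blockCore_subset_block (d := d) (L := L) j)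
  rw [blockSum, ← sum_siteObs_indicator, ← h1]
  simp only [← sum_siteObs_indicator, ← h2, Finset.sum_add_distrib, Finset.sum_sub_distrib]
  ring

theorem sum_ofReal_const {κ : Type*} (s : Finset κ) (y : ℝ) :
    ∑ _n ∈ s, ENNReal.ofReal y = ENNReal.ofReal (s.card * y) := by
  rw [Finset.sum_const, nsmul_eq_mul, ENNReal.ofReal_mul (Nat.cast_nonneg _),
    ENNReal.ofReal_natCast]

theorem sum_sum_ofReal_const {ι κ : Type*} (s : Finset ι) (t : ι → Finset κ) (y : ℝ) :
    ∑ i ∈ s, ∑ _n ∈ t i, ENNReal.ofReal y = ENNReal.ofReal ((∑ i ∈ s, ((t i).card : ℝ)) * y) := by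
  simp only [sum_ofReal_const]
  rw [← Nat.cast_sum, ENNReal.ofReal_mul (Nat.cast_nonneg _), ENNReal.ofReal_natCast,
    Nat.cast_sum, Finset.sum_mul]
  refine Finset.sum_congr rfl fun i _ => ?_
  rw [ENNReal.ofReal_mul (Nat.cast_nonneg _), ENNReal.ofReal_natCast]

set_option maxHeartbeats 1000000 in
/-- In mean, the eigenvalue count of the large cube is the sum of those of the small cubes. -/
theorem eventually_lintegral_boxCount_sub_le (hα₀ : 0 < α) (hα₁ : α ≤ 1)
    (hV : IsIIDPotential P V μ) (hμ : HolderBound α C μ) {a b : ℝ} (hE : E ∈ Set.Icc a b)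
    (hloc : FractionalMomentLocalization H₀ P V a b) {u v : ℝ} (huv : u < v) {ε : ℝ}
    (hε : 0 < ε) : ∀ᶠ L in atTop,
      ∫⁻ ω, ‖(boxCount hH₀ α E L (centeredCube d L) (fun j => V j ω) (Set.Ioo u v) : ℝ)
        - blockSum hH₀ E α L (fun j => V j ω) (Set.Ioo u v)‖ₑ ∂P ≤ ENNReal.ofReal ε := by
  set K := 2 * averagingConst C * ((v - u) / 2) ^ α with hKdef
  have h0 : 0 ≤ (v - u) / 2 := by linarith
  have hK : 0 ≤ K := mul_nonneg (mul_nonneg zero_le_two (averagingConst_nonneg C))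
    (Real.rpow_nonneg h0 _)
  have hcomp := comparable_indicator (hH₀ := hH₀) hα₀ hα₁ hV hμ hE hloc u v (ε / 2) (by positivity)
  -- The factor 2 accounts for the sites outside the cores occurring once for the cube and once for
  -- the blocks, each at a mean cost of at most `K / volumeAt d L`.
  have hfrac : Tendsto (fun L => 2 * K * (1 - coreFraction d L)) atTop (𝓝 (2 * K * (1 - 1))) :=
    tendsto_const_nhds.mul (tendsto_const_nhds.sub (tendsto_coreFraction d))
  have hfrac' := hfrac.eventually (gt_mem_nhds (show 2 * K * (1 - 1) < ε / 2 by simp; positivity))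
  filter_upwards [hcomp, hfrac'] with L hL1 hL2
  have hvol := volumeAt_pos d L
  set Λ := centeredCube d L with hΛ
  set χ : ℝ → ℝ := (Set.Ioo u v).indicator fun _ => (1 : ℝ) with hχ
  have hχ0 : ∀ x, 0 ≤ χ x := fun x => Set.indicator_nonneg (fun _ _ => zero_le_one) x
  set s : Finset (Fin d → ℤ) → Ω → (Fin d → ℤ) → ℝ := fun Γ ω n =>
    siteObs hH₀ α E L Γ (fun j => V j ω) χ n with hs
  have hs0 : ∀ Γ ω n, 0 ≤ s Γ ω n := fun Γ ω n => siteObs_nonneg hH₀ α E L Γ _ hχ0 n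
  have hsm : ∀ Γ n, Measurable fun ω => s Γ ω n := fun Γ n =>
    measurable_siteObs_indicator hH₀ α E L Γ hV.measurable u v n
  have hsb : ∀ Γ n, ∫⁻ ω, ‖s Γ ω n‖ₑ ∂P ≤ ENNReal.ofReal (K / volumeAt d L) := by
    intro Γ n
    simp only [Real.enorm_eq_ofReal (hs0 Γ _ n)]
    exact lintegral_siteObs_indicator_le hH₀ E hα₀ hα₁ hV hμ L Γ n huv
  have hdiff : ∀ j, ∀ n ∈ blockCore d L j, ∫⁻ ω, ‖s Λ ω n - s (block d L j) ω n‖ₑ ∂P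
      ≤ ENNReal.ofReal (ε / 2 / volumeAt d L) := by
    intro j n hn
    have h := hL1 (block d L j) (block_subset_centeredCube j) n (blockCore_subset_block j hn)
      fun m _ hm => layer_le_norm_sub hn hm
    simp only [siteObs_ofReal, ← Complex.ofReal_sub] at h
    refine le_of_eq_of_le (lintegral_congr fun ω => ?_) h
    rw [← ofReal_norm, ← ofReal_norm, Complex.norm_real]
  set R := Λ \ Finset.univ.biUnion (blockCore d L)
  have hmd : ∀ j n, Measurable fun ω => ‖s Λ ω n - s (block d L j) ω n‖ₑ := fun j n =>
    ((hsm _ n).sub (hsm _ n)).enorm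
  set N : ℝ := ((Finset.univ : Finset (Fin d → Fin (blockNum L))).card : ℝ)
  set k : ℝ := ((blockSide L - 2 * layer L : ℕ) : ℝ)
  have hcore : N * k ^ d = coreFraction d L * volumeAt d L := by
    rw [coreFraction, div_mul_cancel₀ _ hvol.ne']
  have hcard1 : ∑ j : Fin d → Fin (blockNum L), ((blockCore d L j).card : ℝ) = N * k ^ d := by
    simp only [card_blockCore, Finset.sum_const, nsmul_eq_mul, Nat.cast_pow]
    rfl
  have hcardR : (R.card : ℝ) = volumeAt d L - N * k ^ d := by
    have hsub : Finset.univ.biUnion (blockCore d L) ⊆ Λ :=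
      Finset.biUnion_subset.2 fun j _ =>
        (blockCore_subset_block j).trans (block_subset_centeredCube j)
    have h1 := Finset.card_sdiff_add_card_eq_card hsub
    rw [Finset.card_biUnion fun j _ j' _ h => (disjoint_block h).mono
      (blockCore_subset_block j) (blockCore_subset_block j')] at h1
    have h2 : (R.card : ℝ) + ∑ j : Fin d → Fin (blockNum L), ((blockCore d L j).card : ℝ)
        = volumeAt d L := by
      rw [← card_centeredCube]
      exact_mod_cast h1
    rw [hcard1] at h2
    linarith
  have hcard2 : ∑ j : Fin d → Fin (blockNum L), ((block d L j \ blockCore d L j).card : ℝ)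
      ≤ volumeAt d L - N * k ^ d := by
    have h1 : ∀ j : Fin d → Fin (blockNum L), ((block d L j \ blockCore d L j).card : ℝ)
        = (blockSide L : ℝ) ^ d - ((blockCore d L j).card : ℝ) := by
      intro j
      rw [Finset.cast_card_sdiff (blockCore_subset_block j), card_block, Nat.cast_pow]
    simp only [h1, Finset.sum_sub_distrib, hcard1, Finset.sum_const, nsmul_eq_mul]
    have := sum_card_block_le (d := d) (L := L)
    linarith
  calc _ ≤ ∫⁻ ω, (∑ j, ∑ n ∈ blockCore d L j, ‖s Λ ω n - s (block d L j) ω n‖ₑ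
          + ∑ n ∈ R, ‖s Λ ω n‖ₑ
          + ∑ j, ∑ n ∈ block d L j \ blockCore d L j, ‖s (block d L j) ω n‖ₑ) ∂P := by
        refine lintegral_mono fun ω => ?_
        rw [boxCount_sub_blockSum]
        refine enorm_sub_le.trans (add_le_add ((enorm_add_le _ _).trans (add_le_add ?_ ?_)) ?_)
        · exact (enorm_sum_le _ _).trans (Finset.sum_le_sum fun j _ => enorm_sum_le _ _)
        · exact enorm_sum_le _ _
        · exact (enorm_sum_le _ _).trans (Finset.sum_le_sum fun j _ => enorm_sum_le _ _)
    _ = ∑ j, ∑ n ∈ blockCore d L j, ∫⁻ ω, ‖s Λ ω n - s (block d L j) ω n‖ₑ ∂P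
          + ∑ n ∈ R, ∫⁻ ω, ‖s Λ ω n‖ₑ ∂P
          + ∑ j, ∑ n ∈ block d L j \ blockCore d L j, ∫⁻ ω, ‖s (block d L j) ω n‖ₑ ∂P := by
        have m1 : Measurable fun ω => ∑ j, ∑ n ∈ blockCore d L j,
            ‖s Λ ω n - s (block d L j) ω n‖ₑ :=
          Finset.measurable_sum _ fun j _ => Finset.measurable_sum _ fun n _ => hmd j n
        have m2 : Measurable fun ω => ∑ n ∈ R, ‖s Λ ω n‖ₑ :=
          Finset.measurable_sum _ fun n _ => (hsm _ n).enorm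
        have m12 : Measurable fun ω => ∑ j, ∑ n ∈ blockCore d L j,
            ‖s Λ ω n - s (block d L j) ω n‖ₑ + ∑ n ∈ R, ‖s Λ ω n‖ₑ := m1.add m2
        rw [lintegral_add_left m12, lintegral_add_left m1,
          lintegral_finsetSum _ fun j _ => Finset.measurable_sum _ fun n _ => hmd j n,
          lintegral_finsetSum _ fun n _ => (hsm _ n).enorm,
          lintegral_finsetSum _ fun j _ => Finset.measurable_sum _ fun n _ => (hsm _ n).enorm]
        simp only [lintegral_finsetSum _ fun n _ => hmd _ n,
          lintegral_finsetSum _ fun n _ => (hsm _ n).enorm]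
    _ ≤ ∑ j : Fin d → Fin (blockNum L), ∑ n ∈ blockCore d L j, ENNReal.ofReal (ε / 2 / volumeAt d L)
          + ∑ n ∈ R, ENNReal.ofReal (K / volumeAt d L)
          + ∑ j : Fin d → Fin (blockNum L), ∑ n ∈ block d L j \ blockCore d L j,
              ENNReal.ofReal (K / volumeAt d L) := by
        gcongr with j _ n hn n hn j _ n hn
        · exact hdiff j n hn
        · exact hsb Λ n
        · exact hsb _ n
    _ = ENNReal.ofReal (N * k ^ d * (ε / 2 / volumeAt d L))
          + ENNReal.ofReal (R.card * (K / volumeAt d L))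
          + ENNReal.ofReal ((∑ j : Fin d → Fin (blockNum L),
            ((block d L j \ blockCore d L j).card : ℝ)) * (K / volumeAt d L)) := by
        rw [sum_sum_ofReal_const, sum_sum_ofReal_const, hcard1, sum_ofReal_const]
    _ ≤ ENNReal.ofReal (N * k ^ d * (ε / 2 / volumeAt d L))
          + ENNReal.ofReal ((volumeAt d L - N * k ^ d) * (K / volumeAt d L))
          + ENNReal.ofReal ((volumeAt d L - N * k ^ d) * (K / volumeAt d L)) := by
        rw [hcardR]
        gcongr
    _ = ENNReal.ofReal (coreFraction d L * (ε / 2) + 2 * K * (1 - coreFraction d L)) := by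
        have hc0 : 0 ≤ coreFraction d L := coreFraction_nonneg d L
        have hc1 := coreFraction_le_one d L
        have e1 : N * k ^ d * (ε / 2 / volumeAt d L) = coreFraction d L * (ε / 2) := by
          rw [hcore]; field_simp
        have e2 : (volumeAt d L - N * k ^ d) * (K / volumeAt d L)
            = K * (1 - coreFraction d L) := by
          rw [hcore]; field_simp
        have p1 : 0 ≤ coreFraction d L * (ε / 2) := mul_nonneg hc0 (by linarith)
        have p2 : 0 ≤ K * (1 - coreFraction d L) := mul_nonneg hK (by linarith)
        rw [e1, e2, ← ENNReal.ofReal_add p1 p2, ← ENNReal.ofReal_add (add_nonneg p1 p2) p2]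
        congr 1
        ring
    _ ≤ ENNReal.ofReal ε := by
        apply ENNReal.ofReal_le_ofReal
        have hc1 := coreFraction_le_one d L
        nlinarith

end BlockComparison

/-! ### Characteristic functions and the law of rare events -/

section PoissonApproximation

/-- The linear approximation is exact for `k = 0` and `k = 1`, so the error can be measured by `k (k
- 1)`, the quantity in the Minami estimate. -/
theorem norm_pow_sub_one_sub_le {w : ℂ} (hw : ‖w‖ = 1) (k : ℕ) :
    ‖w ^ k - 1 - k * (w - 1)‖ ≤ 2 * ((k * (k - 1) : ℕ) : ℝ) := by
  have h2 : ‖w - 1‖ ≤ 2 := (norm_sub_le _ _).trans (by rw [hw, norm_one]; norm_num)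
  induction k with
  | zero => simp
  | succ k ih =>
    have e : w ^ (k + 1) - 1 - ((k + 1 : ℕ) : ℂ) * (w - 1)
        = w * (w ^ k - 1 - k * (w - 1)) + k * (w - 1) ^ 2 := by push_cast; ring
    rw [e]
    calc ‖w * (w ^ k - 1 - k * (w - 1)) + k * (w - 1) ^ 2‖
        ≤ ‖w ^ k - 1 - k * (w - 1)‖ + k * ‖w - 1‖ ^ 2 := by
          refine (norm_add_le _ _).trans_eq ?_
          rw [norm_mul, hw, one_mul, norm_mul, norm_pow, Complex.norm_natCast]
      _ ≤ 2 * ((k * (k - 1) : ℕ) : ℝ) + k * 2 ^ 2 := by gcongr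
      _ = _ := by
          rcases k with _ | k
          · simp
          · simp only [Nat.add_sub_cancel]
            push_cast
            ring

theorem norm_exp_sub_one_mul_le_one {w : ℂ} (hw : ‖w‖ = 1) {m : ℝ} (hm : 0 ≤ m) :
    ‖Complex.exp ((w - 1) * m)‖ ≤ 1 := by
  rw [Complex.norm_exp, Real.exp_le_one_iff]
  have h1 : w.re ≤ 1 := hw ▸ Complex.re_le_norm w
  have h2 : ((w - 1) * (m : ℂ)).re = (w.re - 1) * m := by simp
  rw [h2]
  exact mul_nonpos_of_nonpos_of_nonneg (by linarith) hm

theorem norm_prod_sub_prod_le {ι : Type*} (s : Finset ι) (f g : ι → ℂ) (hf : ∀ i ∈ s, ‖f i‖ ≤ 1)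
    (hg : ∀ i ∈ s, ‖g i‖ ≤ 1) : ‖∏ i ∈ s, f i - ∏ i ∈ s, g i‖ ≤ ∑ i ∈ s, ‖f i - g i‖ := by
  classical
  induction s using Finset.induction_on with
  | empty => simp
  | insert i s hi ih =>
    rw [Finset.prod_insert hi, Finset.prod_insert hi, Finset.sum_insert hi]
    have hf' : ‖∏ j ∈ s, f j‖ ≤ 1 := by
      rw [norm_prod]
      exact Finset.prod_le_one (fun _ _ => norm_nonneg _)
        fun j hj => hf j (Finset.mem_insert_of_mem hj)
    have e : f i * ∏ j ∈ s, f j - g i * ∏ j ∈ s, g j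
        = (f i - g i) * ∏ j ∈ s, f j + g i * (∏ j ∈ s, f j - ∏ j ∈ s, g j) := by ring
    rw [e]
    refine (norm_add_le _ _).trans (add_le_add ?_ ?_)
    · rw [norm_mul]
      exact mul_le_of_le_one_right (norm_nonneg _) hf'
    · rw [norm_mul]
      exact (mul_le_of_le_one_left (norm_nonneg _) (hg i (Finset.mem_insert_self i s))).trans
        (ih (fun j hj => hf j (Finset.mem_insert_of_mem hj))
          fun j hj => hg j (Finset.mem_insert_of_mem hj))

variable {Ω : Type*} [MeasurableSpace Ω] {P : Measure Ω} [IsProbabilityMeasure P]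

/-- The characteristic function of a counting variable that rarely exceeds one is close to that of
a Poisson variable of the same mean. -/
theorem norm_charFun_sub_poisson_le {η : Ω → ℕ} (hη : Measurable η) {θ : ℝ} (hθ : θ ≤ 1 / 2)
    (h1 : ∫⁻ ω, (η ω : ℝ≥0∞) ∂P ≤ ENNReal.ofReal θ)
    (h2 : ∫⁻ ω, ((η ω * (η ω - 1) : ℕ) : ℝ≥0∞) ∂P ≤ ENNReal.ofReal (θ ^ 2)) (hθ₀ : 0 ≤ θ) (t : ℝ) :
    ‖charFun (P.map fun ω => (η ω : ℝ)) t
      - Complex.exp ((Complex.exp (t * Complex.I) - 1) * (∫ ω, (η ω : ℝ) ∂P : ℝ))‖ ≤ 6 * θ ^ 2 := by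
  set w := Complex.exp (t * Complex.I) with hwdef
  have hw : ‖w‖ = 1 := Complex.norm_exp_ofReal_mul_I t
  have h2w : ‖w - 1‖ ≤ 2 := (norm_sub_le _ _).trans (by rw [hw, norm_one]; norm_num)
  have hmeas : Measurable fun ω => (η ω : ℝ) := measurable_from_top.comp hη
  have hmeas2 : Measurable fun ω => ((η ω * (η ω - 1) : ℕ) : ℝ) :=
    (measurable_from_top (f := fun k : ℕ => ((k * (k - 1) : ℕ) : ℝ))).comp hη
  have toReal : ∀ (q : Ω → ℕ) (c : ℝ), 0 ≤ c → Measurable (fun ω => (q ω : ℝ)) →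
      ∫⁻ ω, (q ω : ℝ≥0∞) ∂P ≤ ENNReal.ofReal c →
      Integrable (fun ω => (q ω : ℝ)) P ∧ ∫ ω, (q ω : ℝ) ∂P ≤ c := by
    intro q c hc hq h
    refine ⟨⟨hq.aestronglyMeasurable, ?_⟩, ?_⟩
    · rw [hasFiniteIntegral_iff_enorm]
      simp only [Real.enorm_natCast]
      exact h.trans_lt ENNReal.ofReal_lt_top
    · rw [integral_eq_lintegral_of_nonneg_ae (Eventually.of_forall fun _ => by positivity)
        hq.aestronglyMeasurable]
      simp only [ENNReal.ofReal_natCast]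
      exact ENNReal.toReal_le_of_le_ofReal hc h
  obtain ⟨i1, b1⟩ := toReal η θ hθ₀ hmeas h1
  obtain ⟨i2, b2⟩ := toReal (fun ω => η ω * (η ω - 1)) (θ ^ 2) (sq_nonneg θ) hmeas2 h2
  set m := ∫ ω, (η ω : ℝ) ∂P with hm
  have hm0 : 0 ≤ m := integral_nonneg fun _ => by positivity
  have hc : charFun (P.map fun ω => (η ω : ℝ)) t = ∫ ω, w ^ η ω ∂P := by
    rw [charFun_apply_real, integral_map hmeas.aemeasurable (by fun_prop)]
    refine integral_congr_ae (Eventually.of_forall fun ω => ?_)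
    simp only [hwdef, ← Complex.exp_nat_mul]
    congr 1
    push_cast
    ring
  have hwm : Measurable fun ω => w ^ η ω := measurable_from_top.comp hη
  have iw : Integrable (fun ω => w ^ η ω) P :=
    Integrable.of_bound hwm.aestronglyMeasurable 1 (Eventually.of_forall fun ω => by simp [hw])
  have iη : Integrable (fun ω => ((η ω : ℝ) : ℂ)) P := i1.ofReal
  have hlin : ∫ ω, (w ^ η ω - 1 - η ω * (w - 1)) ∂P = (∫ ω, w ^ η ω ∂P) - 1 - (w - 1) * m := by
    have e : ∀ ω, w ^ η ω - 1 - η ω * (w - 1) = w ^ η ω - 1 - ((η ω : ℝ) : ℂ) * (w - 1) := by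
      simp
    simp only [e]
    have e1 := integral_sub (iw.sub (integrable_const (1 : ℂ))) (iη.mul_const (w - 1))
    have e2 := integral_sub iw (integrable_const (μ := P) (1 : ℂ))
    simp only [Pi.sub_apply] at e1
    rw [e1, e2, integral_mul_const, integral_complex_ofReal]
    simp [hm, mul_comm]
  have a1 : ‖(∫ ω, w ^ η ω ∂P) - 1 - (w - 1) * m‖ ≤ 2 * θ ^ 2 := by
    rw [← hlin]
    calc ‖∫ ω, (w ^ η ω - 1 - η ω * (w - 1)) ∂P‖
        ≤ ∫ ω, 2 * ((η ω * (η ω - 1) : ℕ) : ℝ) ∂P :=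
          norm_integral_le_of_norm_le (i2.const_mul 2)
            (Eventually.of_forall fun ω => norm_pow_sub_one_sub_le hw (η ω))
      _ ≤ 2 * θ ^ 2 := by
          rw [integral_const_mul]
          exact mul_le_mul_of_nonneg_left b2 zero_le_two
  have hn : ‖(w - 1) * (m : ℂ)‖ ≤ 2 * θ := by
    rw [norm_mul, Complex.norm_real, Real.norm_of_nonneg hm0]
    exact mul_le_mul h2w b1 hm0 zero_le_two
  -- The quadratic bound for the exponential needs an argument of norm at most one; this is the role
  -- of `θ ≤ 1 / 2`.
  have a2 : ‖Complex.exp ((w - 1) * m) - 1 - (w - 1) * m‖ ≤ 4 * θ ^ 2 := by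
    refine (Complex.norm_exp_sub_one_sub_id_le (by linarith)).trans ?_
    calc ‖(w - 1) * (m : ℂ)‖ ^ 2 ≤ (2 * θ) ^ 2 := by gcongr
      _ = 4 * θ ^ 2 := by ring
  rw [hc]
  calc ‖(∫ ω, w ^ η ω ∂P) - Complex.exp ((w - 1) * m)‖
      = ‖((∫ ω, w ^ η ω ∂P) - 1 - (w - 1) * m)
          - (Complex.exp ((w - 1) * m) - 1 - (w - 1) * m)‖ := by congr 1; ring
    _ ≤ 2 * θ ^ 2 + 4 * θ ^ 2 := (norm_sub_le _ _).trans (add_le_add a1 a2)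
    _ = 6 * θ ^ 2 := by ring

/-- A new summand and the partial sum are functions of the variables on two disjoint index sets,
hence independent; induction then factors the characteristic function. -/
theorem charFun_sum_of_disjoint {κ ι : Type*} [DecidableEq κ] {V : κ → Ω → ℝ}
    (hVm : ∀ j, Measurable (V j)) (hV : iIndepFun V P) (S : ι → Finset κ)
    (hS : Pairwise fun i j => Disjoint (S i) (S j)) (g : ∀ i, (S i → ℝ) → ℝ)
    (hg : ∀ i, Measurable (g i)) (s : Finset ι) (t : ℝ) :
    charFun (P.map fun ω => ∑ i ∈ s, g i fun x => V x ω) t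
      = ∏ i ∈ s, charFun (P.map fun ω => g i fun x => V x ω) t := by
  classical
  have hm : ∀ i, Measurable fun ω => g i fun x => V x ω := fun i =>
    (hg i).comp (measurable_pi_lambda _ fun x => hVm x)
  induction s using Finset.induction_on with
  | empty => simp [charFun_apply_real]
  | insert i s hi ih =>
    simp only [Finset.sum_insert hi]
    rw [Finset.prod_insert hi, ← ih, ← Pi.mul_apply]
    have hdisj : Disjoint (S i) (s.biUnion S) := by
      rw [Finset.disjoint_biUnion_right]
      exact fun j hj => hS fun h => hi (h ▸ hj)
    have hind := hV.indepFun_finset (S i) (s.biUnion S) hdisj hVm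
    have hsub : ∀ j : s, ∀ x : S j, (x : κ) ∈ s.biUnion S := fun j x =>
      Finset.mem_biUnion.2 ⟨j, j.2, x.2⟩
    have hG : Measurable fun y : s.biUnion S → ℝ => ∑ j : s, g j fun x => y ⟨x, hsub j x⟩ :=
      Finset.measurable_sum _ fun j _ => (hg j).comp
        (measurable_pi_lambda _ fun x => measurable_pi_apply _)
    have h := hind.comp (hg i) hG
    have e : (fun y : s.biUnion S → ℝ => ∑ j : s, g j fun x => y ⟨x, hsub j x⟩)
        ∘ (fun ω (x : s.biUnion S) => V x ω) = fun ω => ∑ j ∈ s, g j fun x => V x ω := by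
      funext ω
      exact Finset.sum_coe_sort s fun j => g j fun x => V x ω
    rw [e] at h
    have := h.charFun_map_fun_add_eq_mul (hm i).aemeasurable
      (Finset.measurable_sum s fun j _ => hm j).aemeasurable
    exact congrFun this t

theorem norm_charFun_sub_charFun_le {X Y : Ω → ℝ} (hX : Measurable X) (hY : Measurable Y)
    {ε : ℝ} (hε : 0 ≤ ε) (h : ∫⁻ ω, ‖X ω - Y ω‖ₑ ∂P ≤ ENNReal.ofReal ε) (t : ℝ) :
    ‖charFun (P.map X) t - charFun (P.map Y) t‖ ≤ |t| * ε := by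
  have hint : Integrable (fun ω => X ω - Y ω) P :=
    ⟨(hX.sub hY).aestronglyMeasurable, h.trans_lt ENNReal.ofReal_lt_top⟩
  have hb : ∫ ω, ‖X ω - Y ω‖ ∂P ≤ ε := by
    rw [integral_norm_eq_lintegral_enorm hint.aestronglyMeasurable]
    exact ENNReal.toReal_le_of_le_ofReal hε h
  have hmx : ∀ {Z : Ω → ℝ}, Measurable Z →
      Integrable (fun ω => Complex.exp (t * Z ω * Complex.I)) P := fun {Z} hZ =>
    Integrable.of_bound (by fun_prop) 1 (Eventually.of_forall fun ω => by
      rw [← Complex.ofReal_mul, Complex.norm_exp_ofReal_mul_I])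
  rw [charFun_apply_real, charFun_apply_real, integral_map hX.aemeasurable (by fun_prop),
    integral_map hY.aemeasurable (by fun_prop), ← integral_sub (hmx hX) (hmx hY)]
  calc _ ≤ ∫ ω, |t| * ‖X ω - Y ω‖ ∂P := by
        refine norm_integral_le_of_norm_le (hint.norm.const_mul _)
          (Eventually.of_forall fun ω => ?_)
        have e : Complex.exp (t * X ω * Complex.I) - Complex.exp (t * Y ω * Complex.I)
            = Complex.exp ((t * Y ω : ℝ) * Complex.I)
              * (Complex.exp (Complex.I * (t * (X ω - Y ω) : ℝ)) - 1) := by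
          rw [mul_sub, ← Complex.exp_add, mul_one]
          push_cast
          ring_nf
        rw [e, norm_mul, Complex.norm_exp_ofReal_mul_I, one_mul]
        refine (Real.norm_exp_I_mul_ofReal_sub_one_le).trans_eq ?_
        rw [norm_mul, Real.norm_eq_abs t]
    _ ≤ |t| * ε := by
        rw [integral_const_mul]
        exact mul_le_mul_of_nonneg_left hb (abs_nonneg t)

end PoissonApproximation

/-! ### Poisson limit of the eigenvalue counts -/

section PoissonLimit

variable {d : ℕ} {H₀ : L2 d →L[ℂ] L2 d} (hH₀ : IsSelfAdjoint H₀) {α : ℝ} (E : ℝ)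
  {Ω : Type*} [MeasurableSpace Ω] {P : Measure Ω} [IsProbabilityMeasure P]
  {V : (Fin d → ℤ) → Ω → ℝ} {μ : Measure ℝ} {C : ℝ≥0}

theorem measurable_boxCount_cast (hV : ∀ j, Measurable (V j)) (L : ℕ) (Λ : Finset (Fin d → ℤ))
    (u v : ℝ) :
    Measurable fun ω => (boxCount hH₀ α E L Λ (fun j => V j ω) (Set.Ioo u v) : ℝ) :=
  measurable_from_top.comp (measurable_boxCount hH₀ α E L Λ hV u v)

theorem integrable_boxCount (hV : ∀ j, Measurable (V j)) (L : ℕ) (Λ : Finset (Fin d → ℤ))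
    (u v : ℝ) :
    Integrable (fun ω => (boxCount hH₀ α E L Λ (fun j => V j ω) (Set.Ioo u v) : ℝ)) P :=
  Integrable.of_bound (measurable_boxCount_cast hH₀ E hV L Λ u v).aestronglyMeasurable
    (Fintype.card Λ) (Eventually.of_forall fun ω => by
      rw [Real.norm_natCast]
      exact_mod_cast eigenvalueCount_le_card _ _)

theorem measurable_blockSum (hV : ∀ j, Measurable (V j)) (L : ℕ) (u v : ℝ) :
    Measurable fun ω => blockSum hH₀ E α L (fun j => V j ω) (Set.Ioo u v) :=
  Finset.measurable_sum _ fun j _ => measurable_boxCount_cast hH₀ E hV L (block d L j) u v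

theorem integrable_blockSum (hV : ∀ j, Measurable (V j)) (L : ℕ) (u v : ℝ) :
    Integrable (fun ω => blockSum hH₀ E α L (fun j => V j ω) (Set.Ioo u v)) P :=
  integrable_finsetSum _ fun j _ => integrable_boxCount hH₀ E hV L (block d L j) u v

theorem charFun_blockSum (hV : IsIIDPotential P V μ) (L : ℕ) (u v t : ℝ) :
    charFun (P.map fun ω => blockSum hH₀ E α L (fun j => V j ω) (Set.Ioo u v)) t
      = ∏ j, charFun (P.map fun ω =>
          (boxCount hH₀ α E L (block d L j) (fun i => V i ω) (Set.Ioo u v) : ℝ)) t := by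
  -- The count of a block is written as a function of the potential inside that block alone, which
  -- exposes independence.
  let g : ∀ j : Fin d → Fin (blockNum L), (block d L j → ℝ) → ℝ := fun j x =>
    (eigenvalueCount (potentialMatrix_isHermitian (compression_isHermitian hH₀ 0 (block d L j)) x)
      {y | scale d α L * (y - E) ∈ Set.Ioo u v} : ℝ)
  have hg : ∀ j, Measurable (g j) := fun j => by
    refine measurable_from_top.comp ?_
    rw [scaled_preimage_Ioo]
    exact measurable_eigenvalueCount _ (measurable_potentialMatrix _) _ _
  have e : ∀ j ω, (boxCount hH₀ α E L (block d L j) (fun i => V i ω) (Set.Ioo u v) : ℝ)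
      = g j fun x => V x ω := fun j ω =>
    congrArg Nat.cast (eigenvalueCount_congr (compression_eq_potentialMatrix H₀ _ _) _ _ _)
  unfold blockSum
  simp only [e]
  exact charFun_sum_of_disjoint hV.measurable hV.indep (block d L)
    (fun i j h => disjoint_block h) g hg Finset.univ t

/-- Each block costs `6 (K ρ) ^ 2` with `ρ` the block density. The number of blocks times `ρ` is at
most one because the blocks are disjoint in the cube, so one power of `ρ` survives. -/
theorem norm_charFun_blockSum_sub_le (hα₀ : 0 < α) (hα₁ : α ≤ 1) (hV : IsIIDPotential P V μ)
    (hμ : HolderBound α C μ) {u v : ℝ} (huv : u < v) (L : ℕ) {K : ℝ}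
    (hK : K = 2 * averagingConst C * ((v - u) / 2) ^ α)
    (hL : K * ((blockSide L : ℝ) ^ d / volumeAt d L) ≤ 1 / 2) (t : ℝ) :
    ‖charFun (P.map fun ω => blockSum hH₀ E α L (fun j => V j ω) (Set.Ioo u v)) t
      - Complex.exp ((Complex.exp (t * Complex.I) - 1)
        * (∫ ω, blockSum hH₀ E α L (fun j => V j ω) (Set.Ioo u v) ∂P : ℝ))‖
      ≤ 6 * K ^ 2 * ((blockSide L : ℝ) ^ d / volumeAt d L) := by
  have hK0 : 0 ≤ K := by
    rw [hK]
    exact mul_nonneg (mul_nonneg zero_le_two (averagingConst_nonneg C))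
      (Real.rpow_nonneg (by linarith) _)
  have hvol := volumeAt_pos d L
  set w := Complex.exp (t * Complex.I) with hwdef
  have hw : ‖w‖ = 1 := Complex.norm_exp_ofReal_mul_I t
  set ρ := (blockSide L : ℝ) ^ d / volumeAt d L with hρ
  have hρ0 : 0 ≤ ρ := by positivity
  have hcard : ∀ j, ((block d L j).card : ℝ) * (K / volumeAt d L) = K * ρ := fun j => by
    rw [card_block, hρ]
    push_cast
    ring
  let η : (Fin d → Fin (blockNum L)) → Ω → ℕ := fun j ω =>
    boxCount hH₀ α E L (block d L j) (fun i => V i ω) (Set.Ioo u v)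
  have hη : ∀ j, ‖charFun (P.map fun ω => (η j ω : ℝ)) t
      - Complex.exp ((w - 1) * (∫ ω, (η j ω : ℝ) ∂P : ℝ))‖ ≤ 6 * (K * ρ) ^ 2 := fun j => by
    have h1 := wegner hH₀ E L (block d L j) hα₀ hα₁ hV hμ huv
    have h2 := minami hH₀ E L (block d L j) hα₀ hα₁ hV hμ huv
    rw [← hK, hcard] at h1 h2
    exact norm_charFun_sub_poisson_le
      (measurable_boxCount hH₀ α E L (block d L j) hV.measurable u v) hL h1 h2 (by positivity) t
  have hint : ∫ ω, blockSum hH₀ E α L (fun j => V j ω) (Set.Ioo u v) ∂P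
      = ∑ j, ∫ ω, (η j ω : ℝ) ∂P :=
    integral_finsetSum _ fun j _ => integrable_boxCount hH₀ E hV.measurable L (block d L j) u v
  rw [charFun_blockSum hH₀ E hV, hint, Complex.ofReal_sum, Finset.mul_sum, Complex.exp_sum]
  refine (norm_prod_sub_prod_le _ _ _ (fun j _ => ?_) fun j _ => ?_).trans ?_
  · have := Measure.isProbabilityMeasure_map (μ := P)
      (measurable_boxCount_cast (α := α) hH₀ E hV.measurable L (block d L j) u v).aemeasurable
    exact norm_charFun_le_one t
  · exact norm_exp_sub_one_mul_le_one hw (integral_nonneg fun _ => Nat.cast_nonneg _)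
  · refine (Finset.sum_le_sum fun j _ => hη j).trans ?_
    rw [Finset.sum_const, nsmul_eq_mul]
    have hs := sum_card_block_le (d := d) (L := L)
    have h1 : ((Finset.univ : Finset (Fin d → Fin (blockNum L))).card : ℝ) * ρ ≤ 1 := by
      rw [hρ, ← mul_div_assoc]
      exact (div_le_one hvol).2 hs
    calc _ = (((Finset.univ : Finset (Fin d → Fin (blockNum L))).card : ℝ) * ρ)
          * (6 * K ^ 2 * ρ) := by ring
      _ ≤ 1 * (6 * K ^ 2 * ρ) := mul_le_mul_of_nonneg_right h1 (by positivity)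
      _ = _ := one_mul _

/-- The characteristic functions of the rescaled eigenvalue counts approach those of Poisson
variables with the same means. -/
theorem tendsto_charFun_boxCount_sub (hd : 1 ≤ d) (hα₀ : 0 < α) (hα₁ : α ≤ 1)
    (hV : IsIIDPotential P V μ) (hμ : HolderBound α C μ) {a b : ℝ} (hE : E ∈ Set.Icc a b)
    (hloc : FractionalMomentLocalization H₀ P V a b) {u v : ℝ} (huv : u < v) (t : ℝ)
    {Ls : ℕ → ℕ} (hLs : Tendsto Ls atTop atTop) {γ : ℝ}
    (hlim : Tendsto (fun n => ∫ ω, (boxCount hH₀ α E (Ls n) (centeredCube d (Ls n))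
      (fun j => V j ω) (Set.Ioo u v) : ℝ) ∂P) atTop (𝓝 γ)) :
    Tendsto (fun n => charFun (P.map fun ω => (boxCount hH₀ α E (Ls n) (centeredCube d (Ls n))
      (fun j => V j ω) (Set.Ioo u v) : ℝ)) t) atTop
      (𝓝 (Complex.exp ((Complex.exp (t * Complex.I) - 1) * γ))) := by
  let X : ℕ → Ω → ℝ := fun L ω =>
    (boxCount hH₀ α E L (centeredCube d L) (fun j => V j ω) (Set.Ioo u v) : ℝ)
  let Y : ℕ → Ω → ℝ := fun L ω => blockSum hH₀ E α L (fun j => V j ω) (Set.Ioo u v)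
  have hXm : ∀ L, Measurable (X L) := fun L =>
    measurable_boxCount_cast hH₀ E hV.measurable L _ u v
  have hYm : ∀ L, Measurable (Y L) := fun L => measurable_blockSum hH₀ E hV.measurable L u v
  have hXi : ∀ L, Integrable (X L) P := fun L => integrable_boxCount hH₀ E hV.measurable L _ u v
  have hYi : ∀ L, Integrable (Y L) P := fun L => integrable_blockSum hH₀ E hV.measurable L u v
  have hcmp : ∀ ε : ℝ, 0 < ε → ∀ᶠ L in atTop, ∫⁻ ω, ‖X L ω - Y L ω‖ₑ ∂P ≤ ENNReal.ofReal ε :=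
    fun ε hε => eventually_lintegral_boxCount_sub_le hH₀ E hα₀ hα₁ hV hμ hE hloc huv hε
  -- The Poisson approximation involves the mean of the block sum, whereas convergence is assumed
  -- for the mean of the cube count; closeness in mean identifies the limits.
  have hmean : Tendsto (fun L => ∫ ω, Y L ω ∂P - ∫ ω, X L ω ∂P) atTop (𝓝 0) := by
    rw [Metric.tendsto_nhds]
    intro ε hε
    filter_upwards [hcmp (ε / 2) (half_pos hε)] with L hL
    rw [dist_zero_right, norm_sub_rev, ← integral_sub (hXi L) (hYi L)]
    have h1 := norm_integral_le_integral_norm (μ := P) fun ω => X L ω - Y L ω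
    rw [integral_norm_eq_lintegral_enorm (f := fun ω => X L ω - Y L ω)
      ((hXi L).sub (hYi L)).aestronglyMeasurable] at h1
    have h2 := ENNReal.toReal_le_of_le_ofReal (half_pos hε).le hL
    exact (h1.trans h2).trans_lt (half_lt_self hε)
  have hchar : Tendsto (fun L => charFun (P.map (X L)) t - charFun (P.map (Y L)) t) atTop
      (𝓝 0) := by
    rw [Metric.tendsto_nhds]
    intro ε hε
    have hpos : 0 < ε / (|t| + 1) := by positivity
    filter_upwards [hcmp _ hpos] with L hL
    rw [dist_zero_right]
    refine (norm_charFun_sub_charFun_le (hXm L) (hYm L) hpos.le hL t).trans_lt ?_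
    rw [← mul_div_assoc, div_lt_iff₀ (by positivity)]
    nlinarith
  obtain ⟨K, hK⟩ : ∃ K : ℝ, K = 2 * averagingConst C * ((v - u) / 2) ^ α := ⟨_, rfl⟩
  have hdens := tendsto_block_density hd
  have hpoi : Tendsto (fun L => charFun (P.map (Y L)) t
      - Complex.exp ((Complex.exp (t * Complex.I) - 1) * (∫ ω, Y L ω ∂P : ℝ))) atTop (𝓝 0) := by
    have hsmall : ∀ᶠ L in atTop, K * ((blockSide L : ℝ) ^ d / volumeAt d L) ≤ 1 / 2 := by
      have h := hdens.const_mul K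
      rw [mul_zero] at h
      exact h.eventually_le_const (by norm_num)
    have hb := hdens.const_mul (6 * K ^ 2)
    rw [mul_zero] at hb
    refine squeeze_zero_norm' ?_ hb
    filter_upwards [hsmall] with L hL
    exact norm_charFun_blockSum_sub_le hH₀ E hα₀ hα₁ hV hμ huv L hK hL t
  have hYlim : Tendsto (fun n => ∫ ω, Y (Ls n) ω ∂P) atTop (𝓝 γ) := by
    have h := (hmean.comp hLs).add hlim
    rw [zero_add] at h
    refine h.congr fun n => ?_
    exact sub_add_cancel _ _
  have hexp : Tendsto (fun n => Complex.exp ((Complex.exp (t * Complex.I) - 1)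
      * (∫ ω, Y (Ls n) ω ∂P : ℝ))) atTop
      (𝓝 (Complex.exp ((Complex.exp (t * Complex.I) - 1) * γ))) :=
    (Complex.continuous_exp.tendsto _).comp
      (((Complex.continuous_ofReal.tendsto γ).comp hYlim).const_mul _)
  have h := ((hchar.comp hLs).add (hpoi.comp hLs)).add hexp
  rw [zero_add, zero_add] at h
  refine h.congr fun n => ?_
  simp only [Function.comp_apply, X]
  ring

theorem boxCount_empty (L : ℕ) (Λ : Finset (Fin d → ℤ)) (ω : (Fin d → ℤ) → ℝ) :
    boxCount hH₀ α E L Λ ω ∅ = 0 := by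
  simp [boxCount, eigenvalueCount]

end PoissonLimit

end Anderson

end

/-! ### Convergence in distribution -/

theorem mainTheorem1
    (d : ℕ) (hd : 1 ≤ d)
    (H₀ : Anderson.L2 d →L[ℂ] Anderson.L2 d) (hH₀ : IsSelfAdjoint H₀)
    (hT : Anderson.CommutesWithTranslations H₀)
    {Ω : Type*} [MeasurableSpace Ω] (P : Measure Ω) [IsProbabilityMeasure P]
    (V : (Fin d → ℤ) → Ω → ℝ) (hVmeas : ∀ j, Measurable (V j)) (hVindep : iIndepFun V P)
    (μ : Measure ℝ) (hVlaw : ∀ j, P.map (V j) = μ)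
    (α : ℝ) (hα₀ : 0 < α) (hα₁ : α ≤ 1) (hμ : Anderson.UniformlyHolder α μ)
    (a b : ℝ) (hab : a < b) (hloc : Anderson.FractionalMomentLocalization H₀ P V a b)
    (E : ℝ) (hE : E ∈ Set.Icc a b)
    (u v : ℝ) (Ls : ℕ → ℕ) (hLs : StrictMono Ls)
    (γ : ℝ≥0) (hγ : γ ≠ 0)
    (hlim : Tendsto
      (fun n => ∫ ω, (Anderson.rescaledCount hH₀ α (Ls n) E (fun j => V j ω) (Set.Ioo u v) : ℝ) ∂P)
      atTop (𝓝 (γ : ℝ))) :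
    TendstoInDistribution
      (fun n ω => (Anderson.rescaledCount hH₀ α (Ls n) E (fun j => V j ω) (Set.Ioo u v) : ℝ))
      atTop (fun k : ℕ => (k : ℝ)) (fun _ => P) (poissonMeasure γ) := by
  simp only [Anderson.rescaledCount_eq_boxCount] at hlim ⊢
  -- An empty interval would make every mean zero, against `γ ≠ 0`.
  have huv : u < v := by
    by_contra h
    rw [Set.Ioo_eq_empty h] at hlim
    simp only [Anderson.boxCount_empty, Nat.cast_zero, integral_zero] at hlim
    exact hγ (NNReal.coe_eq_zero.1 (tendsto_nhds_unique hlim tendsto_const_nhds))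
  obtain ⟨C, hC⟩ := hμ
  refine ⟨fun n => (Anderson.measurable_boxCount_cast hH₀ E hVmeas _ _ u v).aemeasurable,
    measurable_from_top.aemeasurable, ?_⟩
  refine ProbabilityMeasure.tendsto_iff_tendsto_charFun.2 fun t => ?_
  have h := Anderson.tendsto_charFun_boxCount_sub hH₀ E hd hα₀ hα₁ ⟨hVmeas, hVindep, hVlaw⟩ hC hE
    hloc huv t hLs.tendsto_atTop hlim
  have e := charFun_map_cast_poissonMeasure γ t
  rw [mul_comm] at e
  exact e ▸ h
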